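/- Throughout, $k$ is a field and $(H,\Delta,\varepsilon,\Phi,S,\alpha,\beta)$ is a quasi-Hopf algebra over $k$: $H$ is a unital associative $k$-algebra, $\Delta:H\to H\otimes H$ and $\varepsilon:H\to k$ are algebra maps, $\Phi\in H\otimes H\otimes H$ is invertible, with $$(\mathrm{id}\otimes\Delta)\Delta(h)=\Phi\,(\Delta\otimes\mathrm{id})\Delta(h)\,\Phi^{-1},\qquad (\varepsilon\otimes\mathrm{id})\Delta=\mathrm{id}=(\mathrm{id}\otimes\varepsilon)\Delta,\qquad (\mathrm{id}\otimes\varepsilon\otimes\mathrm{id})(\Phi)=1,$$ $$(\mathrm{id}\otimes\mathrm{id}\otimes\Delta)(\Phi)\,(\Delta\otimes\mathrm{id}\otimes\mathrm{id})(\Phi)=(1\otimes\Phi)\,(\mathrm{id}\otimes\Delta\otimes\mathrm{id})(\Phi)\,(\Phi\otimes1),$$ and $S$ is a bijective algebra anti-automorphism of $H$, $\alpha,\beta\in H$, with $$S(h^1)\alpha h^2=\varepsilon(h)\alpha,\quad h^1\beta S(h^2)=\varepsilon(h)\beta,\quad X\beta S(Y)\alpha Z=1,\quad S(P)\alpha Q\beta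 S(R)=1 .$$ Here $\Delta(h)=h^1\otimes h^2$, $\Phi=X\otimes Y\otimes Z$, $\Phi^{-1}=P\otimes Q\otimes R$ (summations understood; primes and indices denote further copies). **The weak center.** Left $H$-modules form a monoidal category $H\text{-mod}$: $h(m\otimes n)=h^1m\otimes h^2n$, the associativity isomorphism $(L\otimes M)\otimes N\to L\otimes(M\otimes N)$ is the action of $\Phi$, and the unit is $k$ with $h\cdot1=\varepsilon(h)$. It is biclosed. Its internal homs are $V\triangleright M=\mathrm{Hom}^l(V,M)$ and $M\triangleleft V=\mathrm{Hom}^r(V,M)$, both equal to $\mathrm{Hom}_k(V,M)$ as vector spaces, with actions $h\cdot\varphi=h^1\varphi(S(h^2)-)$, respectively $h\cdot\varphi=h^2\varphi(S^{-1}(h^1)-)$. The adjunctions $$\mathrm{Hom}_H(T\otimes V,M)\cong\mathrm{Hom}_H(T,\mathrm{Hom}^l(V,M)),\qquad \mathrm{Hom}_H(V\otimes T,M)\cong\mathrm{Hom}_H(T,\mathrm{Hom}^r(V,M))$$ have evaluations $\mathrm{ev}^l(\varphi\otimes v)=X\varphi(S(Y)\alpha Zv)$ and $\mathrm{ev}^r(v\otimes\varphi)=R\,\varphi(S^{-1}(Q)S^{-1}(\alpha)Pv)$.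 These internal homs are the two actions of the contragradient bimodule category $H\text{-mod}^{op}$. By adjunction, the associativity of $H\text{-mod}$ induces isomorphisms $$V\triangleright(W\triangleright M)\to(V\otimes W)\triangleright M,\quad V\triangleright(M\triangleleft W)\to(V\triangleright M)\triangleleft W,\quad M\triangleleft(V\otimes W)\to(M\triangleleft V)\triangleleft W .$$ An object of the weak center $\text{w-}\mathcal Z_{H\text{-mod}}(H\text{-mod}^{op})$ is an $H$-module $M$ with $H$-linear maps $\tau_V:V\triangleright M\to M\triangleleft V$, not required to be invertible, that are natural in $V\in H\text{-mod}$, satisfy $\tau_k=\mathrm{id}_M$ (under $k\triangleright M\cong M\cong M\triangleleft k$), and satisfy the hexagon axiom: the composites $$V\triangleright(W\triangleright M)\xrightarrow{\ \mathrm{id}\triangleright\tau_W\ }V\triangleright(M\triangleleft W)\to(V\triangleright M)\triangleleft W\xrightarrow{\ \tau_V\triangleleft\mathrm{id}\ }(M\triangleleft V)\triangleleft W,$$ $$V\triangleright(W\triangleright M)\to(V\otimes W)\triangleright M\xrightarrow{\ \tau_{V\otimes W}\ }M\triangleleft(V\otimes W)\to(M\triangleleft V)\triangleleft W$$ coincide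 for all $V,W$. A morphism $(M,\tau)\to(M',\tau')$ is an $H$-linear map $t:M\to M'$ with $\tau'_V(t\circ f)=t\circ\tau_V(f)$ for all $V$ and all $f\in\mathrm{Hom}_k(V,M)$. **Contramodules of type II.** Put $\kappa(x)=S(Z^2)\,x\,Y\,S^{-1}(\beta)\,S^{-1}(X)$; in an expression $Z^1\cdots\kappa(x)\cdots$ the factor $Z^1$ and $\kappa$ come from the same copy of $\Phi$, with $\Delta(Z)=Z^1\otimes Z^2$. Let $F=F^1\otimes F^2\in H\otimes H$ be Drinfeld's twist, $F\Delta(S(h))F^{-1}=(S\otimes S)\Delta^{op}(h)$: $$F=(S\otimes S)(\Delta^{op}(P))\cdot\gamma\cdot\Delta(Q\beta S(R)),\qquad F^{-1}=\Delta(S(P)\alpha Q)\cdot\delta\cdot(S\otimes S)(\Delta^{op}(R)),$$ $$\gamma=S(U)\alpha V\otimes S(T)\alpha W\ \text{ for }\ T\otimes U\otimes V\otimes W=(1\otimes\Phi^{-1})(\mathrm{id}\otimes\mathrm{id}\otimes\Delta)(\Phi),$$ $$\delta=K\beta S(N)\otimes L\beta S(M)\ \text{ for }\ K\otimes L\otimes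 M\otimes N=(\mathrm{id}\otimes\mathrm{id}\otimes\Delta)(\Phi^{-1})(1\otimes\Phi).$$ Let $G=G^1\otimes G^2=S^{-1}(b)\otimes S^{-1}(a)$, where $F^{-1}=a\otimes b$. (If $H$ is a Hopf algebra with $\Phi=1$ and $\alpha=\beta=1$, then $F=G=1\otimes1$.) A *left-right anti-Yetter–Drinfeld (aYD) contramodule of type II* is a left $H$-module $M$ with a $k$-linear map $\nu:\mathrm{Hom}_k(H,M)\to M$ such that 1. $h\cdot\nu(f)=\nu\big(x\mapsto h^{21}f(S(h^{22})\,x\,h^1)\big)$ for all $h\in H$, $f\in\mathrm{Hom}_k(H,M)$; 2. for all $k$-bilinear $f:H\times H\to M$, $(v,w)\mapsto f_v(w)$, $$\nu\Big(h\mapsto Z_1^1Y\,\nu\big(x\mapsto Z_2^1\,f_{S(Z)\kappa_1(h)}(\kappa_2(x)\,S^{-1}(X))\big)\Big)=Z\,\nu\Big(h\mapsto Z_1^1X'\,f_{S(Z')F^1\kappa_1(h)^1G^1S^{-1}(Y)}\big(S(Y')F^2\kappa_1(h)^2G^2S^{-1}(X)\big)\Big),$$ where $\kappa_i$ and $Z_i^1$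 are formed from the $i$-th copy $X_i\otimes Y_i\otimes Z_i$ of $\Phi$; 3. $\nu\big(x\mapsto\varepsilon(\beta)\varepsilon(x)m\big)=m$ for all $m\in M$. A morphism $(M,\nu)\to(M',\nu')$ is an $H$-linear map $t:M\to M'$ with $t(\nu(f))=\nu'(t\circ f)$. **Theorem.** The category of aYD contramodules of type II over $H$ is isomorphic to the weak center $\text{w-}\mathcal Z_{H\text{-mod}}(H\text{-mod}^{op})$. More precisely, there are mutually inverse functors between the two categories that leave the underlying $H$-modules and $H$-linear maps unchanged and are given on objects by $$(M,\nu)\mapsto(M,\tau),\qquad \tau_V(f)(v)=\nu\big(x\mapsto Z^1f(\kappa(x)v)\big)\quad(f\in\mathrm{Hom}_k(V,M),\ v\in V),$$ $$(M,\tau)\mapsto(M,\nu),\qquad \nu(f)=\mathrm{ev}^r(1\otimes\tau_H(f))=R\cdot\tau_H(f)\big(S^{-1}(Q)S^{-1}(\alpha)P\big)\quad(f\in\mathrm{Hom}_k(H,M)).$$ -/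

import Mathlib

open CategoryTheory MonoidalCategory
open scoped TensorProduct

universe u

/-! ### Quasi-Hopf algebras -/

namespace QHopf

section Basic

variable {k : Type u} [Field k]

/-- `x ⊗ y ↦ f x * a * g y`. -/
noncomputable def mulWith {A B C : Type u} [AddCommGroup A] [Module k A] [AddCommGroup B]
    [Module k B] [Ring C] [Algebra k C] (f : A →ₗ[k] C) (a : C) (g : B →ₗ[k] C) :
    A ⊗[k] B →ₗ[k] C :=
  TensorProduct.lift (((LinearMap.mul k C).compl₁₂ ((LinearMap.mulRight k a) ∘ₗ f) g))

@[simp] lemma mulWith_tmul {A B C : Type u} [AddCommGroup A] [Module k A] [AddCommGroup B]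
    [Module k B] [Ring C] [Algebra k C] (f : A →ₗ[k] C) (a : C) (g : B →ₗ[k] C) (x : A) (y : B) :
    mulWith f a g (x ⊗ₜ y) = f x * a * g y := rfl

/-- An anti-automorphism `S` of an algebra `H`, viewed as a linear bijection `H → H`. -/
def antiLin {H : Type u} [Ring H] [Algebra k H] (S : H ≃ₐ[k] Hᵐᵒᵖ) : H ≃ₗ[k] H :=
  S.toLinearEquiv.trans (MulOpposite.opLinearEquiv k).symm

end Basic

end QHopf

/-- A quasi-bialgebra `(H, Δ, ε, Φ)` over a field `k`. Triple tensor powers are bracketed to the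
right, `H ⊗ (H ⊗ H)`. -/
class QuasiBialgebra (k H : Type u) [Field k] [Ring H] [Algebra k H] where
  /-- the comultiplication `Δ` -/
  comul : H →ₐ[k] H ⊗[k] H
  /-- the counit `ε` -/
  counit : H →ₐ[k] k
  /-- the (invertible) associator `Φ` -/
  assoc : (H ⊗[k] (H ⊗[k] H))ˣ
  /-- `(id ⊗ Δ)(Δ a) = Φ · (Δ ⊗ id)(Δ a) · Φ⁻¹` -/
  coassoc : ∀ a : H,
    Algebra.TensorProduct.map (AlgHom.id k H) comul (comul a) =
      assoc * Algebra.TensorProduct.assoc k k k H H H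
        (Algebra.TensorProduct.map comul (AlgHom.id k H) (comul a)) * (assoc⁻¹ : _ˣ)
  /-- `(id ⊗ id ⊗ Δ)(Φ) · (Δ ⊗ id ⊗ id)(Φ) = (1 ⊗ Φ) · (id ⊗ Δ ⊗ id)(Φ) · (Φ ⊗ 1)` -/
  pentagon :
    Algebra.TensorProduct.map (AlgHom.id k H) (Algebra.TensorProduct.map (AlgHom.id k H) comul)
        (assoc : H ⊗[k] (H ⊗[k] H)) *
      Algebra.TensorProduct.assoc k k k H H (H ⊗[k] H)
        (Algebra.TensorProduct.map comul (AlgHom.id k (H ⊗[k] H)) (assoc : H ⊗[k] (H ⊗[k] H))) =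
    ((1 : H) ⊗ₜ[k] (assoc : H ⊗[k] (H ⊗[k] H))) *
      Algebra.TensorProduct.map (AlgHom.id k H)
        ((Algebra.TensorProduct.assoc k k k H H H).toAlgHom.comp
          (Algebra.TensorProduct.map comul (AlgHom.id k H))) (assoc : H ⊗[k] (H ⊗[k] H)) *
      Algebra.TensorProduct.map (AlgHom.id k H)
        (Algebra.TensorProduct.assoc k k k H H H).toAlgHom
        (Algebra.TensorProduct.assoc k k k H (H ⊗[k] H) H
          ((assoc : H ⊗[k] (H ⊗[k] H)) ⊗ₜ[k] (1 : H)))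
  /-- `(ε ⊗ id)(Δ a) = a` -/
  counit_left : ∀ a : H, Algebra.TensorProduct.lid k H
    (Algebra.TensorProduct.map counit (AlgHom.id k H) (comul a)) = a
  /-- `(id ⊗ ε)(Δ a) = a` -/
  counit_right : ∀ a : H, Algebra.TensorProduct.rid k k H
    (Algebra.TensorProduct.map (AlgHom.id k H) counit (comul a)) = a
  /-- `(id ⊗ ε ⊗ id)(Φ) = 1 ⊗ 1` -/
  counit_assoc : Algebra.TensorProduct.map (AlgHom.id k H)
    ((Algebra.TensorProduct.lid k H).toAlgHom.comp
      (Algebra.TensorProduct.map counit (AlgHom.id k H))) (assoc : H ⊗[k] (H ⊗[k] H)) = 1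

open QHopf in
/-- A quasi-Hopf algebra: a quasi-bialgebra with elements `α`, `β` and an invertible
anti-automorphism `S`. Sweedler notation: `Φ = X ⊗ Y ⊗ Z`, `Φ⁻¹ = P ⊗ Q ⊗ R`. -/
class QuasiHopfAlgebra (k H : Type u) [Field k] [Ring H] [Algebra k H] extends
    QuasiBialgebra k H where
  /-- the antipode `S`, an algebra isomorphism onto the opposite algebra -/
  antipode : H ≃ₐ[k] Hᵐᵒᵖ
  /-- the element `α` -/
  α : H
  /-- the element `β` -/
  β : H
  /-- `S(h¹) α h² = ε(h) α` -/
  antipode_α : ∀ h : H,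
    mulWith (antiLin antipode).toLinearMap α LinearMap.id (comul h) = counit h • α
  /-- `h¹ β S(h²) = ε(h) β` -/
  antipode_β : ∀ h : H,
    mulWith LinearMap.id β (antiLin antipode).toLinearMap (comul h) = counit h • β
  /-- `X β S(Y) α Z = 1` -/
  assoc_antipode : mulWith LinearMap.id β (mulWith (antiLin antipode).toLinearMap α LinearMap.id)
    (assoc : H ⊗[k] (H ⊗[k] H)) = 1
  /-- `S(P) α Q β S(R) = 1` -/
  assoc_inv_antipode : mulWith (antiLin antipode).toLinearMap α
    (mulWith LinearMap.id β (antiLin antipode).toLinearMap)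
    ((assoc⁻¹ : (H ⊗[k] (H ⊗[k] H))ˣ) : H ⊗[k] (H ⊗[k] H)) = 1

namespace QHopf

/-- The associator `Φ = X ⊗ Y ⊗ Z`. -/
abbrev Phi (k H : Type u) [Field k] [Ring H] [Algebra k H] [QuasiBialgebra k H] :
    H ⊗[k] (H ⊗[k] H) :=
  Units.val (QuasiBialgebra.assoc (k := k) (H := H))

/-- The inverse associator `Φ⁻¹ = P ⊗ Q ⊗ R`. -/
abbrev PhiInv (k H : Type u) [Field k] [Ring H] [Algebra k H] [QuasiBialgebra k H] :
    H ⊗[k] (H ⊗[k] H) :=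
  Units.val (QuasiBialgebra.assoc (k := k) (H := H))⁻¹

/-! ### Actions of tensor products of algebras -/

section Act

variable {k : Type u} [Field k]
variable {A B C D : Type u} [Ring A] [Algebra k A] [Ring B] [Algebra k B] [Ring C] [Algebra k C]
  [Ring D] [Algebra k D]
variable {L M N P : Type u} [AddCommGroup L] [Module k L] [AddCommGroup M] [Module k M]
  [AddCommGroup N] [Module k N] [AddCommGroup P] [Module k P]

/-- The action of `A ⊗ B` on `M ⊗ N`, `(a ⊗ b)(m ⊗ n) = a m ⊗ b n`. -/
noncomputable def tensorAct (ρ : A →ₐ[k] Module.End k M) (σ : B →ₐ[k] Module.End k N) :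
    A ⊗[k] B →ₐ[k] Module.End k (M ⊗[k] N) :=
  (Module.endTensorEndAlgHom (R := k) (S := k) (A := k) (M := M) (N := N)).comp
    (Algebra.TensorProduct.map ρ σ)

@[simp] lemma tensorAct_tmul (ρ : A →ₐ[k] Module.End k M) (σ : B →ₐ[k] Module.End k N)
    (a : A) (b : B) (m : M) (n : N) :
    tensorAct ρ σ (a ⊗ₜ b) (m ⊗ₜ n) = ρ a m ⊗ₜ σ b n := rfl

lemma tensorAct_comp (ρ : A →ₐ[k] Module.End k M) (σ : B →ₐ[k] Module.End k N)
    (f : C →ₐ[k] A) (g : D →ₐ[k] B) (x : C ⊗[k] D) :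
    tensorAct (ρ.comp f) (σ.comp g) x = tensorAct ρ σ (Algebra.TensorProduct.map f g x) := by
  induction x with
  | zero => simp
  | tmul x y => ext m n; simp
  | add x y hx hy => simp [hx, hy]

lemma tensorAct_intertwine {M' N' : Type u} [AddCommGroup M'] [Module k M'] [AddCommGroup N']
    [Module k N'] (ρ : A →ₐ[k] Module.End k M) (σ : B →ₐ[k] Module.End k N)
    (ρ' : C →ₐ[k] Module.End k M') (σ' : D →ₐ[k] Module.End k N') (p : A →ₐ[k] C)
    (q : B →ₐ[k] D) (f : M →ₗ[k] M') (g : N →ₗ[k] N') (hf : ∀ a m, f (ρ a m) = ρ' (p a) (f m))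
    (hg : ∀ b n, g (σ b n) = σ' (q b) (g n)) (x : A ⊗[k] B) (t : M ⊗[k] N) :
    TensorProduct.map f g (tensorAct ρ σ x t) =
      tensorAct ρ' σ' (Algebra.TensorProduct.map p q x) (TensorProduct.map f g t) := by
  induction x with
  | zero => simp
  | add x y hx hy => simp [hx, hy]
  | tmul a b =>
    induction t with
    | zero => simp
    | add x y hx hy => simp only [map_add, hx, hy]
    | tmul m n => simp [hf, hg]

lemma assoc_tensorAct (ρ : A →ₐ[k] Module.End k M) (σ : B →ₐ[k] Module.End k N)
    (τ : C →ₐ[k] Module.End k L) (x : (A ⊗[k] B) ⊗[k] C) (t : (M ⊗[k] N) ⊗[k] L) :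
    TensorProduct.assoc k M N L (tensorAct (tensorAct ρ σ) τ x t) =
      tensorAct ρ (tensorAct σ τ) (Algebra.TensorProduct.assoc k k k A B C x)
        (TensorProduct.assoc k M N L t) := by
  induction x with
  | zero => simp
  | add x y hx hy => simp [hx, hy]
  | tmul ab c =>
    induction ab with
    | zero => simp
    | add x y hx hy => simp only [TensorProduct.add_tmul, map_add, LinearMap.add_apply, hx, hy]
    | tmul a b =>
      induction t with
      | zero => simp
      | add x y hx hy => simp only [map_add, hx, hy]
      | tmul mn l =>
        induction mn with
        | zero => simp
        | add x y hx hy => simp only [TensorProduct.add_tmul, map_add, hx, hy]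
        | tmul m n => simp

end Act

end QHopf

/-! ### The category of modules over a quasi-Hopf algebra -/

/-- A left module over the `k`-algebra `H`: a `k`-vector space `M` with an algebra map
`H → End_k(M)`. -/
structure QHMod (k H : Type u) [Field k] [Ring H] [Algebra k H] where
  /-- the underlying vector space -/
  carrier : Type u
  [addCommGroup : AddCommGroup carrier]
  [module : Module k carrier]
  /-- the action of `H` -/
  ρ : H →ₐ[k] Module.End k carrier

namespace QHMod

open QHopf

section Category

variable {k H : Type u} [Field k] [Ring H] [Algebra k H]

instance : CoeSort (QHMod k H) (Type u) := ⟨QHMod.carrier⟩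

instance (M : QHMod k H) : AddCommGroup M := M.addCommGroup
instance (M : QHMod k H) : Module k M := M.module

/-- Morphisms of `H`-modules are the `H`-linear maps. -/
@[ext] structure Hom (M N : QHMod k H) where
  /-- the underlying `k`-linear map -/
  lin : M →ₗ[k] N
  comm : ∀ (h : H) (m : M), lin (M.ρ h m) = N.ρ h (lin m)

instance : Category (QHMod k H) where
  Hom := Hom
  id M := ⟨LinearMap.id, fun _ _ => rfl⟩
  comp f g := ⟨g.lin ∘ₗ f.lin, fun h m => by simp [f.comm, g.comm]⟩

@[ext] lemma hom_ext {M N : QHMod k H} {f g : M ⟶ N} (h : f.lin = g.lin) : f = g := Hom.ext h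

@[simp] lemma id_lin (M : QHMod k H) : Hom.lin (𝟙 M) = LinearMap.id := rfl

@[simp] lemma comp_lin {M N P : QHMod k H} (f : M ⟶ N) (g : N ⟶ P) :
    (f ≫ g).lin = g.lin ∘ₗ f.lin := rfl

/-- `H`-linear bijections are isomorphisms. -/
def mkIso {M N : QHMod k H} (e : M ≃ₗ[k] N) (he : ∀ h m, e (M.ρ h m) = N.ρ h (e m)) : M ≅ N where
  hom := ⟨e.toLinearMap, he⟩
  inv := ⟨e.symm.toLinearMap, fun h m => by
    apply e.injective
    have := he h (e.symm m)
    simp at this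
    simp [this]⟩
  hom_inv_id := by ext; simp
  inv_hom_id := by ext; simp

/-- `H` as a left module over itself. -/
noncomputable abbrev regular (k H : Type u) [Field k] [Ring H] [Algebra k H] : QHMod k H where
  carrier := H
  ρ := Algebra.lmul k H

end Category

section Monoidal

variable {k H : Type u} [Field k] [Ring H] [Algebra k H] [QuasiBialgebra k H]

open QuasiBialgebra

/-- `M ⊗ N` with `h (m ⊗ n) = h¹ m ⊗ h² n`. -/
noncomputable abbrev tensor (M N : QHMod k H) : QHMod k H where
  carrier := M ⊗[k] N
  ρ := (tensorAct M.ρ N.ρ).comp comul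

/-- The unit object: `k` with `h · c = ε(h) c`. -/
noncomputable abbrev unit (k H : Type u) [Field k] [Ring H] [Algebra k H] [QuasiBialgebra k H] :
    QHMod k H where
  carrier := k
  ρ := (Algebra.lmul k k).comp counit

/-- The tensor product of two morphisms. -/
noncomputable def tensorMap {M M' N N' : QHMod k H} (f : M ⟶ M') (g : N ⟶ N') :
    tensor M N ⟶ tensor M' N' where
  lin := TensorProduct.map f.lin g.lin
  comm h t := by
    have := tensorAct_intertwine M.ρ N.ρ M'.ρ N'.ρ (AlgHom.id k H) (AlgHom.id k H) f.lin g.lin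
      f.comm g.comm (comul h) t
    rw [Algebra.TensorProduct.map_id] at this
    exact this

/-- The action of `H ⊗ (H ⊗ H)` on `M ⊗ (N ⊗ L)`. -/
noncomputable def act₃ (M N L : QHMod k H) :
    H ⊗[k] (H ⊗[k] H) →ₐ[k] Module.End k (M ⊗[k] (N ⊗[k] L)) :=
  tensorAct M.ρ (tensorAct N.ρ L.ρ)

/-- Invertible elements act by linear bijections. -/
noncomputable def unitAct {A V : Type u} [Ring A] [Algebra k A] [AddCommGroup V] [Module k V]
    (ρ : A →ₐ[k] Module.End k V) (a : Aˣ) : V ≃ₗ[k] V :=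
  LinearEquiv.ofLinearMap (ρ a) (ρ (a⁻¹ : Aˣ))
    (by rw [← Module.End.mul_eq_comp, ← map_mul]; simp [Module.End.one_eq_id])
    (by rw [← Module.End.mul_eq_comp, ← map_mul]; simp [Module.End.one_eq_id])

@[simp] lemma unitAct_apply {A V : Type u} [Ring A] [Algebra k A] [AddCommGroup V] [Module k V]
    (ρ : A →ₐ[k] Module.End k V) (a : Aˣ) (v : V) : unitAct ρ a v = ρ a v := rfl

lemma tensor_tensor_ρ (M N L : QHMod k H) (h : H) :
    (tensor (tensor M N) L).ρ h = tensorAct (tensorAct M.ρ N.ρ) L.ρ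
        (Algebra.TensorProduct.map comul (AlgHom.id k H) (comul h)) :=
  tensorAct_comp (tensorAct M.ρ N.ρ) L.ρ comul (AlgHom.id k H) (comul h)

lemma tensor_tensor_ρ' (M N L : QHMod k H) (h : H) :
    (tensor M (tensor N L)).ρ h = act₃ M N L
        (Algebra.TensorProduct.map (AlgHom.id k H) comul (comul h)) :=
  tensorAct_comp M.ρ (tensorAct N.ρ L.ρ) (AlgHom.id k H) comul (comul h)

/-- The associativity isomorphism `(m ⊗ n) ⊗ l ↦ X m ⊗ (Y n ⊗ Z l)`. -/
noncomputable def associator (M N L : QHMod k H) :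
    tensor (tensor M N) L ≅ tensor M (tensor N L) :=
  mkIso ((TensorProduct.assoc k M N L).trans (unitAct (act₃ M N L) assoc)) (fun h t => by
    rw [tensor_tensor_ρ, tensor_tensor_ρ', LinearEquiv.trans_apply, LinearEquiv.trans_apply,
      assoc_tensorAct, unitAct_apply, unitAct_apply, act₃, ← Module.End.mul_apply,
      ← Module.End.mul_apply, ← map_mul, ← map_mul, coassoc]
    simp [mul_assoc])

end Monoidal

end QHMod

namespace QHMod

open QHopf

section Monoidal

variable {k H : Type u} [Field k] [Ring H] [Algebra k H] [QuasiBialgebra k H]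

open QuasiBialgebra

lemma lid_tensorAct (M : QHMod k H) (x : H ⊗[k] H) (t : k ⊗[k] M) :
    TensorProduct.lid k M (tensorAct (unit k H).ρ M.ρ x t) =
      M.ρ (Algebra.TensorProduct.lid k H
        (Algebra.TensorProduct.map counit (AlgHom.id k H) x)) (TensorProduct.lid k M t) := by
  induction x with
  | zero => simp
  | add x y hx hy => simp only [map_add, LinearMap.add_apply, hx, hy]
  | tmul a b =>
    induction t with
    | zero => simp
    | add x y hx hy => simp only [map_add, hx, hy]
    | tmul c m => simpa [mul_smul] using smul_comm _ _ _

lemma rid_tensorAct (M : QHMod k H) (x : H ⊗[k] H) (t : M ⊗[k] k) :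
    TensorProduct.rid k M (tensorAct M.ρ (unit k H).ρ x t) =
      M.ρ (Algebra.TensorProduct.rid k k H
        (Algebra.TensorProduct.map (AlgHom.id k H) counit x)) (TensorProduct.rid k M t) := by
  induction x with
  | zero => simp
  | add x y hx hy => simp only [map_add, LinearMap.add_apply, hx, hy]
  | tmul a b =>
    induction t with
    | zero => simp
    | add x y hx hy => simp only [map_add, hx, hy]
    | tmul c m => simpa [mul_smul] using smul_comm _ _ _

/-- The left unit isomorphism `c ⊗ m ↦ c m`. -/
noncomputable def leftUnitor (M : QHMod k H) : tensor (unit k H) M ≅ M :=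
  mkIso (TensorProduct.lid k M) (fun h t => by
    have := lid_tensorAct M (comul h) t
    rw [counit_left] at this
    exact this)

/-- The right unit isomorphism `m ⊗ c ↦ c m`. -/
noncomputable def rightUnitor (M : QHMod k H) : tensor M (unit k H) ≅ M :=
  mkIso (TensorProduct.rid k M) (fun h t => by
    have := rid_tensorAct M (comul h) t
    rw [counit_right] at this
    exact this)

noncomputable instance : MonoidalCategoryStruct (QHMod k H) where
  tensorObj := tensor
  whiskerLeft M _ _ f := tensorMap (𝟙 M) f
  whiskerRight f N := tensorMap f (𝟙 N)
  tensorHom f g := tensorMap f g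
  tensorUnit := unit k H
  associator := associator
  leftUnitor := leftUnitor
  rightUnitor := rightUnitor

lemma associator_apply (M N L : QHMod k H) (t : (M ⊗[k] N) ⊗[k] L) :
    (associator M N L).hom.lin t =
      act₃ M N L (Phi k H) (TensorProduct.assoc k M N L t) := rfl

lemma associator_inv_apply (M N L : QHMod k H) (t : M ⊗[k] (N ⊗[k] L)) :
    (associator M N L).inv.lin t =
      (TensorProduct.assoc k M N L).symm
        (act₃ M N L (PhiInv k H) t) := rfl

lemma pentagon_aux (W X Y Z : QHMod k H) (t : ((W ⊗[k] X) ⊗[k] Y) ⊗[k] Z) :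
    TensorProduct.map LinearMap.id (associator X Y Z).hom.lin
      ((associator W (tensor X Y) Z).hom.lin
        (TensorProduct.map (associator W X Y).hom.lin LinearMap.id t)) =
    (associator W X (tensor Y Z)).hom.lin ((associator (tensor W X) Y Z).hom.lin t) := by
  set Φ : H ⊗[k] (H ⊗[k] H) := Phi k H with hΦ
  let act₄ := tensorAct W.ρ (act₃ X Y Z)
  have r1 : (associator (tensor W X) Y Z).hom.lin t = tensorAct (tensorAct W.ρ X.ρ)
      (tensorAct Y.ρ Z.ρ) (Algebra.TensorProduct.map comul (AlgHom.id k (H ⊗[k] H)) Φ)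
      (TensorProduct.assoc k (W ⊗[k] X) Y Z t) :=
    congrArg (fun f => f (TensorProduct.assoc k (W ⊗[k] X) Y Z t))
      (tensorAct_comp (tensorAct W.ρ X.ρ) (tensorAct Y.ρ Z.ρ) comul (AlgHom.id k (H ⊗[k] H)) Φ)
  have r2 : ∀ s, (associator W X (tensor Y Z)).hom.lin s =
      act₄ (Algebra.TensorProduct.map (AlgHom.id k H)
        (Algebra.TensorProduct.map (AlgHom.id k H) comul) Φ)
        (TensorProduct.assoc k W X (Y ⊗[k] Z) s) := by
    intro s
    rw [← show tensorAct (W.ρ.comp (AlgHom.id k H)) ((act₃ X Y Z).comp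
      (Algebra.TensorProduct.map (AlgHom.id k H) comul)) Φ = act₄ _ from tensorAct_comp _ _ _ _ _]
    have : (act₃ X Y Z).comp (Algebra.TensorProduct.map (AlgHom.id k H) comul) =
        tensorAct X.ρ (tensor Y Z).ρ := by
      apply AlgHom.ext
      intro x
      exact (tensorAct_comp X.ρ (tensorAct Y.ρ Z.ρ) (AlgHom.id k H) comul x).symm
    rw [this]
    rfl
  have l1 : TensorProduct.map (associator W X Y).hom.lin LinearMap.id t =
      tensorAct (tensorAct W.ρ (tensorAct X.ρ Y.ρ)) Z.ρ (Φ ⊗ₜ[k] (1 : H))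
        (TensorProduct.map (TensorProduct.assoc k W X Y).toLinearMap LinearMap.id t) := by
    have : ∀ s : (W ⊗[k] (X ⊗[k] Y)) ⊗[k] Z,
        tensorAct (tensorAct W.ρ (tensorAct X.ρ Y.ρ)) Z.ρ (Φ ⊗ₜ[k] (1 : H)) s =
          TensorProduct.map (act₃ W X Y Φ) LinearMap.id s := by
      intro s
      induction s with
      | zero => simp
      | add x y hx hy => simp only [map_add, hx, hy]
      | tmul a b => simp [act₃]
    rw [this, ← LinearMap.comp_apply, ← TensorProduct.map_comp]
    rfl
  have l2 : ∀ s, (associator W (tensor X Y) Z).hom.lin s =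
      tensorAct W.ρ (tensorAct (tensorAct X.ρ Y.ρ) Z.ρ) (Algebra.TensorProduct.map (AlgHom.id k H)
        (Algebra.TensorProduct.map comul (AlgHom.id k H)) Φ)
        (TensorProduct.assoc k W (X ⊗[k] Y) Z s) := by
    intro s
    rw [← tensorAct_comp]
    have : (tensorAct (tensorAct X.ρ Y.ρ) Z.ρ).comp
        (Algebra.TensorProduct.map comul (AlgHom.id k H)) = tensorAct (tensor X Y).ρ Z.ρ := by
      apply AlgHom.ext
      intro x
      exact (tensorAct_comp (tensorAct X.ρ Y.ρ) Z.ρ comul (AlgHom.id k H) x).symm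
    rw [this]
    rfl
  have l3 : ∀ s : W ⊗[k] ((X ⊗[k] Y) ⊗[k] Z),
      TensorProduct.map LinearMap.id (associator X Y Z).hom.lin s =
      act₄ ((1 : H) ⊗ₜ[k] Φ)
        (TensorProduct.map LinearMap.id (TensorProduct.assoc k X Y Z).toLinearMap s) := by
    intro s
    induction s with
    | zero => simp
    | add x y hx hy => simp only [map_add, hx, hy]
    | tmul a b =>
      simp only [TensorProduct.map_tmul, act₄, tensorAct_tmul, map_one, LinearMap.id_apply,
        Module.End.one_apply]
      rfl
  have l4 : ∀ x s, TensorProduct.map LinearMap.id (TensorProduct.assoc k X Y Z).toLinearMap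
      (tensorAct W.ρ (tensorAct (tensorAct X.ρ Y.ρ) Z.ρ) x s) =
      act₄ (Algebra.TensorProduct.map (AlgHom.id k H)
        (Algebra.TensorProduct.assoc k k k H H H).toAlgHom x)
        (TensorProduct.map LinearMap.id (TensorProduct.assoc k X Y Z).toLinearMap s) := by
    intro x s
    exact tensorAct_intertwine W.ρ (tensorAct (tensorAct X.ρ Y.ρ) Z.ρ) W.ρ
      (act₃ X Y Z) (AlgHom.id k H) (Algebra.TensorProduct.assoc k k k H H H).toAlgHom
      LinearMap.id (TensorProduct.assoc k X Y Z).toLinearMap (fun _ _ => rfl)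
      (fun b n => assoc_tensorAct X.ρ Y.ρ Z.ρ b n) x s
  have l5 : ∀ t : ((W ⊗[k] X) ⊗[k] Y) ⊗[k] Z,
      TensorProduct.map LinearMap.id (TensorProduct.assoc k X Y Z).toLinearMap
        (TensorProduct.assoc k W (X ⊗[k] Y) Z (TensorProduct.map
          (TensorProduct.assoc k W X Y).toLinearMap LinearMap.id t)) =
      TensorProduct.assoc k W X (Y ⊗[k] Z) (TensorProduct.assoc k (W ⊗[k] X) Y Z t) := by
    intro t
    have : (TensorProduct.map LinearMap.id (TensorProduct.assoc k X Y Z).toLinearMap ∘ₗ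
        (TensorProduct.assoc k W (X ⊗[k] Y) Z).toLinearMap ∘ₗ (TensorProduct.map
          (TensorProduct.assoc k W X Y).toLinearMap LinearMap.id)) =
      (TensorProduct.assoc k W X (Y ⊗[k] Z)).toLinearMap ∘ₗ
        (TensorProduct.assoc k (W ⊗[k] X) Y Z).toLinearMap := by
      ext; rfl
    exact congrArg (fun f => f t) this
  rw [l1, l2, assoc_tensorAct, ← Module.End.mul_apply, ← map_mul, l3, l4, l5, r2, r1,
    assoc_tensorAct]
  have key : ∀ x y s, act₄ x (act₄ y s) = act₄ (x * y) s := by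
    intro x y s
    rw [map_mul, Module.End.mul_apply]
  refine (key _ _ _).trans (Eq.trans ?_ (key _ _ _).symm)
  rw [QuasiBialgebra.pentagon]
  simp only [map_mul, mul_assoc]
  congr 4
  rw [← AlgHom.comp_apply, ← Algebra.TensorProduct.map_comp]
  rfl

noncomputable instance : MonoidalCategory (QHMod k H) where
  tensorHom_def f g := by
    apply hom_ext
    change TensorProduct.map _ _ = TensorProduct.map _ _ ∘ₗ TensorProduct.map _ _
    rw [← TensorProduct.map_comp]; rfl
  id_tensorHom_id M N := hom_ext TensorProduct.map_id
  tensorHom_comp_tensorHom f₁ f₂ g₁ g₂ := by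
    apply hom_ext
    change TensorProduct.map _ _ ∘ₗ TensorProduct.map _ _ = TensorProduct.map _ _
    rw [← TensorProduct.map_comp]; rfl
  whiskerLeft_id M N := hom_ext TensorProduct.map_id
  id_whiskerRight M N := hom_ext TensorProduct.map_id
  associator_naturality {M N L M' N' L'} f g h := by
    apply hom_ext
    apply LinearMap.ext
    intro t
    have h1 := tensorAct_intertwine M.ρ (tensorAct N.ρ L.ρ) M'.ρ (tensorAct N'.ρ L'.ρ)
      (AlgHom.id k H) (AlgHom.id k (H ⊗[k] H)) f.lin (TensorProduct.map g.lin h.lin) f.comm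
      (fun b n => by
        have := tensorAct_intertwine N.ρ L.ρ N'.ρ L'.ρ
          (AlgHom.id k H) (AlgHom.id k H) g.lin h.lin g.comm h.comm b n
        rwa [Algebra.TensorProduct.map_id] at this)
      (Phi k H) (TensorProduct.assoc k M N L t)
    rw [Algebra.TensorProduct.map_id] at h1
    have h2 : TensorProduct.map f.lin (TensorProduct.map g.lin h.lin)
        (TensorProduct.assoc k M N L t) = TensorProduct.assoc k M' N' L'
        (TensorProduct.map (TensorProduct.map f.lin g.lin) h.lin t) := by
      have : TensorProduct.map f.lin (TensorProduct.map g.lin h.lin) ∘ₗ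
        (TensorProduct.assoc k M N L).toLinearMap = (TensorProduct.assoc k M' N' L').toLinearMap ∘ₗ
          (TensorProduct.map (TensorProduct.map f.lin g.lin) h.lin) := by ext; rfl
      exact congrArg (fun f => f t) this
    rw [h2] at h1
    exact h1.symm
  leftUnitor_naturality f := by
    apply hom_ext
    apply TensorProduct.ext'
    intro c m
    exact (f.lin.map_smul c m).symm
  rightUnitor_naturality f := by
    apply hom_ext
    apply TensorProduct.ext'
    intro m c
    exact (f.lin.map_smul c m).symm
  pentagon W X Y Z := by
    apply hom_ext
    apply LinearMap.ext
    intro t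
    exact pentagon_aux W X Y Z t
  triangle M N := by
    apply hom_ext
    apply LinearMap.ext
    intro t
    have h1 := tensorAct_intertwine M.ρ (tensorAct (unit k H).ρ N.ρ) M.ρ N.ρ
      (AlgHom.id k H) ((Algebra.TensorProduct.lid k H).toAlgHom.comp
      (Algebra.TensorProduct.map counit (AlgHom.id k H))) LinearMap.id
      (TensorProduct.lid k N).toLinearMap (fun _ _ => rfl) (fun b n => lid_tensorAct N b n)
      (Phi k H) (TensorProduct.assoc k M k N t)
    rw [counit_assoc, map_one] at h1
    refine Eq.trans h1 ?_
    have : TensorProduct.map LinearMap.id (TensorProduct.lid k N).toLinearMap ∘ₗ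
      (TensorProduct.assoc k M k N).toLinearMap =
      TensorProduct.map (TensorProduct.rid k M).toLinearMap LinearMap.id := by
      ext; simp
    exact congrArg (fun f => f t) this

end Monoidal

end QHMod

namespace QHopf

/-! ### Identities in a quasi-Hopf algebra -/

section Identities

set_option maxSynthPendingDepth 6

open QuasiBialgebra QuasiHopfAlgebra

lemma ind₃ {k A B C : Type u} [Field k] [AddCommGroup A] [Module k A] [AddCommGroup B]
    [Module k B] [AddCommGroup C] [Module k C] {p : A ⊗[k] (B ⊗[k] C) → Prop}
    (x : A ⊗[k] (B ⊗[k] C)) (h0 : p 0) (hadd : ∀ x y, p x → p y → p (x + y))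
    (ht : ∀ a b c, p (a ⊗ₜ (b ⊗ₜ c))) : p x := by
  induction x with
  | zero => exact h0
  | add x y hx hy => exact hadd x y hx hy
  | tmul a t =>
    induction t with
    | zero => simpa using h0
    | add x y hx hy => simpa [TensorProduct.tmul_add] using hadd _ _ hx hy
    | tmul b c => exact ht a b c

section Bialgebra

variable (k H : Type u) [Field k] [Ring H] [Algebra k H] [QuasiBialgebra k H]

/-- `ε ⊗ id` -/
noncomputable def epsL (k H : Type u) [Field k] [Ring H] [Algebra k H] [QuasiBialgebra k H]
    (B : Type u) [Ring B] [Algebra k B] : H ⊗[k] B →ₐ[k] B :=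
  (Algebra.TensorProduct.lid k B).toAlgHom.comp
    (Algebra.TensorProduct.map counit (AlgHom.id k B))

/-- `id ⊗ ε` -/
noncomputable def epsR (k H : Type u) [Field k] [Ring H] [Algebra k H] [QuasiBialgebra k H]
    (B : Type u) [Ring B] [Algebra k B] : B ⊗[k] H →ₐ[k] B :=
  (Algebra.TensorProduct.rid k k B).toAlgHom.comp
    (Algebra.TensorProduct.map (AlgHom.id k B) counit)

variable {k H}

@[simp] lemma epsL_tmul {B : Type u} [Ring B] [Algebra k B] (h : H) (b : B) :
    epsL k H B (h ⊗ₜ b) = (counit h : k) • b := by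
  simp [epsL]

@[simp] lemma epsR_tmul {B : Type u} [Ring B] [Algebra k B] (h : H) (b : B) :
    epsR k H B (b ⊗ₜ h) = (counit h : k) • b := by
  simp [epsR]

lemma epsL_comul (h : H) : epsL k H H (comul h) = h := counit_left h

lemma epsR_comul (h : H) : epsR k H H (comul h) = h := counit_right h

lemma epsM_Phi : Algebra.TensorProduct.map (AlgHom.id k H) (epsL k H H) (Phi k H) = 1 :=
  counit_assoc

lemma pentagon_eps₃ (w : H ⊗[k] H) (x z : H) :
    Algebra.TensorProduct.map (AlgHom.id k H) (Algebra.TensorProduct.map (AlgHom.id k H)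
      (epsL k H H)) (x ⊗ₜ (Algebra.TensorProduct.assoc k k k H H H (w ⊗ₜ[k] z))) =
    x ⊗ₜ (epsR k H H w ⊗ₜ[k] z) := by
  induction w with
  | zero => simp
  | add a b ha hb =>
    simp only [TensorProduct.add_tmul, map_add, TensorProduct.tmul_add] at ha hb ⊢
    rw [ha, hb]
  | tmul a b => simp [TensorProduct.smul_tmul]

lemma pentagon_eps₁ (w : H ⊗[k] H) (x z : H) :
    Algebra.TensorProduct.map (AlgHom.id k H) (epsL k H (H ⊗[k] H))
      (x ⊗ₜ (Algebra.TensorProduct.assoc k k k H H H (w ⊗ₜ[k] z))) =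
    x ⊗ₜ (epsL k H H w ⊗ₜ[k] z) := by
  induction w with
  | zero => simp
  | add a b ha hb =>
    simp only [TensorProduct.add_tmul, map_add, TensorProduct.tmul_add] at ha hb ⊢
    rw [ha, hb]
  | tmul a b => simp [TensorProduct.smul_tmul']

lemma epsR_Phi : Algebra.TensorProduct.map (AlgHom.id k H) (epsR k H H) (Phi k H) = 1 := by
  let E := Algebra.TensorProduct.map (AlgHom.id k H) (Algebra.TensorProduct.map (AlgHom.id k H)
      (epsL k H H))
  have e1 : ∀ T : H ⊗[k] (H ⊗[k] H), E (Algebra.TensorProduct.map (AlgHom.id k H)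
      (Algebra.TensorProduct.map (AlgHom.id k H) comul) T) = T := by
    intro T
    induction T using ind₃ with
    | h0 => simp
    | hadd x y hx hy => simp [hx, hy]
    | ht a b c => simp [E, epsL_comul]
  have e2 : ∀ T : H ⊗[k] (H ⊗[k] H), E (Algebra.TensorProduct.assoc k k k H H (H ⊗[k] H)
        (Algebra.TensorProduct.map comul (AlgHom.id k (H ⊗[k] H)) T)) =
      Algebra.TensorProduct.assoc k k k H H H (Algebra.TensorProduct.map comul (AlgHom.id k H)
        (Algebra.TensorProduct.map (AlgHom.id k H) (epsL k H H) T)) := by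
    intro T
    induction T using ind₃ with
    | h0 => simp
    | hadd x y hx hy => simp only [map_add, hx, hy]
    | ht a b c =>
      simp only [Algebra.TensorProduct.map_tmul, AlgHom.id_apply, epsL_tmul]
      generalize (comul a : H ⊗[k] H) = w
      induction w with
      | zero => simp
      | add x y hx hy => simp only [TensorProduct.add_tmul, map_add, hx, hy]
      | tmul x y => simp [E]
  have e3 : E ((1 : H) ⊗ₜ[k] Phi k H) = 1 := by
    have : E ((1 : H) ⊗ₜ[k] Phi k H) =
      (1 : H) ⊗ₜ[k] (Algebra.TensorProduct.map (AlgHom.id k H) (epsL k H H) (Phi k H)) := by simp [E]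
    rw [this, epsM_Phi]; rfl
  have e4 : ∀ T : H ⊗[k] (H ⊗[k] H), E (Algebra.TensorProduct.map (AlgHom.id k H)
        ((Algebra.TensorProduct.assoc k k k H H H).toAlgHom.comp
          (Algebra.TensorProduct.map comul (AlgHom.id k H))) T) = T := by
    intro T
    induction T using ind₃ with
    | h0 => simp
    | hadd x y hx hy => simp only [map_add, hx, hy]
    | ht a b c =>
      have := pentagon_eps₃ (comul b : H ⊗[k] H) a c
      rw [epsR_comul] at this
      exact this
  have e5 : ∀ T : H ⊗[k] (H ⊗[k] H), E (Algebra.TensorProduct.map (AlgHom.id k H)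
        (Algebra.TensorProduct.assoc k k k H H H).toAlgHom
        (Algebra.TensorProduct.assoc k k k H (H ⊗[k] H) H (T ⊗ₜ[k] (1 : H)))) =
        Algebra.TensorProduct.assoc k k k H H H
          ((Algebra.TensorProduct.map (AlgHom.id k H) (epsR k H H) T) ⊗ₜ[k] (1 : H)) := by
    intro T
    induction T using ind₃ with
    | h0 => simp
    | hadd x y hx hy => simp only [TensorProduct.add_tmul, map_add, hx, hy]
    | ht a b c => simp [E, TensorProduct.smul_tmul]
  have h := congrArg E (pentagon (k := k) (H := H))
  simp only [map_mul, e1, e2, e3, e4, e5, epsM_Phi, map_one, mul_one, one_mul] at h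
  have h2 := congrArg (fun x => PhiInv k H * x) h
  simp only [← mul_assoc, Units.inv_mul, one_mul] at h2
  have h3 := congrArg (epsR k H (H ⊗[k] H))
    ((Algebra.TensorProduct.assoc k k k H H H).injective (h2.symm.trans (map_one _).symm))
  simpa using h3

lemma epsL_Phi : epsL k H (H ⊗[k] H) (Phi k H) = 1 := by
  let E := Algebra.TensorProduct.map (AlgHom.id k H) (epsL k H (H ⊗[k] H))
  have e1 : ∀ T : H ⊗[k] (H ⊗[k] H), E (Algebra.TensorProduct.map (AlgHom.id k H)
      (Algebra.TensorProduct.map (AlgHom.id k H) comul) T) =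
      Algebra.TensorProduct.map (AlgHom.id k H) comul
        (Algebra.TensorProduct.map (AlgHom.id k H) (epsL k H H) T) := by
    intro T
    induction T using ind₃ with
    | h0 => simp
    | hadd x y hx hy => simp only [map_add, hx, hy]
    | ht a b c => simp [E]
  have e2 : ∀ T : H ⊗[k] (H ⊗[k] H), E (Algebra.TensorProduct.assoc k k k H H (H ⊗[k] H)
        (Algebra.TensorProduct.map comul (AlgHom.id k (H ⊗[k] H)) T)) = T := by
    intro T
    induction T using ind₃ with
    | h0 => simp
    | hadd x y hx hy => simp only [map_add, hx, hy]
    | ht a b c =>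
      have : ∀ w : H ⊗[k] H, E (Algebra.TensorProduct.assoc k k k H H (H ⊗[k] H)
          (w ⊗ₜ[k] (b ⊗ₜ[k] c))) = epsR k H H w ⊗ₜ[k] (b ⊗ₜ[k] c) := by
        intro w
        induction w with
        | zero => simp
        | add x y hx hy => simp only [TensorProduct.add_tmul, map_add, hx, hy]
        | tmul x y => simp [E, TensorProduct.smul_tmul]
      simp only [Algebra.TensorProduct.map_tmul, AlgHom.id_apply, this, epsR_comul]
  have e3 : E ((1 : H) ⊗ₜ[k] Phi k H) = (1 : H) ⊗ₜ[k] (epsL k H (H ⊗[k] H) (Phi k H)) := by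
    simp [E]
  have e4 : ∀ T : H ⊗[k] (H ⊗[k] H), E (Algebra.TensorProduct.map (AlgHom.id k H)
        ((Algebra.TensorProduct.assoc k k k H H H).toAlgHom.comp
          (Algebra.TensorProduct.map comul (AlgHom.id k H))) T) = T := by
    intro T
    induction T using ind₃ with
    | h0 => simp
    | hadd x y hx hy => simp only [map_add, hx, hy]
    | ht a b c =>
      have := pentagon_eps₁ (comul b : H ⊗[k] H) a c
      rw [epsL_comul] at this
      exact this
  have e5 : ∀ T : H ⊗[k] (H ⊗[k] H), E (Algebra.TensorProduct.map (AlgHom.id k H)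
        (Algebra.TensorProduct.assoc k k k H H H).toAlgHom
        (Algebra.TensorProduct.assoc k k k H (H ⊗[k] H) H (T ⊗ₜ[k] (1 : H)))) =
        Algebra.TensorProduct.assoc k k k H H H
          ((Algebra.TensorProduct.map (AlgHom.id k H) (epsL k H H) T) ⊗ₜ[k] (1 : H)) := by
    intro T
    induction T using ind₃ with
    | h0 => simp
    | hadd x y hx hy => simp only [TensorProduct.add_tmul, map_add, hx, hy]
    | ht a b c =>
      simp only [E, Algebra.TensorProduct.assoc_tmul, Algebra.TensorProduct.map_tmul,
        AlgHom.id_apply, epsL_tmul]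
      change a ⊗ₜ[k] (epsL k H (H ⊗[k] H) (b ⊗ₜ[k] (c ⊗ₜ[k] (1 : H)))) = _
      rw [epsL_tmul, TensorProduct.smul_tmul']
  have h := congrArg E (pentagon (k := k) (H := H))
  have h1 : (1 : H ⊗[k] H) ⊗ₜ[k] (1 : H) = 1 := rfl
  simp only [map_mul, e1, e2, e3, e4, e5, epsM_Phi, map_one, mul_one, one_mul, h1] at h
  have h2 := congrArg (fun x => x * PhiInv k H) h
  simp only [mul_assoc, Units.mul_inv, mul_one] at h2
  have h3 := congrArg (epsL k H (H ⊗[k] H)) h2.symm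
  simpa using h3

lemma eps_inv {B : Type u} [Ring B] [Algebra k B] (f : H ⊗[k] (H ⊗[k] H) →ₐ[k] B)
    (hf : f (Phi k H) = 1) : f (PhiInv k H) = 1 := by
  have : f (PhiInv k H) * f (Phi k H) = 1 := by rw [← map_mul, Units.inv_mul, map_one]
  rwa [hf, mul_one] at this

variable (k H)

/-- `Δ ⊗ id ⊗ id` -/
noncomputable def dFst : H ⊗[k] (H ⊗[k] H) →ₐ[k] H ⊗[k] (H ⊗[k] (H ⊗[k] H)) :=
  (Algebra.TensorProduct.assoc k k k H H (H ⊗[k] H)).toAlgHom.comp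
    (Algebra.TensorProduct.map comul (AlgHom.id k (H ⊗[k] H)))

/-- `id ⊗ Δ ⊗ id` -/
noncomputable def dMid : H ⊗[k] (H ⊗[k] H) →ₐ[k] H ⊗[k] (H ⊗[k] (H ⊗[k] H)) :=
  Algebra.TensorProduct.map (AlgHom.id k H) ((Algebra.TensorProduct.assoc k k k H H H).toAlgHom.comp
    (Algebra.TensorProduct.map comul (AlgHom.id k H)))

/-- `id ⊗ id ⊗ Δ` -/
noncomputable def dLst : H ⊗[k] (H ⊗[k] H) →ₐ[k] H ⊗[k] (H ⊗[k] (H ⊗[k] H)) :=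
  Algebra.TensorProduct.map (AlgHom.id k H) (Algebra.TensorProduct.map (AlgHom.id k H) comul)

/-- `T ↦ 1 ⊗ T` -/
noncomputable def padL : H ⊗[k] (H ⊗[k] H) →ₐ[k] H ⊗[k] (H ⊗[k] (H ⊗[k] H)) :=
  Algebra.TensorProduct.includeRight

/-- The rebracketing `(H ⊗ (H ⊗ H)) ⊗ H ≃ H ⊗ (H ⊗ (H ⊗ H))`. -/
noncomputable def rebr (k H : Type u) [Field k] [Ring H] [Algebra k H] :
    (H ⊗[k] (H ⊗[k] H)) ⊗[k] H ≃ₐ[k] H ⊗[k] (H ⊗[k] (H ⊗[k] H)) :=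
  (Algebra.TensorProduct.assoc k k k H (H ⊗[k] H) H).trans
    (Algebra.TensorProduct.congr AlgEquiv.refl (Algebra.TensorProduct.assoc k k k H H H))

/-- `T ↦ T ⊗ 1` -/
noncomputable def padR : H ⊗[k] (H ⊗[k] H) →ₐ[k] H ⊗[k] (H ⊗[k] (H ⊗[k] H)) :=
  (rebr k H).toAlgHom.comp Algebra.TensorProduct.includeLeft

lemma pentagon' : dLst k H (Phi k H) * dFst k H (Phi k H) =
    padL k H (Phi k H) * dMid k H (Phi k H) * padR k H (Phi k H) :=
  pentagon

lemma pentagon_units :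
    Units.map (dLst k H).toRingHom.toMonoidHom assoc * Units.map (dFst k H).toRingHom.toMonoidHom assoc =
    Units.map (padL k H).toRingHom.toMonoidHom assoc * Units.map (dMid k H).toRingHom.toMonoidHom assoc *
      Units.map (padR k H).toRingHom.toMonoidHom assoc :=
  Units.ext (pentagon' k H)

lemma pentagon₁ : dFst k H (Phi k H) * padR k H (PhiInv k H) =
    dLst k H (PhiInv k H) * padL k H (Phi k H) * dMid k H (Phi k H) := by
  have h := congrArg (fun x => (Units.map (dLst k H).toRingHom.toMonoidHom assoc)⁻¹ * x *
    (Units.map (padR k H).toRingHom.toMonoidHom assoc)⁻¹) (pentagon_units k H)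
  simp only [← mul_assoc, inv_mul_cancel, one_mul, mul_inv_cancel_right] at h
  exact congrArg Units.val h

lemma pentagon₂ : padR k H (Phi k H) * dFst k H (PhiInv k H) =
    dMid k H (PhiInv k H) * padL k H (PhiInv k H) * dLst k H (Phi k H) := by
  have h := congrArg (fun x => (Units.map (dMid k H).toRingHom.toMonoidHom assoc)⁻¹ *
    (Units.map (padL k H).toRingHom.toMonoidHom assoc)⁻¹ * x *
    (Units.map (dFst k H).toRingHom.toMonoidHom assoc)⁻¹) (pentagon_units k H).symm
  simp only [mul_assoc, inv_mul_cancel_left, mul_inv_cancel, mul_one] at h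
  simp only [← mul_assoc] at h
  exact congrArg Units.val h

lemma pentagon₃ : dLst k H (PhiInv k H) * padL k H (Phi k H) =
    dFst k H (Phi k H) * padR k H (PhiInv k H) * dMid k H (PhiInv k H) := by
  rw [pentagon₁, mul_assoc _ (dMid k H _), ← map_mul (dMid k H), Units.mul_inv, map_one, mul_one]

lemma pentagon₄ : padL k H (PhiInv k H) * dLst k H (Phi k H) =
    dMid k H (Phi k H) * padR k H (Phi k H) * dFst k H (PhiInv k H) := by
  rw [mul_assoc, pentagon₂, ← mul_assoc, ← mul_assoc, ← map_mul (dMid k H), Units.mul_inv, map_one,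
    one_mul]

end Bialgebra

/-- `f ⊗ id` after rebracketing `H ⊗ (H ⊗ (H ⊗ H))` as `(H ⊗ (H ⊗ H)) ⊗ H`. -/
noncomputable def onFirst₃ {k H : Type u} [Field k] [Ring H] [Algebra k H]
    (f : H ⊗[k] (H ⊗[k] H) →ₗ[k] H) :
    H ⊗[k] (H ⊗[k] (H ⊗[k] H)) →ₗ[k] H ⊗[k] H :=
  f.rTensor H ∘ₗ (rebr k H).symm.toLinearMap

lemma onFirst₃_rebr {k H : Type u} [Field k] [Ring H] [Algebra k H]
    (f : H ⊗[k] (H ⊗[k] H) →ₗ[k] H) (t) :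
    onFirst₃ f (rebr k H t) = f.rTensor H t := by
  simp [onFirst₃]


section Hopf

variable (k H : Type u) [Field k] [Ring H] [Algebra k H] [QuasiHopfAlgebra k H]

/-- The antipode `S` as a linear bijection of `H`. -/
noncomputable def S : H ≃ₗ[k] H := antiLin antipode

variable {k H}

lemma S_mul (a b : H) : S k H (a * b) = S k H b * S k H a := by
  simp [S, antiLin]

lemma S_one : S k H 1 = 1 := by simp [S, antiLin]

lemma S_symm_mul (a b : H) : (S k H).symm (a * b) = (S k H).symm b * (S k H).symm a := by
  apply (S k H).injective
  rw [S_mul]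
  simp

lemma S_symm_one : (S k H).symm 1 = 1 := by
  apply (S k H).injective
  rw [S_one]
  simp

variable (k H)

/-- `a ⊗ b ↦ S(a) α b` -/
noncomputable def mα : H ⊗[k] H →ₗ[k] H := mulWith (S k H).toLinearMap (α k) LinearMap.id

/-- `a ⊗ b ↦ a β S(b)` -/
noncomputable def mβ : H ⊗[k] H →ₗ[k] H := mulWith LinearMap.id (β k) (S k H).toLinearMap

variable {k H}

@[simp] lemma mα_tmul (a b : H) : mα k H (a ⊗ₜ b) = S k H a * α k * b := rfl
@[simp] lemma mβ_tmul (a b : H) : mβ k H (a ⊗ₜ b) = a * β k * S k H b := rfl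

lemma mα_comul (h : H) : mα k H (comul h) = (counit h : k) • α k := antipode_α h
lemma mβ_comul (h : H) : mβ k H (comul h) = (counit h : k) • β k := antipode_β h

lemma mα_mul (v : H ⊗[k] H) (b c : H) : mα k H (v * (b ⊗ₜ c)) = S k H b * mα k H v * c := by
  induction v with
  | zero => simp
  | add x y hx hy => simp only [add_mul, mul_add, map_add, hx, hy]
  | tmul x y => simp [S_mul, mul_assoc]

lemma mβ_mul (v : H ⊗[k] H) (b c : H) : mβ k H ((b ⊗ₜ c) * v) = b * mβ k H v * S k H c := by
  induction v with
  | zero => simp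
  | add x y hx hy => simp only [add_mul, mul_add, map_add, hx, hy]
  | tmul x y => simp [S_mul, mul_assoc]

variable (k H)

/-- `a ⊗ b ⊗ c ↦ a β S(b) α c` -/
noncomputable def f₃ : H ⊗[k] (H ⊗[k] H) →ₗ[k] H := mulWith LinearMap.id (β k) (mα k H)

/-- `a ⊗ b ⊗ c ↦ S(a) α b β S(c)` -/
noncomputable def g₃ : H ⊗[k] (H ⊗[k] H) →ₗ[k] H := mulWith (S k H).toLinearMap (α k) (mβ k H)

variable {k H}

@[simp] lemma f₃_tmul (a : H) (t : H ⊗[k] H) : f₃ k H (a ⊗ₜ t) = a * β k * mα k H t := rfl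
@[simp] lemma g₃_tmul (a : H) (t : H ⊗[k] H) : g₃ k H (a ⊗ₜ t) = S k H a * α k * mβ k H t := rfl

lemma f₃_Phi : f₃ k H (Phi k H) = 1 := assoc_antipode
lemma g₃_PhiInv : g₃ k H (PhiInv k H) = 1 := assoc_inv_antipode

/-- `id ⊗ Δ` -/
noncomputable def idΔ (k H : Type u) [Field k] [Ring H] [Algebra k H] [QuasiBialgebra k H] :
    H ⊗[k] H →ₐ[k] H ⊗[k] (H ⊗[k] H) :=
  Algebra.TensorProduct.map (AlgHom.id k H) comul

/-- `Δ ⊗ id` -/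
noncomputable def Δid (k H : Type u) [Field k] [Ring H] [Algebra k H] [QuasiBialgebra k H] :
    H ⊗[k] H →ₐ[k] H ⊗[k] (H ⊗[k] H) :=
  (Algebra.TensorProduct.assoc k k k H H H).toAlgHom.comp
    (Algebra.TensorProduct.map comul (AlgHom.id k H))

lemma idΔ_tmul (a b : H) : idΔ k H (a ⊗ₜ b) = a ⊗ₜ comul b := by simp [idΔ]

lemma Δid_tmul (a b : H) : Δid k H (a ⊗ₜ b) =
    Algebra.TensorProduct.assoc k k k H H H (comul a ⊗ₜ[k] b) := by simp [Δid]

lemma coassoc' (h : H) : idΔ k H (comul h) * Phi k H = Phi k H * Δid k H (comul h) := by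
  rw [idΔ, coassoc, mul_assoc, Units.inv_mul, mul_one]
  rfl

lemma coassoc'' (h : H) : PhiInv k H * idΔ k H (comul h) = Δid k H (comul h) * PhiInv k H := by
  rw [idΔ, coassoc, ← mul_assoc, ← mul_assoc, Units.inv_mul, one_mul]
  rfl

lemma f₃_left (w : H ⊗[k] H) (u : H ⊗[k] (H ⊗[k] H)) :
    f₃ k H (idΔ k H w * u) = epsR k H H w * f₃ k H u := by
  induction w with
  | zero => simp
  | add x y hx hy => simp only [add_mul, map_add, hx, hy]
  | tmul q r =>
    induction u using ind₃ with
    | h0 => simp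
    | hadd x y hx hy => simp only [mul_add, map_add, hx, hy]
    | ht a b c =>
      rw [idΔ_tmul, Algebra.TensorProduct.tmul_mul_tmul, f₃_tmul, mα_mul, mα_comul]
      simp [mul_assoc]

lemma f₃_right (w : H ⊗[k] H) (u : H ⊗[k] (H ⊗[k] H)) :
    f₃ k H (u * Δid k H w) = f₃ k H u * epsL k H H w := by
  induction w with
  | zero => simp
  | add x y hx hy => simp only [mul_add, map_add, hx, hy]
  | tmul y z =>
    induction u using ind₃ with
    | h0 => simp
    | hadd x y hx hy => simp only [add_mul, map_add, hx, hy]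
    | ht a b c =>
      have : ∀ v : H ⊗[k] H, f₃ k H ((a ⊗ₜ (b ⊗ₜ c)) *
          Algebra.TensorProduct.assoc k k k H H H (v ⊗ₜ[k] z)) =
          a * mβ k H v * (mα k H (b ⊗ₜ c) * z) := by
        intro v
        induction v with
        | zero => simp
        | add x y hx hy =>
          simp only [TensorProduct.add_tmul, add_mul, mul_add, map_add, hx, hy]
        | tmul x y => simp [S_mul, mul_assoc]
      rw [Δid_tmul, this, mβ_comul]
      simp [mul_assoc]

lemma g₃_left (w : H ⊗[k] H) (u : H ⊗[k] (H ⊗[k] H)) :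
    g₃ k H (Δid k H w * u) = g₃ k H u * S k H (epsL k H H w) := by
  induction w with
  | zero => simp
  | add x y hx hy => simp only [add_mul, mul_add, map_add, hx, hy]
  | tmul y z =>
    induction u using ind₃ with
    | h0 => simp
    | hadd x y hx hy => simp only [mul_add, add_mul, map_add, hx, hy]
    | ht a b c =>
      have : ∀ v : H ⊗[k] H, g₃ k H (
          Algebra.TensorProduct.assoc k k k H H H (v ⊗ₜ[k] z) * (a ⊗ₜ (b ⊗ₜ c))) =
          S k H a * mα k H v * (mβ k H (b ⊗ₜ c) * S k H z) := by
        intro v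
        induction v with
        | zero => simp
        | add x y hx hy =>
          simp only [TensorProduct.add_tmul, add_mul, mul_add, map_add, hx, hy]
        | tmul x y => simp [S_mul, mul_assoc]
      rw [Δid_tmul, this, mα_comul]
      simp [mul_assoc]

lemma g₃_right (w : H ⊗[k] H) (u : H ⊗[k] (H ⊗[k] H)) :
    g₃ k H (u * idΔ k H w) = S k H (epsR k H H w) * g₃ k H u := by
  induction w with
  | zero => simp
  | add x y hx hy => simp only [add_mul, mul_add, map_add, hx, hy]
  | tmul q r =>
    induction u using ind₃ with
    | h0 => simp
    | hadd x y hx hy => simp only [mul_add, add_mul, map_add, hx, hy]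
    | ht a b c =>
      rw [idΔ_tmul, Algebra.TensorProduct.tmul_mul_tmul, g₃_tmul, mβ_mul, mβ_comul]
      simp [S_mul, mul_assoc]

lemma id_f₃_pentagon (T U : H ⊗[k] (H ⊗[k] H)) :
    (f₃ k H).lTensor H (dLst k H T * padL k H (Phi k H) * dMid k H U) =
      Algebra.TensorProduct.map (AlgHom.id k H) (epsR k H H) T *
      Algebra.TensorProduct.map (AlgHom.id k H) (epsL k H H) U := by
  induction T with
  | zero => simp
  | add x y hx hy => simp only [add_mul, map_add, hx, hy]
  | tmul p t =>
    induction U with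
    | zero => simp
    | add x y hx hy => simp only [mul_add, map_add, hx, hy]
    | tmul x u =>
      have : dLst k H (p ⊗ₜ t) * padL k H (Phi k H) * dMid k H (x ⊗ₜ u) =
        (p * x) ⊗ₜ[k] (idΔ k H t * Phi k H * Δid k H u) := by
        simp [dLst, padL, dMid, idΔ, Δid]
      rw [this, LinearMap.lTensor_tmul, f₃_right, f₃_left, f₃_Phi]
      simp

lemma id_g₃_pentagon (T U : H ⊗[k] (H ⊗[k] H)) :
    (g₃ k H).lTensor H (dMid k H T * padL k H (PhiInv k H) * dLst k H U) =
      (S k H).toLinearMap.lTensor H (Algebra.TensorProduct.map (AlgHom.id k H) (epsL k H H) T *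
      Algebra.TensorProduct.map (AlgHom.id k H) (epsR k H H) U) := by
  induction T with
  | zero => simp
  | add x y hx hy => simp only [add_mul, map_add, hx, hy]
  | tmul p t =>
    induction U with
    | zero => simp
    | add x y hx hy => simp only [mul_add, map_add, hx, hy]
    | tmul x u =>
      have : dMid k H (p ⊗ₜ t) * padL k H (PhiInv k H) * dLst k H (x ⊗ₜ u) =
        (p * x) ⊗ₜ[k] (Δid k H t * PhiInv k H * idΔ k H u) := by
        simp [dLst, padL, dMid, idΔ, Δid]
      rw [this, LinearMap.lTensor_tmul, g₃_right, g₃_left, g₃_PhiInv]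
      simp [S_mul]

lemma dFst_rebr (t : H ⊗[k] H) (c : H) :
    dFst k H (Algebra.TensorProduct.assoc k k k H H H (t ⊗ₜ c)) = rebr k H (Δid k H t ⊗ₜ c) := by
  induction t with
  | zero => simp
  | add x y hx hy => simp only [TensorProduct.add_tmul, map_add, hx, hy]
  | tmul a b =>
    simp only [dFst, Δid, rebr, AlgHom.comp_apply, Algebra.TensorProduct.assoc_tmul,
      Algebra.TensorProduct.map_tmul, AlgHom.id_apply]
    generalize (comul a : H ⊗[k] H) = w
    induction w with
    | zero => simp
    | add x y hx hy => simp only [TensorProduct.add_tmul, map_add, hx, hy]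
    | tmul x y => simp

lemma dMid_rebr (t : H ⊗[k] H) (c : H) :
    dMid k H (Algebra.TensorProduct.assoc k k k H H H (t ⊗ₜ c)) = rebr k H (idΔ k H t ⊗ₜ c) := by
  induction t with
  | zero => simp
  | add x y hx hy => simp only [TensorProduct.add_tmul, map_add, hx, hy]
  | tmul a b => simp [dMid, idΔ, rebr]

lemma f₃_id_pentagon (T U : H ⊗[k] (H ⊗[k] H)) :
    onFirst₃ (f₃ k H) (dMid k H T * padR k H (Phi k H) * dFst k H U) =
      Algebra.TensorProduct.map (AlgHom.id k H) (epsL k H H) T * epsL k H (H ⊗[k] H) U := by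
  obtain ⟨T, rfl⟩ := (Algebra.TensorProduct.assoc k k k H H H).surjective T
  obtain ⟨U, rfl⟩ := (Algebra.TensorProduct.assoc k k k H H H).surjective U
  induction T with
  | zero => simp
  | add x y hx hy => simp only [add_mul, map_add, hx, hy]
  | tmul t c =>
    induction U with
    | zero => simp
    | add x y hx hy => simp only [mul_add, map_add, hx, hy]
    | tmul u d =>
      have e1 : Algebra.TensorProduct.map (AlgHom.id k H) (epsL k H H)
          (Algebra.TensorProduct.assoc k k k H H H (t ⊗ₜ c)) = epsR k H H t ⊗ₜ c := by
        induction t with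
        | zero => simp
        | add x y hx hy => simp only [TensorProduct.add_tmul, map_add, hx, hy]
        | tmul a b => simp [TensorProduct.smul_tmul]
      have e2 : epsL k H (H ⊗[k] H)
          (Algebra.TensorProduct.assoc k k k H H H (u ⊗ₜ d)) = epsL k H H u ⊗ₜ d := by
        induction u with
        | zero => simp
        | add x y hx hy => simp only [TensorProduct.add_tmul, map_add, hx, hy]
        | tmul a b => simp [TensorProduct.smul_tmul']
      have : padR k H (Phi k H) = rebr k H (Phi k H ⊗ₜ 1) := rfl
      rw [dFst_rebr, dMid_rebr, this, ← map_mul, ← map_mul, onFirst₃_rebr, e1, e2]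
      simp [f₃_right, f₃_left, f₃_Phi]

lemma g₃_id_pentagon (T U : H ⊗[k] (H ⊗[k] H)) :
    onFirst₃ (g₃ k H) (dFst k H T * padR k H (PhiInv k H) * dMid k H U) =
      (S k H).toLinearMap.rTensor H (epsL k H (H ⊗[k] H) T *
        Algebra.TensorProduct.map (AlgHom.id k H) (epsL k H H) U) := by
  obtain ⟨T, rfl⟩ := (Algebra.TensorProduct.assoc k k k H H H).surjective T
  obtain ⟨U, rfl⟩ := (Algebra.TensorProduct.assoc k k k H H H).surjective U
  induction T with
  | zero => simp
  | add x y hx hy => simp only [add_mul, map_add, hx, hy]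
  | tmul t c =>
    induction U with
    | zero => simp
    | add x y hx hy => simp only [mul_add, map_add, hx, hy]
    | tmul u d =>
      have e1 : Algebra.TensorProduct.map (AlgHom.id k H) (epsL k H H)
          (Algebra.TensorProduct.assoc k k k H H H (u ⊗ₜ d)) = epsR k H H u ⊗ₜ d := by
        induction u with
        | zero => simp
        | add x y hx hy => simp only [TensorProduct.add_tmul, map_add, hx, hy]
        | tmul a b => simp [TensorProduct.smul_tmul]
      have e2 : epsL k H (H ⊗[k] H)
          (Algebra.TensorProduct.assoc k k k H H H (t ⊗ₜ c)) = epsL k H H t ⊗ₜ c := by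
        induction t with
        | zero => simp
        | add x y hx hy => simp only [TensorProduct.add_tmul, map_add, hx, hy]
        | tmul a b => simp [TensorProduct.smul_tmul']
      have : padR k H (PhiInv k H) = rebr k H (PhiInv k H ⊗ₜ 1) := rfl
      rw [dFst_rebr, dMid_rebr, this, ← map_mul, ← map_mul, onFirst₃_rebr, e1, e2]
      simp [g₃_right, g₃_left, g₃_PhiInv, S_mul]

end Hopf
end Identities
end QHopf

namespace QHopf

section Elements

open QuasiBialgebra QuasiHopfAlgebra

set_option maxSynthPendingDepth 6

variable (k H : Type u) [Field k] [Ring H] [Algebra k H] [QuasiHopfAlgebra k H]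

/-- `x ⊗ y ⊗ z ↦ x ⊗ S(y) α z` -/
noncomputable def κL : H ⊗[k] (H ⊗[k] H) →ₗ[k] H ⊗[k] H := (mα k H).lTensor H

/-- `x ⊗ y ⊗ z ↦ z ⊗ S⁻¹(y) S⁻¹(α) x = z ⊗ S⁻¹(S(x) α y)` -/
noncomputable def κR : H ⊗[k] (H ⊗[k] H) →ₗ[k] H ⊗[k] H :=
  (TensorProduct.comm k H H).toLinearMap ∘ₗ
    ((S k H).symm.toLinearMap ∘ₗ mα k H).rTensor H ∘ₗ (TensorProduct.assoc k H H H).symm.toLinearMap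

/-- `x ⊗ y ⊗ z ↦ x ⊗ y β S(z)` -/
noncomputable def κL' : H ⊗[k] (H ⊗[k] H) →ₗ[k] H ⊗[k] H := (mβ k H).lTensor H

/-- `x ⊗ y ⊗ z ↦ y S⁻¹(β) S⁻¹(x) ⊗ z = S⁻¹(x β S(y)) ⊗ z` -/
noncomputable def κR' : H ⊗[k] (H ⊗[k] H) →ₗ[k] H ⊗[k] H :=
  ((S k H).symm.toLinearMap ∘ₗ mβ k H).rTensor H ∘ₗ (TensorProduct.assoc k H H H).symm.toLinearMap

/-- `X ⊗ S(Y) α Z` -/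
noncomputable def pL : H ⊗[k] H := κL k H (Phi k H)

/-- `P ⊗ Q β S(R)` -/
noncomputable def qL : H ⊗[k] H := κL' k H (PhiInv k H)

/-- `R ⊗ S⁻¹(Q) S⁻¹(α) P` -/
noncomputable def pR : H ⊗[k] H := κR k H (PhiInv k H)

/-- `Y S⁻¹(β) S⁻¹(X) ⊗ Z` -/
noncomputable def qR : H ⊗[k] H := κR' k H (Phi k H)

variable {k H}

@[simp] lemma κL_tmul (x y z : H) :
    κL k H (x ⊗ₜ (y ⊗ₜ z)) = x ⊗ₜ (S k H y * α k * z) := rfl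

@[simp] lemma κR_tmul (x y z : H) : κR k H (x ⊗ₜ (y ⊗ₜ z)) =
    z ⊗ₜ ((S k H).symm y * (S k H).symm (α k) * x) := by
  simp [κR, S_symm_mul, mul_assoc]

@[simp] lemma κL'_tmul (x y z : H) :
    κL' k H (x ⊗ₜ (y ⊗ₜ z)) = x ⊗ₜ (y * β k * S k H z) := rfl

@[simp] lemma κR'_tmul (x y z : H) : κR' k H (x ⊗ₜ (y ⊗ₜ z)) =
    (y * (S k H).symm (β k) * (S k H).symm x) ⊗ₜ z := by
  simp [κR', S_symm_mul, mul_assoc]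

lemma κL_idΔ (w : H ⊗[k] H) (u : H ⊗[k] (H ⊗[k] H)) :
    κL k H (idΔ k H w * u) = (epsR k H H w ⊗ₜ 1) * κL k H u := by
  induction w with
  | zero => simp
  | add x y hx hy => simp only [add_mul, map_add, TensorProduct.add_tmul, hx, hy]
  | tmul q r =>
    induction u using ind₃ with
    | h0 => simp
    | hadd x y hx hy => simp only [mul_add, map_add, hx, hy]
    | ht a b c =>
      rw [idΔ_tmul, Algebra.TensorProduct.tmul_mul_tmul, κL, LinearMap.lTensor_tmul, mα_mul,
        mα_comul]
      simp [TensorProduct.smul_tmul']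

lemma κL'_idΔ (w : H ⊗[k] H) (u : H ⊗[k] (H ⊗[k] H)) :
    κL' k H (u * idΔ k H w) = κL' k H u * (epsR k H H w ⊗ₜ 1) := by
  induction w with
  | zero => simp
  | add x y hx hy => simp only [mul_add, map_add, TensorProduct.add_tmul, hx, hy]
  | tmul q r =>
    induction u using ind₃ with
    | h0 => simp
    | hadd x y hx hy => simp only [add_mul, map_add, hx, hy]
    | ht a b c =>
      rw [idΔ_tmul, Algebra.TensorProduct.tmul_mul_tmul, κL', LinearMap.lTensor_tmul, mβ_mul,
        mβ_comul]
      simp [TensorProduct.smul_tmul']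

lemma κR_Δid (w : H ⊗[k] H) (u : H ⊗[k] (H ⊗[k] H)) :
    κR k H (Δid k H w * u) = (epsL k H H w ⊗ₜ 1) * κR k H u := by
  induction w with
  | zero => simp
  | add x y hx hy => simp only [add_mul, map_add, TensorProduct.add_tmul, hx, hy]
  | tmul q r =>
    induction u using ind₃ with
    | h0 => simp
    | hadd x y hx hy => simp only [mul_add, map_add, hx, hy]
    | ht a b c =>
      have : ∀ v : H ⊗[k] H, κR k H (Algebra.TensorProduct.assoc k k k H H H (v ⊗ₜ[k] r) *
          (a ⊗ₜ (b ⊗ₜ c))) = (r * c) ⊗ₜ (S k H).symm (mα k H (v * (a ⊗ₜ b))) := by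
        intro v
        induction v with
        | zero => simp
        | add x y hx hy =>
          simp only [TensorProduct.add_tmul, add_mul, map_add, TensorProduct.tmul_add, hx, hy]
        | tmul x y => simp [S_symm_mul, mul_assoc]
      rw [Δid_tmul, this, mα_mul, mα_comul]
      simp [S_symm_mul, mul_assoc, TensorProduct.smul_tmul']

lemma κR'_Δid (w : H ⊗[k] H) (u : H ⊗[k] (H ⊗[k] H)) :
    κR' k H (u * Δid k H w) = κR' k H u * (1 ⊗ₜ epsL k H H w) := by
  induction w with
  | zero => simp
  | add x y hx hy => simp only [mul_add, map_add, TensorProduct.tmul_add, hx, hy]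
  | tmul q r =>
    induction u using ind₃ with
    | h0 => simp
    | hadd x y hx hy => simp only [add_mul, map_add, hx, hy]
    | ht a b c =>
      have : ∀ v : H ⊗[k] H, κR' k H ((a ⊗ₜ (b ⊗ₜ c)) *
          Algebra.TensorProduct.assoc k k k H H H (v ⊗ₜ[k] r)) =
          (S k H).symm (mβ k H ((a ⊗ₜ b) * v)) ⊗ₜ (c * r) := by
        intro v
        induction v with
        | zero => simp
        | add x y hx hy =>
          simp only [TensorProduct.add_tmul, mul_add, map_add, hx, hy]
        | tmul x y => simp [S_symm_mul, mul_assoc]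
      rw [Δid_tmul, this, mβ_mul, mβ_comul]
      simp [S_symm_mul, mul_assoc, TensorProduct.smul_tmul']

lemma κL_Phi_comul (h : H) : κL k H (Phi k H * Δid k H (comul h)) = (h ⊗ₜ 1) * pL k H := by
  rw [← coassoc', κL_idΔ, epsR_comul, pL]

lemma κR_PhiInv_comul (h : H) :
    κR k H (PhiInv k H * idΔ k H (comul h)) = (h ⊗ₜ 1) * pR k H := by
  rw [coassoc'', κR_Δid, epsL_comul, pR]

lemma qL_mul (h : H) : qL k H * (h ⊗ₜ 1) = mulWith (comul : H →ₐ[k] H ⊗[k] H).toLinearMap (qL k H)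
    (Algebra.TensorProduct.includeRight : H →ₐ[k] H ⊗[k] H).toLinearMap
      ((S k H).toLinearMap.lTensor H (comul h)) := by
  have : ∀ (w : H ⊗[k] H) u, mulWith (comul : H →ₐ[k] H ⊗[k] H).toLinearMap (κL' k H u)
      (Algebra.TensorProduct.includeRight : H →ₐ[k] H ⊗[k] H).toLinearMap
      ((S k H).toLinearMap.lTensor H w) = κL' k H (Δid k H w * u) := by
    intro w u
    induction w with
    | zero => simp
    | add x y hx hy => simp only [map_add, add_mul, hx, hy]
    | tmul a b =>
      induction u using ind₃ with
      | h0 => simp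
      | hadd x y hx hy =>
        simp only [LinearMap.lTensor_tmul, mulWith_tmul] at hx hy
        simp only [LinearMap.lTensor_tmul, mulWith_tmul, map_add, mul_add, add_mul, hx, hy]
      | ht p q r =>
        simp only [LinearMap.lTensor_tmul, mulWith_tmul, Δid_tmul, AlgHom.toLinearMap_apply]
        generalize (comul a : H ⊗[k] H) = v
        induction v with
        | zero => simp
        | add x y hx hy => simp only [add_mul, TensorProduct.add_tmul, map_add, hx, hy]
        | tmul x y => simp [S_mul, mul_assoc]
  rw [qL, this, ← coassoc'', κL'_idΔ, epsR_comul]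

lemma qR_mul (h : H) : qR k H * (1 ⊗ₜ h) = mulWith (comul : H →ₐ[k] H ⊗[k] H).toLinearMap (qR k H)
    (Algebra.TensorProduct.includeLeft : H →ₐ[k] H ⊗[k] H).toLinearMap
      ((S k H).symm.toLinearMap.lTensor H (TensorProduct.comm k H H (comul h))) := by
  have : ∀ (w : H ⊗[k] H) u, mulWith (comul : H →ₐ[k] H ⊗[k] H).toLinearMap (κR' k H u)
      (Algebra.TensorProduct.includeLeft : H →ₐ[k] H ⊗[k] H).toLinearMap
      ((S k H).symm.toLinearMap.lTensor H (TensorProduct.comm k H H w)) =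
        κR' k H (idΔ k H w * u) := by
    intro w u
    induction w with
    | zero => simp
    | add x y hx hy => simp only [map_add, add_mul, hx, hy]
    | tmul a b =>
      induction u using ind₃ with
      | h0 => simp
      | hadd x y hx hy =>
        simp only [TensorProduct.comm_tmul, LinearMap.lTensor_tmul, mulWith_tmul] at hx hy
        simp only [TensorProduct.comm_tmul, LinearMap.lTensor_tmul, mulWith_tmul, map_add, mul_add,
          add_mul, hx, hy]
      | ht p q r =>
        simp only [TensorProduct.comm_tmul, LinearMap.lTensor_tmul, mulWith_tmul, idΔ_tmul,
          AlgHom.toLinearMap_apply]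
        generalize (comul b : H ⊗[k] H) = v
        induction v with
        | zero => simp
        | add x y hx hy =>
          simp only [add_mul, TensorProduct.tmul_add, map_add, hx, hy]
        | tmul x y => simp [S_symm_mul, mul_assoc]
  rw [qR, this, coassoc', κR'_Δid, epsL_comul]

lemma mulWith_pL : mulWith (comul : H →ₐ[k] H ⊗[k] H).toLinearMap (qL k H)
    (Algebra.TensorProduct.includeRight : H →ₐ[k] H ⊗[k] H).toLinearMap (pL k H) = 1 := by
  have : ∀ T U : H ⊗[k] (H ⊗[k] H), mulWith (comul : H →ₐ[k] H ⊗[k] H).toLinearMap (κL' k H U)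
      (Algebra.TensorProduct.includeRight : H →ₐ[k] H ⊗[k] H).toLinearMap (κL k H T) =
        (f₃ k H).lTensor H (dFst k H T * padR k H U) := by
    intro T U
    induction T using ind₃ with
    | h0 => simp
    | hadd x y hx hy => simp only [map_add, add_mul, hx, hy]
    | ht x y z =>
      induction U using ind₃ with
      | h0 => simp
      | hadd x y hx hy =>
        simp only [κL_tmul, mulWith_tmul] at hx hy
        simp only [κL_tmul, mulWith_tmul, map_add, mul_add, add_mul, hx, hy]
      | ht p q r =>
        simp only [κL_tmul, mulWith_tmul, AlgHom.toLinearMap_apply, dFst, AlgHom.comp_apply,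
          Algebra.TensorProduct.map_tmul, AlgHom.id_apply]
        generalize (comul x : H ⊗[k] H) = v
        induction v with
        | zero => simp
        | add x y hx hy => simp only [add_mul, TensorProduct.add_tmul, map_add, hx, hy]
        | tmul a b => simp [padR, rebr, S_mul, mul_assoc]
  rw [pL, qL, this, pentagon₁, id_f₃_pentagon, eps_inv _ epsR_Phi, epsM_Phi, one_mul]

lemma κL_qL : κL k H (Phi k H * Δid k H (qL k H)) = 1 := by
  have : ∀ T U : H ⊗[k] (H ⊗[k] H), κL k H (T * Δid k H (κL' k H U)) =
      (g₃ k H).lTensor H (padR k H T * dFst k H U) := by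
    intro T U
    induction T using ind₃ with
    | h0 => simp
    | hadd x y hx hy => simp only [map_add, add_mul, hx, hy]
    | ht x y z =>
      induction U using ind₃ with
      | h0 => simp
      | hadd x y hx hy => simp only [map_add, mul_add, hx, hy]
      | ht p q r =>
        simp only [κL'_tmul, Δid_tmul, dFst, AlgHom.comp_apply,
          Algebra.TensorProduct.map_tmul, AlgHom.id_apply]
        generalize (comul p : H ⊗[k] H) = v
        induction v with
        | zero => simp
        | add x y hx hy => simp only [mul_add, TensorProduct.add_tmul, map_add, hx, hy]
        | tmul a b => simp [padR, rebr, S_mul, mul_assoc]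
  rw [qL, this, pentagon₂, id_g₃_pentagon, eps_inv _ epsM_Phi, epsR_Phi, one_mul]
  simp [Algebra.TensorProduct.one_def, S_one]

lemma mulWith_pR : mulWith (comul : H →ₐ[k] H ⊗[k] H).toLinearMap (qR k H)
    (Algebra.TensorProduct.includeLeft : H →ₐ[k] H ⊗[k] H).toLinearMap (pR k H) = 1 := by
  have : ∀ T U : H ⊗[k] (H ⊗[k] H), mulWith (comul : H →ₐ[k] H ⊗[k] H).toLinearMap (κR' k H T)
      (Algebra.TensorProduct.includeLeft : H →ₐ[k] H ⊗[k] H).toLinearMap (κR k H U) =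
        (S k H).symm.toLinearMap.rTensor H (onFirst₃ (g₃ k H) (dLst k H U * padL k H T)) := by
    intro T U
    induction U using ind₃ with
    | h0 => simp
    | hadd x y hx hy => simp only [map_add, add_mul, hx, hy]
    | ht p q r =>
      induction T using ind₃ with
      | h0 => simp
      | hadd x y hx hy =>
        simp only [κR_tmul, mulWith_tmul] at hx hy
        simp only [κR_tmul, mulWith_tmul, map_add, mul_add, add_mul, hx, hy]
      | ht x y z =>
        simp only [κR_tmul, mulWith_tmul, AlgHom.toLinearMap_apply, dLst,
          Algebra.TensorProduct.map_tmul, AlgHom.id_apply]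
        generalize (comul r : H ⊗[k] H) = v
        induction v with
        | zero => simp
        | add x y hx hy => simp only [add_mul, TensorProduct.tmul_add, map_add, hx, hy]
        | tmul a b => simp [padL, rebr, onFirst₃, S_mul, S_symm_mul, mul_assoc]
  rw [pR, qR, this, pentagon₃, g₃_id_pentagon, eps_inv _ epsM_Phi, epsL_Phi, one_mul]
  simp [Algebra.TensorProduct.one_def, S_one, S_symm_one]

lemma κR_qR : κR k H (PhiInv k H * idΔ k H (qR k H)) = 1 := by
  have : ∀ T U : H ⊗[k] (H ⊗[k] H), κR k H (U * idΔ k H (κR' k H T)) =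
      TensorProduct.comm k H H ((S k H).symm.toLinearMap.rTensor H
        (onFirst₃ (f₃ k H) (padL k H U * dLst k H T))) := by
    intro T U
    induction T using ind₃ with
    | h0 => simp
    | hadd x y hx hy => simp only [map_add, mul_add, hx, hy]
    | ht x y z =>
      induction U using ind₃ with
      | h0 => simp
      | hadd x y hx hy => simp only [map_add, add_mul, hx, hy]
      | ht p q r =>
        simp only [κR'_tmul, idΔ_tmul, dLst,
          Algebra.TensorProduct.map_tmul, AlgHom.id_apply]
        generalize (comul z : H ⊗[k] H) = v
        induction v with
        | zero => simp
        | add x y hx hy => simp only [mul_add, TensorProduct.tmul_add, map_add, hx, hy]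
        | tmul a b => simp [padL, rebr, onFirst₃, S_mul, S_symm_mul, mul_assoc]
  rw [qR, this, pentagon₄, f₃_id_pentagon, epsM_Phi, eps_inv _ epsL_Phi, one_mul]
  simp [Algebra.TensorProduct.one_def, S_symm_one]

end Elements

end QHopf

/-! ### The internal homs -/

namespace QHMod

open QHopf QuasiBialgebra QuasiHopfAlgebra

section InternalHom

variable {k H : Type u} [Field k] [Ring H] [Algebra k H]

/-- `a ⊗ b` sends a linear map `φ : V → M` to `v ↦ a φ(b v)`. -/
noncomputable def sandwich (V M : QHMod k H) : H ⊗[k] H →ₗ[k] Module.End k (V →ₗ[k] M) :=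
  TensorProduct.lift (LinearMap.mk₂ k
    (fun a b => (LinearMap.llcomp k V M M (M.ρ a)) ∘ₗ (LinearMap.lcomp k M (V.ρ b)))
    (fun a a' b => by ext; simp) (fun c a b => by ext; simp)
    (fun a b b' => by ext; simp) (fun c a b => by ext; simp))

@[simp] lemma sandwich_tmul (V M : QHMod k H) (a b : H) (φ : V →ₗ[k] M) (v : V) :
    sandwich V M (a ⊗ₜ b) φ v = M.ρ a (φ (V.ρ b v)) := rfl

lemma sandwich_one (V M : QHMod k H) (φ : V →ₗ[k] M) : sandwich V M 1 φ = φ := by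
  ext v
  simp [Algebra.TensorProduct.one_def]

lemma sandwich_left (V M : QHMod k H) (h : H) (x : H ⊗[k] H) (φ : V →ₗ[k] M) (v : V) :
    sandwich V M ((h ⊗ₜ 1) * x) φ v = M.ρ h (sandwich V M x φ v) := by
  induction x with
  | zero => simp
  | add x y hx hy => simp only [mul_add, map_add, LinearMap.add_apply, hx, hy]
  | tmul a b => simp

lemma sandwich_comp {V M V' M' : QHMod k H} (f : V' ⟶ V) (g : M ⟶ M') (x : H ⊗[k] H)
    (φ : V →ₗ[k] M) :
    sandwich V' M' x (g.lin ∘ₗ φ ∘ₗ f.lin) = g.lin ∘ₗ sandwich V M x φ ∘ₗ f.lin := by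
  ext v
  induction x with
  | zero => simp
  | add x y hx hy => simp_all
  | tmul a b => simp [f.comm, g.comm]

variable [QuasiHopfAlgebra k H]

/-- The action of `H ⊗ H` on `Hom_k(V, M)`, `(a ⊗ b) φ = a φ(S(b) -)`. -/
noncomputable def homActL (V M : QHMod k H) : H ⊗[k] H →ₐ[k] Module.End k (V →ₗ[k] M) :=
  AlgHom.ofLinearMap (sandwich V M ∘ₗ (S k H).toLinearMap.lTensor H)
    (by ext φ v; simp [Algebra.TensorProduct.one_def, S_one])
    (fun x y => by
      induction x with
      | zero => simp
      | add x x' hx hx' => simp only [add_mul, map_add, hx, hx']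
      | tmul a b =>
        induction y with
        | zero => simp
        | add y y' hy hy' => simp only [mul_add, map_add, hy, hy']
        | tmul c d => ext φ v; simp [S_mul])

@[simp] lemma homActL_tmul (V M : QHMod k H) (a b : H) (φ : V →ₗ[k] M) (v : V) :
    homActL V M (a ⊗ₜ b) φ v = M.ρ a (φ (V.ρ (S k H b) v)) := rfl

/-- The action of `H ⊗ H` on `Hom_k(V, M)`, `(a ⊗ b) φ = b φ(S⁻¹(a) -)`. -/
noncomputable def homActR (V M : QHMod k H) : H ⊗[k] H →ₐ[k] Module.End k (V →ₗ[k] M) :=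
  AlgHom.ofLinearMap (sandwich V M ∘ₗ (S k H).symm.toLinearMap.lTensor H ∘ₗ
      (TensorProduct.comm k H H).toLinearMap)
    (by ext φ v; simp [Algebra.TensorProduct.one_def, S_symm_one])
    (fun x y => by
      induction x with
      | zero => simp
      | add x x' hx hx' => simp only [add_mul, map_add, hx, hx']
      | tmul a b =>
        induction y with
        | zero => simp
        | add y y' hy hy' => simp only [mul_add, map_add, hy, hy']
        | tmul c d => ext φ v; simp [S_symm_mul])

@[simp] lemma homActR_tmul (V M : QHMod k H) (a b : H) (φ : V →ₗ[k] M) (v : V) :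
    homActR V M (a ⊗ₜ b) φ v = M.ρ b (φ (V.ρ ((S k H).symm a) v)) := rfl

/-- `Homˡ(V, M) = Hom_k(V, M)` with `h · φ = h¹ φ(S(h²) -)`. -/
noncomputable abbrev homL (V M : QHMod k H) : QHMod k H where
  carrier := V →ₗ[k] M
  ρ := (homActL V M).comp comul

/-- `Homʳ(V, M) = Hom_k(V, M)` with `h · φ = h² φ(S⁻¹(h¹) -)`. -/
noncomputable abbrev homR (V M : QHMod k H) : QHMod k H where
  carrier := V →ₗ[k] M
  ρ := (homActR V M).comp comul

lemma sandwich_qL {T V M : QHMod k H} (f : tensor T V ⟶ M) (x : H ⊗[k] H) (t : T) (v : V) :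
    sandwich V M x
        (TensorProduct.curry (f.lin ∘ₗ tensorAct T.ρ V.ρ (qL k H)) t) v =
      f.lin (tensorAct T.ρ V.ρ (mulWith (comul : H →ₐ[k] H ⊗[k] H).toLinearMap (qL k H)
        (Algebra.TensorProduct.includeRight : H →ₐ[k] H ⊗[k] H).toLinearMap x) (t ⊗ₜ v)) := by
  induction x with
  | zero => simp
  | add x y hx hy => simp only [map_add, LinearMap.add_apply, hx, hy]
  | tmul a b =>
    have := f.comm a (tensorAct T.ρ V.ρ (qL k H) (t ⊗ₜ V.ρ b v))
    simp only [AlgHom.comp_apply] at this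
    simp [← this]

lemma sandwich_qR {T V M : QHMod k H} (f : tensor V T ⟶ M) (x : H ⊗[k] H) (t : T) (v : V) :
    sandwich V M x
        ((TensorProduct.curry (f.lin ∘ₗ tensorAct V.ρ T.ρ (qR k H))).flip t) v =
      f.lin (tensorAct V.ρ T.ρ (mulWith (comul : H →ₐ[k] H ⊗[k] H).toLinearMap (qR k H)
        (Algebra.TensorProduct.includeLeft : H →ₐ[k] H ⊗[k] H).toLinearMap x) (v ⊗ₜ t)) := by
  induction x with
  | zero => simp
  | add x y hx hy => simp only [map_add, LinearMap.add_apply, hx, hy]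
  | tmul a b =>
    have := f.comm a (tensorAct V.ρ T.ρ (qR k H) (V.ρ b v ⊗ₜ t))
    simp only [AlgHom.comp_apply] at this
    simp [← this]

lemma sandwich_κL (V M : QHMod k H) (u : H ⊗[k] (H ⊗[k] H)) (w : H ⊗[k] H) (b : H)
    (φ : V →ₗ[k] M) (v : V) :
    sandwich V M (κL k H u) (homActL V M w φ) (V.ρ b v) =
      sandwich V M (κL k H (u * Algebra.TensorProduct.assoc k k k H H H (w ⊗ₜ b))) φ v := by
  induction u using ind₃ with
  | h0 => simp
  | hadd x y hx hy => simp only [map_add, add_mul, LinearMap.add_apply, hx, hy]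
  | ht x y z =>
    induction w with
    | zero => simp
    | add x y hx hy =>
      simp only [map_add, mul_add, TensorProduct.add_tmul, LinearMap.add_apply, hx, hy]
    | tmul c d => simp [S_mul]

lemma sandwich_κR (V M : QHMod k H) (u : H ⊗[k] (H ⊗[k] H)) (w : H ⊗[k] H) (b : H)
    (φ : V →ₗ[k] M) (v : V) :
    sandwich V M (κR k H u) (homActR V M w φ) (V.ρ b v) =
      sandwich V M (κR k H (u * (b ⊗ₜ w))) φ v := by
  induction u using ind₃ with
  | h0 => simp
  | hadd x y hx hy => simp only [map_add, add_mul, LinearMap.add_apply, hx, hy]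
  | ht x y z =>
    induction w with
    | zero => simp
    | add x y hx hy =>
      simp only [map_add, mul_add, TensorProduct.tmul_add, LinearMap.add_apply, hx, hy]
    | tmul c d => simp [S_symm_mul]

lemma ηL_act {T V M : QHMod k H} (g : T ⟶ homL V M) (y : H ⊗[k] H) (t : T) (v : V) :
    TensorProduct.lift (sandwich V M (pL k H) ∘ₗ g.lin) (tensorAct T.ρ V.ρ y (t ⊗ₜ v)) =
      sandwich V M (κL k H (Phi k H * Δid k H y)) (g.lin t) v := by
  induction y with
  | zero => simp
  | add x y hx hy => simp only [map_add, mul_add, LinearMap.add_apply, hx, hy]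
  | tmul a b =>
    rw [Δid_tmul, ← sandwich_κL]
    have := g.comm a t
    simp only [AlgHom.comp_apply] at this
    simp [this, pL]

lemma ηR_act {T V M : QHMod k H} (g : T ⟶ homR V M) (y : H ⊗[k] H) (t : T) (v : V) :
    TensorProduct.lift ((sandwich V M (pR k H) ∘ₗ g.lin).flip)
        (tensorAct V.ρ T.ρ y (v ⊗ₜ t)) =
      sandwich V M (κR k H (PhiInv k H * idΔ k H y)) (g.lin t) v := by
  induction y with
  | zero => simp
  | add x y hx hy => simp only [map_add, mul_add, LinearMap.add_apply, hx, hy]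
  | tmul a b =>
    rw [idΔ_tmul, ← sandwich_κR]
    have := g.comm b t
    simp only [AlgHom.comp_apply] at this
    simp [this, pR]

/-- `ζˡ(f)(t) = f(P t ⊗ Q β S(R) -)` -/
noncomputable def ζL {T V M : QHMod k H} (f : tensor T V ⟶ M) : T ⟶ homL V M where
  lin := TensorProduct.curry (f.lin ∘ₗ tensorAct T.ρ V.ρ (qL k H))
  comm h t := by
    ext v
    have := sandwich_qL f ((S k H).toLinearMap.lTensor H (comul h)) t v
    rw [← qL_mul] at this
    refine Eq.trans ?_ this.symm
    simp

/-- `ηˡ(g)(t ⊗ v) = X (g(t)(S(Y) α Z v))` -/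
noncomputable def ηL {T V M : QHMod k H} (g : T ⟶ homL V M) : tensor T V ⟶ M where
  lin := TensorProduct.lift (sandwich V M (pL k H) ∘ₗ g.lin)
  comm := fun h (x : T ⊗[k] V) => by
    induction x with
    | zero => simp
    | add x y hx hy => simp only [map_add, hx, hy]
    | tmul t v =>
      rw [AlgHom.comp_apply, ηL_act, κL_Phi_comul, sandwich_left]
      rfl

/-- `ζʳ(f)(t) = f(Y S⁻¹(β) S⁻¹(X) - ⊗ Z t)` -/
noncomputable def ζR {T V M : QHMod k H} (f : tensor V T ⟶ M) : T ⟶ homR V M where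
  lin := (TensorProduct.curry (f.lin ∘ₗ tensorAct V.ρ T.ρ (qR k H))).flip
  comm h t := by
    ext v
    have := sandwich_qR f
      ((S k H).symm.toLinearMap.lTensor H (TensorProduct.comm k H H (comul h))) t v
    rw [← qR_mul] at this
    refine Eq.trans ?_ this.symm
    simp

/-- `ηʳ(g)(v ⊗ t) = R (g(t)(S⁻¹(Q) S⁻¹(α) P v))` -/
noncomputable def ηR {T V M : QHMod k H} (g : T ⟶ homR V M) : tensor V T ⟶ M where
  lin := TensorProduct.lift ((sandwich V M (pR k H) ∘ₗ g.lin).flip)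
  comm := fun h (x : V ⊗[k] T) => by
    induction x with
    | zero => simp
    | add x y hx hy => simp only [map_add, hx, hy]
    | tmul v t =>
      rw [AlgHom.comp_apply, ηR_act, κR_PhiInv_comul, sandwich_left]
      rfl

/-- `Hom_H(T ⊗ V, M) ≃ Hom_H(T, Homˡ(V, M))` -/
noncomputable def homEquivL (T V M : QHMod k H) : (tensor T V ⟶ M) ≃ (T ⟶ homL V M) where
  toFun := ζL
  invFun := ηL
  left_inv f := by
    refine hom_ext (TensorProduct.ext' fun t v => ?_)
    refine (sandwich_qL f (pL k H) t v).trans ?_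
    rw [mulWith_pL, map_one, Module.End.one_apply]
  right_inv g := by
    refine hom_ext (LinearMap.ext fun t => LinearMap.ext fun v => ?_)
    refine (ηL_act g (qL k H) t v).trans ?_
    rw [κL_qL, sandwich_one]

/-- `Hom_H(V ⊗ T, M) ≃ Hom_H(T, Homʳ(V, M))` -/
noncomputable def homEquivR (T V M : QHMod k H) : (tensor V T ⟶ M) ≃ (T ⟶ homR V M) where
  toFun := ζR
  invFun := ηR
  left_inv f := by
    refine hom_ext (TensorProduct.ext' fun v t => ?_)
    refine (sandwich_qR f (pR k H) t v).trans ?_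
    rw [mulWith_pR, map_one, Module.End.one_apply]
  right_inv g := by
    refine hom_ext (LinearMap.ext fun t => LinearMap.ext fun v => ?_)
    refine (ηR_act g (qR k H) t v).trans ?_
    rw [κR_qR, sandwich_one]

/-- The functor `Homˡ(V, -)`. -/
noncomputable def homLFunctor (V : QHMod k H) : QHMod k H ⥤ QHMod k H where
  obj M := homL V M
  map {M M'} g := ⟨LinearMap.llcomp k V M M' g.lin, fun h φ =>
    (sandwich_comp (𝟙 V) g _ φ).symm⟩

/-- The functor `Homʳ(V, -)`. -/
noncomputable def homRFunctor (V : QHMod k H) : QHMod k H ⥤ QHMod k H where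
  obj M := homR V M
  map {M M'} g := ⟨LinearMap.llcomp k V M M' g.lin, fun h φ =>
    (sandwich_comp (𝟙 V) g _ φ).symm⟩

/-- `- ⊗ V` is left adjoint to `Homˡ(V, -)`. -/
noncomputable def adjL (V : QHMod k H) : tensorRight V ⊣ homLFunctor V :=
  Adjunction.mkOfHomEquiv
    { homEquiv := fun T M => homEquivL T V M
      homEquiv_naturality_left_symm := fun f g => by
        refine hom_ext (TensorProduct.ext' fun t v => ?_)
        rfl
      homEquiv_naturality_right := fun f g => by
        refine hom_ext (LinearMap.ext fun t => LinearMap.ext fun v => ?_)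
        rfl }

/-- `V ⊗ -` is left adjoint to `Homʳ(V, -)`. -/
noncomputable def adjR (V : QHMod k H) : tensorLeft V ⊣ homRFunctor V :=
  Adjunction.mkOfHomEquiv
    { homEquiv := fun T M => homEquivR T V M
      homEquiv_naturality_left_symm := fun f g => by
        refine hom_ext (TensorProduct.ext' fun t v => ?_)
        rfl
      homEquiv_naturality_right := fun f g => by
        refine hom_ext (LinearMap.ext fun t => LinearMap.ext fun v => ?_)
        rfl }

end InternalHom

end QHMod

universe v w

/-! ### Biclosed monoidal categories and the weak center of the contragradient bimodule category -/

/-- A biclosed monoidal category: `Hom(T ⊗ V, M) ≃ Hom(T, Homˡ(V, M))` and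
`Hom(V ⊗ T, M) ≃ Hom(T, Homʳ(V, M))`. -/
class Biclosed (C : Type w) [Category.{v} C] [MonoidalCategory C] where
  /-- the left internal hom `Homˡ(V, -)` -/
  homL : C → C ⥤ C
  /-- `- ⊗ V` is left adjoint to `Homˡ(V, -)` -/
  adjL : ∀ V : C, tensorRight V ⊣ homL V
  /-- the right internal hom `Homʳ(V, -)` -/
  homR : C → C ⥤ C
  /-- `V ⊗ -` is left adjoint to `Homʳ(V, -)` -/
  adjR : ∀ V : C, tensorLeft V ⊣ homR V

namespace Biclosed

section Bimodule

variable {C : Type w} [Category.{v} C] [MonoidalCategory C] [Biclosed C]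

/-- The evaluation `Homˡ(V, M) ⊗ V ⟶ M`. -/
def evL (V M : C) : (homL V).obj M ⊗ V ⟶ M := (adjL V).counit.app M

/-- The evaluation `V ⊗ Homʳ(V, M) ⟶ M`. -/
def evR (V M : C) : V ⊗ (homR V).obj M ⟶ M := (adjR V).counit.app M

/-- The bijection `Hom(T ⊗ V, M) ≃ Hom(T, Homˡ(V, M))`. -/
def curryL (T V M : C) : (T ⊗ V ⟶ M) ≃ (T ⟶ (homL V).obj M) := (adjL V).homEquiv T M

/-- The bijection `Hom(V ⊗ T, M) ≃ Hom(T, Homʳ(V, M))`. -/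
def curryR (T V M : C) : (V ⊗ T ⟶ M) ≃ (T ⟶ (homR V).obj M) := (adjR V).homEquiv T M

/-- The map `Homˡ(V', M) ⟶ Homˡ(V, M)` induced by `f : V ⟶ V'`. -/
def preL {V V' : C} (f : V ⟶ V') (M : C) : (homL V').obj M ⟶ (homL V).obj M :=
  curryL _ _ _ ((homL V').obj M ◁ f ≫ evL V' M)

/-- The map `Homʳ(V', M) ⟶ Homʳ(V, M)` induced by `f : V ⟶ V'`. -/
def preR {V V' : C} (f : V ⟶ V') (M : C) : (homR V').obj M ⟶ (homR V).obj M :=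
  curryR _ _ _ (f ▷ (homR V').obj M ≫ evR V' M)

/-- The associativity map `V ▷ (W ▷ M) ⟶ (V ⊗ W) ▷ M`, where `V ▷ M = Homˡ(V, M)`. It corresponds
to `T ⊗ (V ⊗ W) ⟶ (T ⊗ V) ⊗ W ⟶ (W ▷ M) ⊗ W ⟶ M` for `T = V ▷ (W ▷ M)`. -/
def assocL (V W M : C) : (homL V).obj ((homL W).obj M) ⟶ (homL (V ⊗ W)).obj M :=
  curryL _ _ _ ((α_ _ V W).inv ≫ evL V ((homL W).obj M) ▷ W ≫ evL W M)

/-- The associativity map `V ▷ (M ◁ W) ⟶ (V ▷ M) ◁ W`, where `M ◁ W = Homʳ(W, M)`. It corresponds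
to `(W ⊗ T) ⊗ V ⟶ W ⊗ (T ⊗ V) ⟶ W ⊗ (M ◁ W) ⟶ M` for `T = V ▷ (M ◁ W)`. -/
def assocM (V W M : C) : (homL V).obj ((homR W).obj M) ⟶ (homR W).obj ((homL V).obj M) :=
  curryR _ _ _ (curryL _ _ _ ((α_ W _ V).hom ≫ W ◁ evL V ((homR W).obj M) ≫ evR W M))

/-- The associativity map `M ◁ (V ⊗ W) ⟶ (M ◁ V) ◁ W`. It corresponds to
`V ⊗ (W ⊗ T) ⟶ (V ⊗ W) ⊗ T ⟶ M` for `T = M ◁ (V ⊗ W)`. -/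
def assocR (V W M : C) : (homR (V ⊗ W)).obj M ⟶ (homR W).obj ((homR V).obj M) :=
  curryR _ _ _ (curryR _ _ _ ((α_ V W _).inv ≫ evR (V ⊗ W) M))

/-- The unit isomorphism `1 ▷ M ⟶ M`. -/
def unitL (M : C) : (homL (𝟙_ C)).obj M ⟶ M := (ρ_ _).inv ≫ evL (𝟙_ C) M

/-- The unit isomorphism `M ◁ 1 ⟶ M`. -/
def unitR (M : C) : (homR (𝟙_ C)).obj M ⟶ M := (λ_ _).inv ≫ evR (𝟙_ C) M

end Bimodule

end Biclosed

open Biclosed in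
/-- The objects of the weak center of the contragradient bimodule category of `C`: an object `M`
with a natural family `τ_V : V ▷ M ⟶ M ◁ V`, not necessarily invertible, satisfying the hexagon
axiom and compatible with the unit object. -/
structure WeakCenter (C : Type w) [Category.{v} C] [MonoidalCategory C] [Biclosed C] where
  /-- the underlying object -/
  M : C
  /-- the structure maps `τ_V : V ▷ M ⟶ M ◁ V` -/
  τ : ∀ V : C, (homL V).obj M ⟶ (homR V).obj M
  naturality : ∀ {V V' : C} (f : V ⟶ V'), preL f M ≫ τ V = τ V' ≫ preR f M
  hexagon : ∀ V W : C,
    (homL V).map (τ W) ≫ assocM V W M ≫ (homR W).map (τ V) =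
      assocL V W M ≫ τ (V ⊗ W) ≫ assocR V W M
  unit : τ (𝟙_ C) ≫ unitR M = unitL M

namespace WeakCenter

open Biclosed

variable {C : Type w} [Category.{v} C] [MonoidalCategory C] [Biclosed C]

/-- A morphism in the weak center is a morphism of `C` that commutes with the structure maps. -/
@[ext] structure Hom (X Y : WeakCenter C) where
  /-- the underlying morphism -/
  t : X.M ⟶ Y.M
  comm : ∀ V : C, (homL V).map t ≫ Y.τ V = X.τ V ≫ (homR V).map t

instance : Category (WeakCenter C) where
  Hom := Hom
  id X := ⟨𝟙 X.M, fun V => by simp⟩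
  comp f g := ⟨f.t ≫ g.t, fun V => by
    rw [Functor.map_comp, Functor.map_comp, Category.assoc, g.comm, ← Category.assoc, f.comm,
      Category.assoc]⟩
  id_comp f := Hom.ext (Category.id_comp f.t)
  comp_id f := Hom.ext (Category.comp_id f.t)
  assoc f g h := Hom.ext (Category.assoc f.t g.t h.t)

/-- The forgetful functor from the weak center. -/
def forget (C : Type w) [Category.{v} C] [MonoidalCategory C] [Biclosed C] : WeakCenter C ⥤ C where
  obj X := X.M
  map f := f.t

end WeakCenter

namespace QHMod

noncomputable instance {k H : Type u} [Field k] [Ring H] [Algebra k H] [QuasiHopfAlgebra k H] :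
    Biclosed (QHMod k H) where
  homL := homLFunctor
  adjL := adjL
  homR := homRFunctor
  adjR := adjR

end QHMod

/-! ### Anti-Yetter-Drinfeld contramodules of type II -/

namespace QHopf

open QuasiBialgebra QuasiHopfAlgebra

section Twist

set_option maxSynthPendingDepth 6

variable (k H : Type u) [Field k] [Ring H] [Algebra k H] [QuasiHopfAlgebra k H]

/-- `h ↦ (S ⊗ S)(Δᵒᵖ(h)) = S(h²) ⊗ S(h¹)` -/
noncomputable def SΔop : H →ₗ[k] H ⊗[k] H :=
  TensorProduct.map (S k H).toLinearMap (S k H).toLinearMap ∘ₗ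
    (TensorProduct.comm k H H).toLinearMap ∘ₗ (comul : H →ₐ[k] H ⊗[k] H).toLinearMap

/-- `γ = S(U) α V ⊗ S(T) α W`, where `T ⊗ U ⊗ V ⊗ W = (1 ⊗ Φ⁻¹) · (id ⊗ id ⊗ Δ)(Φ)`. -/
noncomputable def γ : H ⊗[k] H :=
  mulWith ((Algebra.TensorProduct.includeRight : H →ₐ[k] H ⊗[k] H).toLinearMap ∘ₗ
      (S k H).toLinearMap) 1
    (TensorProduct.map (mα k H) (LinearMap.mulLeft k (α k)) ∘ₗ
      (TensorProduct.assoc k H H H).symm.toLinearMap)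
    (padL k H (PhiInv k H) * dLst k H (Phi k H))

/-- `δ = K β S(N) ⊗ L β S(M)`, where `K ⊗ L ⊗ M ⊗ N = (id ⊗ id ⊗ Δ)(Φ⁻¹) · (1 ⊗ Φ)`. -/
noncomputable def δ : H ⊗[k] H :=
  mulWith (Algebra.TensorProduct.includeLeft : H →ₐ[k] H ⊗[k] H).toLinearMap 1
    ((TensorProduct.comm k H H).toLinearMap ∘ₗ
      TensorProduct.map (mβ k H) (LinearMap.mulLeft k (β k) ∘ₗ (S k H).toLinearMap) ∘ₗ
      (TensorProduct.assoc k H H H).symm.toLinearMap)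
    (dLst k H (PhiInv k H) * padL k H (Phi k H))

/-- Drinfeld's twist `F = (S ⊗ S)(Δᵒᵖ(P)) · γ · Δ(Q β S(R))`; it satisfies
`F · Δ(S(h)) · F⁻¹ = (S ⊗ S)(Δᵒᵖ(h))`. -/
noncomputable def drinfeldTwist : H ⊗[k] H :=
  mulWith (SΔop k H) (γ k H) (comul : H →ₐ[k] H ⊗[k] H).toLinearMap (qL k H)

/-- The inverse `F⁻¹ = Δ(S(P) α Q) · δ · (S ⊗ S)(Δᵒᵖ(R))` of Drinfeld's twist. -/
noncomputable def drinfeldTwistInv : H ⊗[k] H :=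
  mulWith (comul : H →ₐ[k] H ⊗[k] H).toLinearMap (δ k H) (SΔop k H)
    ((mα k H).rTensor H ((TensorProduct.assoc k H H H).symm (PhiInv k H)))

/-- `G = S⁻¹(b) ⊗ S⁻¹(a)` where `F⁻¹ = a ⊗ b`; it satisfies
`G · (S⁻¹ ⊗ S⁻¹)(Δᵒᵖ(h)) · G⁻¹ = Δ(S⁻¹(h))`. -/
noncomputable def drinfeldTwistG : H ⊗[k] H :=
  TensorProduct.map (S k H).symm.toLinearMap (S k H).symm.toLinearMap
    (TensorProduct.comm k H H (drinfeldTwistInv k H))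

/-- `a ⊗ b ⊗ c ↦ b ⊗ S(c) ⊗ a` -/
noncomputable def cyc : H ⊗[k] (H ⊗[k] H) →ₗ[k] H ⊗[k] (H ⊗[k] H) :=
  ((S k H).toLinearMap.rTensor H).lTensor H ∘ₗ (TensorProduct.assoc k H H H).toLinearMap ∘ₗ
    (TensorProduct.comm k H (H ⊗[k] H)).toLinearMap

/-- `Z¹ ⊗ S(Z²) ⊗ Y S⁻¹(β) S⁻¹(X)`, so that `κ(x) = S(Z²) x Y S⁻¹(β) S⁻¹(X)`. -/
noncomputable def kappaElt : H ⊗[k] (H ⊗[k] H) := cyc k H (idΔ k H (qR k H))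

/-- `X ⊗ S(Z) F¹ ⊗ S(Y) F²` -/
noncomputable def elL : H ⊗[k] (H ⊗[k] H) :=
  (TensorProduct.map (S k H).toLinearMap (S k H).toLinearMap ∘ₗ
    (TensorProduct.comm k H H).toLinearMap).lTensor H (Phi k H) * (1 ⊗ₜ[k] drinfeldTwist k H)

/-- `Y ⊗ S(Z) ⊗ S⁻¹(X)` -/
noncomputable def elM : H ⊗[k] (H ⊗[k] H) :=
  ((S k H).symm.toLinearMap.lTensor H).lTensor H (cyc k H (Phi k H))

/-- `Z ⊗ G¹ S⁻¹(Y) ⊗ G² S⁻¹(X)` -/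
noncomputable def elR : H ⊗[k] (H ⊗[k] H) :=
  (1 ⊗ₜ[k] drinfeldTwistG k H) *
    (TensorProduct.map (S k H).symm.toLinearMap (S k H).symm.toLinearMap ∘ₗ
      (TensorProduct.comm k H H).toLinearMap).lTensor H
        (TensorProduct.comm k (H ⊗[k] H) H ((TensorProduct.assoc k H H H).symm (Phi k H)))

end Twist

section Contramodule

variable {k H : Type u} [Field k] [Ring H] [Algebra k H]

/-- `a ⊗ b ⊗ c` sends a linear map `φ : H → M` to `x ↦ a φ(b x c)`. -/
noncomputable def twist (M : QHMod k H) : H ⊗[k] (H ⊗[k] H) →ₗ[k] Module.End k (H →ₗ[k] M) :=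
  mulWith (LinearMap.llcomp k H M M ∘ₗ M.ρ.toLinearMap) 1
    (TensorProduct.lift (LinearMap.mk₂ k
      (fun b c => LinearMap.lcomp k M (LinearMap.mulRight k c ∘ₗ LinearMap.mulLeft k b))
      (fun a a' b => by ext; simp [add_mul]) (fun c a b => by ext; simp)
      (fun a b b' => by ext; simp [mul_add]) (fun c a b => by ext; simp)))

@[simp] lemma twist_tmul (M : QHMod k H) (a b c : H) (φ : H →ₗ[k] M) (x : H) :
    twist M (a ⊗ₜ (b ⊗ₜ c)) φ x = M.ρ a (φ (b * x * c)) := rfl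

/-- `a ⊗ b ⊗ c` sends a bilinear map `f : H × H → M` to `(v, w) ↦ a f(b v, c w)`. -/
noncomputable def twist₂ (M : QHMod k H) :
    H ⊗[k] (H ⊗[k] H) →ₗ[k] Module.End k (H →ₗ[k] H →ₗ[k] M) :=
  mulWith (C := Module.End k (H →ₗ[k] H →ₗ[k] M))
    ((LinearMap.llcomp k H (H →ₗ[k] M) (H →ₗ[k] M) :
        ((H →ₗ[k] M) →ₗ[k] (H →ₗ[k] M)) →ₗ[k] Module.End k (H →ₗ[k] H →ₗ[k] M)) ∘ₗ
      LinearMap.llcomp k H M M ∘ₗ M.ρ.toLinearMap) 1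
    (TensorProduct.lift (LinearMap.mk₂ k
      (fun b c => LinearMap.llcomp k H (H →ₗ[k] M) (H →ₗ[k] M)
          (LinearMap.lcomp k M (LinearMap.mulLeft k c)) ∘ₗ
        LinearMap.lcomp k (H →ₗ[k] M) (LinearMap.mulLeft k b))
      (fun a a' b => by ext; simp [add_mul]) (fun c a b => by ext; simp)
      (fun a b b' => by ext; simp [add_mul]) (fun c a b => by ext; simp)))

@[simp] lemma twist₂_tmul (M : QHMod k H) (a b c : H) (f : H →ₗ[k] H →ₗ[k] M) (v w : H) :
    twist₂ M (a ⊗ₜ (b ⊗ₜ c)) f v w = M.ρ a (f (b * v) (c * w)) := rfl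

variable [QuasiHopfAlgebra k H]

/-- The map `τ_V` associated with a linear map `ν : Hom_k(H, M) → M`:
`τ_V(f)(v) = ν(x ↦ Z¹ f(κ(x) v))`, where `κ(x) = S(Z²) x Y S⁻¹(β) S⁻¹(X)`. -/
noncomputable def tau {M : QHMod k H} (ν : (H →ₗ[k] M) →ₗ[k] M) (V : QHMod k H) :
    (V →ₗ[k] M) →ₗ[k] V →ₗ[k] M :=
  LinearMap.mk₂ k
    (fun f v => ν (twist M (kappaElt k H) (f ∘ₗ LinearMap.applyₗ v ∘ₗ V.ρ.toLinearMap)))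
    (fun f f' v => by simp [LinearMap.add_comp])
    (fun c f v => by simp [LinearMap.smul_comp])
    (fun f v v' => by simp [LinearMap.comp_add, LinearMap.add_comp])
    (fun c f v => by simp [LinearMap.comp_smul, LinearMap.smul_comp])

end Contramodule

end QHopf

open QHopf QuasiBialgebra QuasiHopfAlgebra in
/-- A left-right anti-Yetter-Drinfeld contramodule of type II over a quasi-Hopf algebra: an
`H`-module `M` with a linear map `ν : Hom_k(H, M) → M`. -/
structure AYDContramoduleII (k H : Type u) [Field k] [Ring H] [Algebra k H]
    [QuasiHopfAlgebra k H] where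
  /-- the underlying module -/
  M : QHMod k H
  /-- the structure map -/
  ν : (H →ₗ[k] M) →ₗ[k] M
  /-- `h · ν(f) = ν(x ↦ h²¹ f(S(h²²) x h¹))` -/
  aYD : ∀ (h : H) (f : H →ₗ[k] M),
    M.ρ h (ν f) = ν (twist M (cyc k H (idΔ k H (comul h))) f)
  /-- For all bilinear `f : H × H → M`, written `f_v(w)`,
  `ν(h ↦ Z₁¹ Y ν(x ↦ Z₂¹ f_{S(Z) κ₁(h)}(κ₂(x) S⁻¹(X))))
    = Z ν(h ↦ Z₁¹ X' f_{S(Z') F¹ κ₁(h)¹ G¹ S⁻¹(Y)}(S(Y') F² κ₁(h)² G² S⁻¹(X)))`,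
  where `κᵢ(x) = S(Zᵢ²) x Yᵢ S⁻¹(β) S⁻¹(Xᵢ)`, and `X ⊗ Y ⊗ Z`, `X' ⊗ Y' ⊗ Z'`, `Xᵢ ⊗ Yᵢ ⊗ Zᵢ` are
  copies of `Φ`. -/
  contra : ∀ f : H →ₗ[k] H →ₗ[k] M,
    tau ν (QHMod.regular k H) ((twist₂ M (elM k H) (tau ν (QHMod.regular k H) ∘ₗ f)).flip 1) 1 =
      twist₂ M (elR k H) (TensorProduct.curry
        (tau ν (QHMod.tensor (QHMod.regular k H) (QHMod.regular k H))
          (TensorProduct.lift (twist₂ M (elL k H) f)))) 1 1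
  /-- `ν(x ↦ ε(β) ε(x) m) = m` -/
  unit : ∀ m : M, ν ((counit (β k : H) : k) •
    (counit : H →ₐ[k] k).toLinearMap.smulRight m) = m

namespace AYDContramoduleII

variable {k H : Type u} [Field k] [Ring H] [Algebra k H] [QuasiHopfAlgebra k H]

/-- A morphism is an `H`-linear map commuting with the structure maps. -/
@[ext] structure Hom (X Y : AYDContramoduleII k H) where
  /-- the underlying `H`-linear map -/
  t : X.M ⟶ Y.M
  comm : ∀ f : H →ₗ[k] X.M, t.lin (X.ν f) = Y.ν (t.lin ∘ₗ f)

instance : Category (AYDContramoduleII k H) where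
  Hom := Hom
  id X := ⟨𝟙 X.M, fun _ => rfl⟩
  comp f g := ⟨f.t ≫ g.t, fun φ => by
    rw [QHMod.comp_lin, LinearMap.comp_apply, f.comm, g.comm, LinearMap.comp_assoc]⟩
  id_comp f := Hom.ext (Category.id_comp f.t)
  comp_id f := Hom.ext (Category.comp_id f.t)
  assoc f g h := Hom.ext (Category.assoc f.t g.t h.t)

/-- The forgetful functor to `H`-modules. -/
def forget (k H : Type u) [Field k] [Ring H] [Algebra k H] [QuasiHopfAlgebra k H] :
    AYDContramoduleII k H ⥤ QHMod k H where
  obj X := X.M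
  map f := f.t

end AYDContramoduleII

namespace WeakCenter

variable {k H : Type u} [Field k] [Ring H] [Algebra k H] [QuasiHopfAlgebra k H]

/-- The structure map `τ_V` of an object of the weak center of `H`-modules, as a linear map
`Hom_k(V, M) → Hom_k(V, M)`. -/
noncomputable def tauLin (X : WeakCenter (QHMod k H)) (V : QHMod k H) :
    (V →ₗ[k] X.M) →ₗ[k] V →ₗ[k] X.M :=
  (X.τ V).lin

/-- The map `ν(f) = evʳ(1 ⊗ τ_H(f)) = R · τ_H(f)(S⁻¹(Q) S⁻¹(α) P)`; in other words
`ν(f) = τ'_H(1 ⊗ f)`, where `τ'_H : H ⊗ Homˡ(H, M) ⟶ M` corresponds to `τ_H` under the adjunction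
of `H ⊗ -` and `Homʳ(H, -)`. -/
noncomputable def nuLin (X : WeakCenter (QHMod k H)) : (H →ₗ[k] X.M) →ₗ[k] X.M :=
  QHMod.Hom.lin (QHMod.ηR (T := QHMod.homL (QHMod.regular k H) X.M) (X.τ (QHMod.regular k H))) ∘ₗ
    TensorProduct.mk k H (H →ₗ[k] X.M) 1

end WeakCenter

/-! Under the adjunction of V ⊗ - and Homʳ(V, -), a map τ_V : V ▷ M → M ◁ V is the same thing as an
H-linear map τ'_V : V ⊗ Homˡ(V, M) → M. Every v ∈ V is the image of 1 under the H-linear map `orbit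
V v`, h ↦ h v, so naturality along it forces τ'_V(v ⊗ f) = τ'_H(1 ⊗ (x ↦ f(x v))) = ν(x ↦ f(x v))
(`WeakCenter.ηR_τ`). A natural family is thus determined by the single linear map ν, and conversely
every linear ν gives a natural family by this formula (`coev`, `tau_comp`). Going back from τ'_V to
τ_V inserts the unit of the adjunction, Y S⁻¹(β) S⁻¹(X) ⊗ Z; this is where Z¹ and κ come from
(`tau_eq_coev`). It remains to match the axioms.

Linearity of τ'_V is the first contramodule axiom, because h(v ⊗ f) is h¹v ⊗ h²¹f(S(h²²) -)
(`coev_act`). The unit axiom is the third one: the isomorphism 1 ▷ M → M is φ ↦ ε(α) φ(1), and ε(α)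
ε(β) = 1 (`unit_axiom_iff`). Both sides of the hexagon are natural in V and W, so it suffices to
test it at V = W = H on the pair (1, 1) (`HexagonAt.comp`, `hexagonAt_of_regular`). There it is
literally the second axiom, once the three associativity maps are known to be the actions of `elL`,
`elM`, `elR` on bilinear maps (`assocLLin_tmul`, `assocMLin_eq`, `assocRLin_eq`).

These three formulas are the bulk of the proof. Unwinding the adjunctions turns each map into a
product of four or five copies of Φ and Φ⁻¹ in various bracketings, contracted by α, β and S. To
compute with such products, the copies are placed on "legs", algebra maps H → B with commuting
images, and `dl a b` is the compound leg h ↦ a(h¹) b(h²). The antipode axioms say that the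
contraction K sees certain compound legs only through ε, on the left next to an α and on the right
next to a β (`Leq`, `Req`). A copy of Φ with such an argument can be dropped once it reaches that
side. Copies are moved by coassociativity and recombined by the pentagon; this gives
`assocL_coherence`, `assocM_coherence` and `assocR_coherence`.

In the left case the surviving copies contract to γ and then to Drinfeld's twist F. In the mixed
case two of three surviving copies contract to 1 by X β S(Y) α Z = 1 and S(P) α Q β S(R) = 1, and
one Φ is left. In the right case they contract to δ, and G is recognised (`mulWith_δ_Phi`) from Δ(β)
F⁻¹ = δ and Δ(S(h)) F⁻¹ = F⁻¹ (S ⊗ S)(Δᵒᵖ(h)), both proved by the same leg calculus. That F and F⁻¹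
are inverse to each other is never used. -/

/-! ### Commuting legs in an algebra -/

namespace QHopf

open QuasiBialgebra QuasiHopfAlgebra

set_option maxSynthPendingDepth 6
set_option linter.unusedSectionVars false

section Legs

variable {k : Type u} [Field k]

/-- The images of two algebra maps commute elementwise. -/
class CommLeg {A A' B : Type u} [Ring A] [Algebra k A] [Ring A'] [Algebra k A'] [Ring B]
    [Algebra k B] (f : A →ₐ[k] B) (g : A' →ₐ[k] B) : Prop where
  comm : ∀ x y, Commute (f x) (g y)

variable {A A' A'' B C : Type u} [Ring A] [Algebra k A] [Ring A'] [Algebra k A'] [Ring A'']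
  [Algebra k A''] [Ring B] [Algebra k B] [Ring C] [Algebra k C]

/-- The low priority makes symmetry a last resort, after the structural instances for pairs,
composites and compound legs. -/
instance (priority := 10) commLeg_symm (f : A →ₐ[k] B) (g : A' →ₐ[k] B) [h : CommLeg f g] :
    CommLeg g f :=
  ⟨fun x y => (h.comm y x).symm⟩

/-- `x ⊗ y ↦ f x * g y` for commuting legs `f` and `g`. -/
noncomputable def pair (f : A →ₐ[k] B) (g : A' →ₐ[k] B) [CommLeg f g] : A ⊗[k] A' →ₐ[k] B :=
  Algebra.TensorProduct.lift f g CommLeg.comm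

@[simp] lemma pair_tmul (f : A →ₐ[k] B) (g : A' →ₐ[k] B) [CommLeg f g] (x : A) (y : A') :
    pair f g (x ⊗ₜ y) = f x * g y := by
  simp [pair]

instance commLeg_pair (f : A →ₐ[k] B) (g : A' →ₐ[k] B) (h : A'' →ₐ[k] B) [CommLeg f g]
    [CommLeg f h] [CommLeg g h] : CommLeg f (pair g h) where
  comm x t := by
    induction t with
    | zero => simp
    | add s t hs ht => rw [map_add]; exact hs.add_right ht
    | tmul y z => rw [pair_tmul]; exact (CommLeg.comm x y).mul_right (CommLeg.comm x z)

instance commLeg_comp (f : A →ₐ[k] B) (g : A' →ₐ[k] B) (h : A'' →ₐ[k] A') [CommLeg f g] :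
    CommLeg f (g.comp h) where
  comm x t := by rw [AlgHom.comp_apply]; exact CommLeg.comm x _

instance commLeg_includeLeft (f : A →ₐ[k] C) :
    CommLeg (Algebra.TensorProduct.includeLeft : B →ₐ[k] B ⊗[k] C)
      (Algebra.TensorProduct.includeRight.comp f) where
  comm x y := by simp [Commute, SemiconjBy]

instance commLeg_includeRight₀ :
    CommLeg (Algebra.TensorProduct.includeLeft : B →ₐ[k] B ⊗[k] C)
      (Algebra.TensorProduct.includeRight : C →ₐ[k] B ⊗[k] C) where
  comm x y := by simp [Commute, SemiconjBy]

instance commLeg_comp_comp (f : A →ₐ[k] B) (g : A' →ₐ[k] B) (h : B →ₐ[k] C) [CommLeg f g] :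
    CommLeg (h.comp f) (h.comp g) where
  comm x y := (CommLeg.comm x y).map h

variable {H : Type u} [Ring H] [Algebra k H] [QuasiBialgebra k H]

/-- The leg `h ↦ a(h¹) b(h²)`. -/
noncomputable def dl (a b : H →ₐ[k] B) [CommLeg a b] : H →ₐ[k] B := (pair a b).comp comul

/-- The trivial leg `h ↦ ε(h)`. -/
noncomputable def ηl (k H B : Type u) [Field k] [Ring H] [Algebra k H] [QuasiBialgebra k H]
    [Ring B] [Algebra k B] : H →ₐ[k] B := (Algebra.ofId k B).comp counit

@[simp] lemma ηl_apply (h : H) : ηl k H B h = algebraMap k B (counit h) := rfl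

lemma dl_apply (a b : H →ₐ[k] B) [CommLeg a b] (h : H) : dl a b h = pair a b (comul h) := rfl

instance commLeg_dl (f : A →ₐ[k] B) (a b : H →ₐ[k] B) [CommLeg a b] [CommLeg f a] [CommLeg f b] :
    CommLeg f (dl a b) :=
  inferInstanceAs (CommLeg f ((pair a b).comp comul))

instance commLeg_ηl (f : A →ₐ[k] B) : CommLeg f (ηl k H B) where
  comm _ _ := (Algebra.commutes _ _).symm

/-- `x ⊗ y ⊗ z ↦ a(x) b(y) c(z)` -/
noncomputable abbrev leg₃ (a b c : H →ₐ[k] B) [CommLeg a b] [CommLeg a c] [CommLeg b c] :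
    H ⊗[k] (H ⊗[k] H) →ₐ[k] B := pair a (pair b c)

/-- The associator `Φ` on three legs. -/
noncomputable def ph (a b c : H →ₐ[k] B) [CommLeg a b] [CommLeg a c] [CommLeg b c] : B :=
  leg₃ a b c (Phi k H)

/-- The inverse associator on three legs. -/
noncomputable def ph' (a b c : H →ₐ[k] B) [CommLeg a b] [CommLeg a c] [CommLeg b c] : B :=
  leg₃ a b c (PhiInv k H)

section three

variable (a b c : H →ₐ[k] B) [CommLeg a b] [CommLeg a c] [CommLeg b c]

@[simp] lemma ph_mul_ph' : ph a b c * ph' a b c = 1 := by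
  rw [ph, ph', ← map_mul, Units.mul_inv, map_one]

@[simp] lemma ph'_mul_ph : ph' a b c * ph a b c = 1 := by
  rw [ph, ph', ← map_mul, Units.inv_mul, map_one]

@[simp] lemma ph_mul_ph'_mul (u : B) : ph a b c * (ph' a b c * u) = u := by
  rw [← mul_assoc, ph_mul_ph', one_mul]

@[simp] lemma ph'_mul_ph_mul (u : B) : ph' a b c * (ph a b c * u) = u := by
  rw [← mul_assoc, ph'_mul_ph, one_mul]

lemma leg₃_idΔ (w : H ⊗[k] H) :
    leg₃ a b c (idΔ k H w) = pair a (dl b c) w := by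
  induction w with
  | zero => simp
  | add x y hx hy => simp only [map_add, hx, hy]
  | tmul x y => simp [idΔ, dl_apply]

lemma leg₃_assoc (t : H ⊗[k] H) (y : H) :
    leg₃ a b c (Algebra.TensorProduct.assoc k k k H H H (t ⊗ₜ y)) = pair a b t * c y := by
  induction t with
  | zero => simp
  | add s t hs ht => simp only [TensorProduct.add_tmul, map_add, add_mul, hs, ht]
  | tmul x z => simp [mul_assoc]

lemma leg₃_Δid (w : H ⊗[k] H) :
    leg₃ a b c (Δid k H w) = pair (dl a b) c w := by
  induction w with
  | zero => simp
  | add x y hx hy => simp only [map_add, hx, hy]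
  | tmul x y => simp [Δid, leg₃_assoc, dl_apply]

/-- Coassociativity on legs: moving Φ past a compound leg changes the bracketing of that leg from
(ab)c to a(bc). -/
lemma ph_nat (h : H) : ph a b c * dl (dl a b) c h = dl a (dl b c) h * ph a b c := by
  rw [dl_apply (dl a b), dl_apply a, ← leg₃_Δid, ← leg₃_idΔ, ph, ← map_mul, ← map_mul]
  congr 1
  have := coassoc (k := k) h
  change idΔ k H (comul h) = _ * Δid k H (comul h) * _ at this
  rw [this, mul_assoc, Units.inv_mul, mul_one]

lemma ph'_nat (h : H) : ph' a b c * dl a (dl b c) h = dl (dl a b) c h * ph' a b c := by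
  rw [← ph'_mul_ph_mul a b c (dl (dl a b) c h * ph' a b c), ← mul_assoc (ph a b c), ph_nat,
    mul_assoc, ph_mul_ph', mul_one]

end three

/-- An element that intertwines the individual legs intertwines everything built from them. This is
how one copy of Φ is moved past another: on legs it does not meet it commutes (`ph_comm`), on a
compound leg it rebrackets (`ph_nat`). -/
lemma pair_conj (g : B) {a a' : A →ₐ[k] B} {b b' : A' →ₐ[k] B} [CommLeg a b] [CommLeg a' b']
    (ha : ∀ x, g * a x = a' x * g) (hb : ∀ x, g * b x = b' x * g) (t : A ⊗[k] A') :
    g * pair a b t = pair a' b' t * g := by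
  induction t with
  | zero => simp
  | add s t hs ht => rw [map_add, map_add, mul_add, add_mul, hs, ht]
  | tmul x y => rw [pair_tmul, pair_tmul, ← mul_assoc, ha, mul_assoc, hb, mul_assoc]

lemma dl_conj (g : B) {a a' : H →ₐ[k] B} {b b' : H →ₐ[k] B} [CommLeg a b] [CommLeg a' b']
    (ha : ∀ x, g * a x = a' x * g) (hb : ∀ x, g * b x = b' x * g) (h : H) :
    g * dl a b h = dl a' b' h * g := pair_conj g ha hb _

section conj

variable {a b c a' b' c' : H →ₐ[k] B} [CommLeg a b] [CommLeg a c] [CommLeg b c]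
  [CommLeg a' b'] [CommLeg a' c'] [CommLeg b' c'] (g : B)

lemma ph_conj (ha : ∀ x, g * a x = a' x * g) (hb : ∀ x, g * b x = b' x * g)
    (hc : ∀ x, g * c x = c' x * g) : g * ph a b c = ph a' b' c' * g := pair_conj g ha (pair_conj g hb hc) _

lemma ph'_conj (ha : ∀ x, g * a x = a' x * g) (hb : ∀ x, g * b x = b' x * g)
    (hc : ∀ x, g * c x = c' x * g) : g * ph' a b c = ph' a' b' c' * g := pair_conj g ha (pair_conj g hb hc) _

end conj

lemma ph_comm (a b c : H →ₐ[k] B) [CommLeg a b] [CommLeg a c] [CommLeg b c] (x : A →ₐ[k] B)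
    [CommLeg x a] [CommLeg x b] [CommLeg x c] (h : A) : ph a b c * x h = x h * ph a b c :=
  (CommLeg.comm (f := x) (g := leg₃ a b c) h _).symm

lemma ph'_comm (a b c : H →ₐ[k] B) [CommLeg a b] [CommLeg a c] [CommLeg b c] (x : A →ₐ[k] B)
    [CommLeg x a] [CommLeg x b] [CommLeg x c] (h : A) : ph' a b c * x h = x h * ph' a b c :=
  (CommLeg.comm (f := x) (g := leg₃ a b c) h _).symm

/-! ### The pentagon on four legs and its rearrangements -/

section four

variable (a b c d : H →ₐ[k] B) [CommLeg a b] [CommLeg a c] [CommLeg a d] [CommLeg b c]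
  [CommLeg b d] [CommLeg c d]

lemma pair_assoc₃ (t : H ⊗[k] H) (y : H ⊗[k] H) :
    pair a (leg₃ b c d) (Algebra.TensorProduct.assoc k k k H H (H ⊗[k] H) (t ⊗ₜ y)) =
      pair a b t * pair c d y := by
  induction t with
  | zero => simp
  | add s t hs ht => simp only [TensorProduct.add_tmul, map_add, add_mul, hs, ht]
  | tmul x z => simp [mul_assoc]

lemma pair_rebr (T : H ⊗[k] (H ⊗[k] H)) (y : H) :
    pair a (leg₃ b c d) (rebr k H (T ⊗ₜ y)) = leg₃ a b c T * d y := by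
  induction T using ind₃ with
  | h0 => simp
  | hadd s t hs ht => simp only [TensorProduct.add_tmul, map_add, add_mul, hs, ht]
  | ht x z w => simp [rebr, mul_assoc]

lemma leg₄_dLst (T : H ⊗[k] (H ⊗[k] H)) :
    pair a (leg₃ b c d) (dLst k H T) = leg₃ a b (dl c d) T := by
  induction T using ind₃ with
  | h0 => simp
  | hadd x y hx hy => simp only [map_add, hx, hy]
  | ht x y z => simp [dLst, dl_apply]

lemma leg₄_dFst (T : H ⊗[k] (H ⊗[k] H)) :
    pair a (leg₃ b c d) (dFst k H T) = leg₃ (dl a b) c d T := by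
  induction T using ind₃ with
  | h0 => simp
  | hadd x y hx hy => simp only [map_add, hx, hy]
  | ht x y z =>
    simp only [dFst, AlgHom.comp_apply, Algebra.TensorProduct.map_tmul, AlgHom.id_apply]
    exact (pair_assoc₃ a b c d _ _).trans (by simp [dl_apply])

lemma leg₄_dMid (T : H ⊗[k] (H ⊗[k] H)) :
    pair a (leg₃ b c d) (dMid k H T) = leg₃ a (dl b c) d T := by
  induction T using ind₃ with
  | h0 => simp
  | hadd x y hx hy => simp only [map_add, hx, hy]
  | ht x y z =>
    have : dMid k H (x ⊗ₜ (y ⊗ₜ z)) = x ⊗ₜ Δid k H (y ⊗ₜ z) := rfl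
    rw [this, pair_tmul, leg₃_Δid, pair_tmul, pair_tmul, pair_tmul]

lemma leg₄_padR (T : H ⊗[k] (H ⊗[k] H)) :
    pair a (leg₃ b c d) (padR k H T) = leg₃ a b c T :=
  (pair_rebr a b c d T 1).trans (by rw [map_one, mul_one])

lemma leg₄_padL (T : H ⊗[k] (H ⊗[k] H)) :
    pair a (leg₃ b c d) (padL k H T) = leg₃ b c d T := by
  simp [padL]

/-- The pentagon identity on four legs. -/
lemma ph_pentagon : ph a b (dl c d) * ph (dl a b) c d =
    ph b c d * ph a (dl b c) d * ph a b c := by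
  have h := congrArg (pair a (leg₃ b c d)) (pentagon' k H)
  simp only [map_mul, leg₄_dLst, leg₄_dFst, leg₄_dMid, leg₄_padR, leg₄_padL] at h
  exact h

lemma ph_pentagon₁ : ph' b c d * ph a b (dl c d) =
    ph a (dl b c) d * ph a b c * ph' (dl a b) c d := by
  have h := congrArg (fun x => ph' b c d * x * ph' (dl a b) c d) (ph_pentagon a b c d)
  simpa only [mul_assoc, ph_mul_ph', mul_one, ph'_mul_ph_mul] using h

lemma ph_pentagon₂ : ph a b c * ph' (dl a b) c d =
    ph' a (dl b c) d * ph' b c d * ph a b (dl c d) := by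
  have h := congrArg (fun x => ph' a (dl b c) d * x) (ph_pentagon₁ a b c d)
  simp only [mul_assoc, ph'_mul_ph_mul] at h ⊢
  exact h.symm

lemma ph_pentagon₃ : ph b c d * ph a (dl b c) d =
    ph a b (dl c d) * ph (dl a b) c d * ph' a b c := by
  rw [ph_pentagon, mul_assoc, mul_assoc, ph_mul_ph', mul_one]

lemma ph_pentagon₄ : ph' a b c * ph' a (dl b c) d =
    ph' (dl a b) c d * ph' a b (dl c d) * ph b c d := by
  have h := congrArg (fun x => ph' (dl a b) c d * ph' a b (dl c d) * x * ph' a (dl b c) d)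
    (ph_pentagon₃ a b c d)
  simp only [mul_assoc, ph_mul_ph', mul_one, ph'_mul_ph_mul] at h ⊢
  exact h.symm

end four

/-! ### Counit legs, on which the associator is trivial -/

section counit

variable (a b : H →ₐ[k] B) [CommLeg a b]

lemma pair_ηl_left (t : H ⊗[k] H) : pair (ηl k H B) b t = b (epsL k H H t) := by
  induction t with
  | zero => simp
  | add s t hs ht => rw [map_add, map_add, map_add, hs, ht]
  | tmul x y => simp [Algebra.smul_def]

@[simp] lemma dl_ηl_left : dl (ηl k H B) b = b := by
  ext h
  rw [dl_apply, pair_ηl_left, epsL_comul]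

lemma leg₃_ηl_left (T : H ⊗[k] (H ⊗[k] H)) :
    leg₃ (ηl k H B) a b T = pair a b (epsL k H _ T) := by
  induction T using ind₃ with
  | h0 => simp
  | hadd s t hs ht => rw [map_add, map_add, map_add, hs, ht]
  | ht x y z => simp [Algebra.smul_def, mul_assoc]

lemma leg₃_ηl_mid (T : H ⊗[k] (H ⊗[k] H)) : leg₃ a (ηl k H B) b T =
    pair a b (Algebra.TensorProduct.map (AlgHom.id k H) (epsL k H H) T) := by
  induction T using ind₃ with
  | h0 => simp
  | hadd s t hs ht => rw [map_add, map_add, map_add, hs, ht]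
  | ht x y z => simp [Algebra.smul_def, Algebra.left_comm]

lemma leg₃_ηl_right (T : H ⊗[k] (H ⊗[k] H)) : leg₃ a b (ηl k H B) T =
    pair a b (Algebra.TensorProduct.map (AlgHom.id k H) (epsR k H H) T) := by
  induction T using ind₃ with
  | h0 => simp
  | hadd s t hs ht => rw [map_add, map_add, map_add, hs, ht]
  | ht x y z => simp [Algebra.smul_def, Algebra.commutes]

@[simp] lemma ph_ηl_left : ph (ηl k H B) a b = 1 := by
  rw [ph, leg₃_ηl_left, epsL_Phi, map_one]

@[simp] lemma ph_ηl_mid : ph a (ηl k H B) b = 1 := by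
  rw [ph, leg₃_ηl_mid, epsM_Phi, map_one]

@[simp] lemma ph_ηl_right : ph a b (ηl k H B) = 1 := by
  rw [ph, leg₃_ηl_right, epsR_Phi, map_one]

@[simp] lemma ph'_ηl_left : ph' (ηl k H B) a b = 1 := by
  rw [ph', leg₃_ηl_left, eps_inv _ epsL_Phi, map_one]

@[simp] lemma ph'_ηl_mid : ph' a (ηl k H B) b = 1 := by
  rw [ph', leg₃_ηl_mid, eps_inv _ epsM_Phi, map_one]

end counit

/-! ### Contractions -/

section Contraction

variable {N : Type u} [AddCommGroup N] [Module k N]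

/-- `K` does not distinguish left multiplication by the legs `z` and `z'`. -/
def Leq (K : B →ₗ[k] N) (z z' : A →ₐ[k] B) : Prop := ∀ h u, K (z h * u) = K (z' h * u)

/-- `K` does not distinguish right multiplication by the legs `z` and `z'`. -/
def Req (K : B →ₗ[k] N) (z z' : A →ₐ[k] B) : Prop := ∀ h u, K (u * z h) = K (u * z' h)

lemma Leq.pair_left {K : B →ₗ[k] N} {z z' : A →ₐ[k] B} (h : Leq K z z') (w : A' →ₐ[k] B)
    [CommLeg z w] [CommLeg z' w] : Leq K (pair z w) (pair z' w) := by
  intro t u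
  induction t with
  | zero => simp
  | add s t hs ht => simp only [map_add, add_mul, hs, ht]
  | tmul x y => simpa [mul_assoc] using h x (w y * u)

lemma Leq.pair_right {K : B →ₗ[k] N} {z z' : A →ₐ[k] B} (h : Leq K z z') (w : A' →ₐ[k] B)
    [CommLeg w z] [CommLeg w z'] : Leq K (pair w z) (pair w z') := by
  intro t u
  induction t with
  | zero => simp
  | add s t hs ht => simp only [map_add, add_mul, hs, ht]
  | tmul x y =>
    rw [pair_tmul, pair_tmul, (CommLeg.comm (f := w) (g := z) x y).eq,
      (CommLeg.comm (f := w) (g := z') x y).eq, mul_assoc, mul_assoc, h]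

lemma Req.pair_left {K : B →ₗ[k] N} {z z' : A →ₐ[k] B} (h : Req K z z') (w : A' →ₐ[k] B)
    [CommLeg z w] [CommLeg z' w] : Req K (pair z w) (pair z' w) := by
  intro t u
  induction t with
  | zero => simp
  | add s t hs ht => simp only [map_add, mul_add, hs, ht]
  | tmul x y =>
    rw [pair_tmul, pair_tmul, (CommLeg.comm (f := z) (g := w) x y).eq,
      (CommLeg.comm (f := z') (g := w) x y).eq, ← mul_assoc, ← mul_assoc, h]

lemma Req.pair_right {K : B →ₗ[k] N} {z z' : A →ₐ[k] B} (h : Req K z z') (w : A' →ₐ[k] B)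
    [CommLeg w z] [CommLeg w z'] : Req K (pair w z) (pair w z') := by
  intro t u
  induction t with
  | zero => simp
  | add s t hs ht => simp only [map_add, mul_add, hs, ht]
  | tmul x y => simpa [mul_assoc] using h y (u * w x)

variable {K : B →ₗ[k] N} {z z' : H →ₐ[k] B}

lemma Leq.dl_left (h : Leq K z z') (w : H →ₐ[k] B) [CommLeg z w] [CommLeg z' w] :
    Leq K (dl z w) (dl z' w) := fun x u => h.pair_left w (comul x) u

lemma Leq.dl_right (h : Leq K z z') (w : H →ₐ[k] B) [CommLeg w z] [CommLeg w z'] :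
    Leq K (dl w z) (dl w z') := fun x u => h.pair_right w (comul x) u

lemma Req.dl_left (h : Req K z z') (w : H →ₐ[k] B) [CommLeg z w] [CommLeg z' w] :
    Req K (dl z w) (dl z' w) := fun x u => h.pair_left w (comul x) u

lemma Req.dl_right (h : Req K z z') (w : H →ₐ[k] B) [CommLeg w z] [CommLeg w z'] :
    Req K (dl w z) (dl w z') := fun x u => h.pair_right w (comul x) u

lemma Leq.trans {z'' : A →ₐ[k] B} {z z' : A →ₐ[k] B} (h : Leq K z z') (h' : Leq K z' z'') :
    Leq K z z'' := fun x u => (h x u).trans (h' x u)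

/-- A left factor that commutes with the legs may be absorbed in the contraction. -/
lemma Leq.absorb {z z' : A →ₐ[k] B} (h : Leq K z z') (g : B) (hz : ∀ x, g * z x = z x * g)
    (hz' : ∀ x, g * z' x = z' x * g) : Leq (K ∘ₗ LinearMap.mulLeft k g) z z' := by
  intro x u
  simp only [LinearMap.comp_apply, LinearMap.mulLeft_apply, ← mul_assoc, hz, hz']
  simp only [mul_assoc, h x]

/-- A right factor that commutes with the legs may be absorbed in the contraction. -/
lemma Req.absorb {z z' : A →ₐ[k] B} (h : Req K z z') (g : B) (hz : ∀ x, g * z x = z x * g)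
    (hz' : ∀ x, g * z' x = z' x * g) : Req (K ∘ₗ LinearMap.mulRight k g) z z' := by
  intro x u
  simp only [LinearMap.comp_apply, LinearMap.mulRight_apply, mul_assoc, ← hz, ← hz']
  simp only [← mul_assoc, h x]

end Contraction

end Legs
end QHopf


namespace QHopf

open QuasiBialgebra QuasiHopfAlgebra

set_option maxSynthPendingDepth 6

/-! ### Coherence of contracted products of associators -/

section Coherence

variable {k : Type u} [Field k] {B : Type u} [Ring B] [Algebra k B] {H : Type u} [Ring H]
  [Algebra k H] [QuasiBialgebra k H] {N : Type u} [AddCommGroup N] [Module k N] {K : B →ₗ[k] N}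

section collapse

variable {z : H →ₐ[k] B} (x y : H →ₐ[k] B) [CommLeg z x] [CommLeg z y] [CommLeg x y] (g u : B)

lemma ηl_comm (h : H) : g * ηl k H B h = ηl k H B h * g := (Algebra.commutes _ _).symm

lemma Leq.absorb_ηl (h : Leq K z (ηl k H B)) (hg : ∀ h, g * z h = z h * g) :
    Leq (K ∘ₗ LinearMap.mulLeft k g) z (ηl k H B) := h.absorb g hg (ηl_comm g)

lemma Req.absorb_ηl (h : Req K z (ηl k H B)) (hg : ∀ h, g * z h = z h * g) :
    Req (K ∘ₗ LinearMap.mulRight k g) z (ηl k H B) := h.absorb g hg (ηl_comm g)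

variable {g}

/-- Once the contraction has replaced one argument of Φ by ε, Φ becomes 1. The factor g that
separates Φ from the edge of the product need only commute with that one leg. The four lemmas that
follow are the other positions and signs that occur. -/
lemma Leq.ph_mid (h : Leq K z (ηl k H B)) (hg : ∀ h, g * z h = z h * g) :
    K (g * ph x z y * u) = K (g * u) := by
  have := ((h.absorb_ηl g hg).pair_left y).pair_right x (Phi k H) u
  change K (g * (ph x z y * u)) = K (g * (ph x (ηl k H B) y * u)) at this
  rw [mul_assoc, this, ph_ηl_mid, one_mul]

lemma Leq.ph'_mid (h : Leq K z (ηl k H B)) (hg : ∀ h, g * z h = z h * g) :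
    K (g * ph' x z y * u) = K (g * u) := by
  have := ((h.absorb_ηl g hg).pair_left y).pair_right x (PhiInv k H) u
  change K (g * (ph' x z y * u)) = K (g * (ph' x (ηl k H B) y * u)) at this
  rw [mul_assoc, this, ph'_ηl_mid, one_mul]

lemma Leq.ph'_left (h : Leq K z (ηl k H B)) (hg : ∀ h, g * z h = z h * g) :
    K (g * ph' z x y * u) = K (g * u) := by
  have := (h.absorb_ηl g hg).pair_left (pair x y) (PhiInv k H) u
  change K (g * (ph' z x y * u)) = K (g * (ph' (ηl k H B) x y * u)) at this
  rw [mul_assoc, this, ph'_ηl_left, one_mul]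

lemma Req.ph_right (h : Req K z (ηl k H B)) (hg : ∀ h, g * z h = z h * g) :
    K (u * ph x y z * g) = K (u * g) := by
  have := ((h.absorb_ηl g hg).pair_right y).pair_right x (Phi k H) u
  change K ((u * ph x y z) * g) = K ((u * ph x y (ηl k H B)) * g) at this
  rw [this, ph_ηl_right, mul_one]

lemma Req.ph'_left (h : Req K z (ηl k H B)) (hg : ∀ h, g * z h = z h * g) :
    K (u * ph' z x y * g) = K (u * g) := by
  have := (h.absorb_ηl g hg).pair_left (pair x y) (PhiInv k H) u
  change K ((u * ph' z x y) * g) = K ((u * ph' (ηl k H B) x y) * g) at this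
  rw [this, ph'_ηl_left, mul_one]

end collapse

section assocL

variable (a b c d e r : H →ₐ[k] B) [CommLeg a b] [CommLeg a c] [CommLeg a d] [CommLeg a e]
  [CommLeg a r] [CommLeg b c] [CommLeg b d] [CommLeg b e] [CommLeg b r] [CommLeg c d] [CommLeg c e]
  [CommLeg c r] [CommLeg d e] [CommLeg d r] [CommLeg e r]

/-- The left side is what the adjunctions produce for the associativity of Homˡ. The right side is
sorted so that it can be contracted: its first two factors give γ, the third completes γ to F, and
the last involves only a, b, c. The contracted pairs are nested, cd inside be, so that b((cd)e) also
reduces to ε. -/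
lemma assocL_coherence (hcd : Leq K (dl c d) (ηl k H B)) (hbe : Leq K (dl b e) (ηl k H B))
    (hr : Req K (dl (dl d e) r) (ηl k H B)) :
    K (ph a b e * ph (dl a b) c d * ph' (dl (dl a b) c) d e * ph' (dl (dl a b) c) (dl d e) r) =
      K (ph' c d e * ph b c (dl d e) * ph' (dl b c) (dl d e) r * ph a b c) := by
  have h1 : Leq K (dl (dl c d) e) e := by simpa using hcd.dl_left e
  have h2 : Leq K (dl b (dl (dl c d) e)) (ηl k H B) := (h1.dl_right b).trans hbe
  -- Since cd is invisible on the left, e may be enlarged to (cd)e and a copy of Φ on ab, cd, e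
  -- inserted for free; this is the copy that the pentagon on ab, c, d, e is missing.
  have h3 : ∀ u, K (ph a b (dl (dl c d) e) * ph (dl a b) (dl c d) e * u) = K (ph a b e * u) := by
    intro u
    rw [mul_assoc]
    refine ((h1.pair_right b).pair_right a (Phi k H) _).trans ?_
    change K (ph a b e * _) = _
    rw [← mul_assoc]
    exact hcd.ph_mid _ _ _ (ph_comm _ _ _ _)
  have h4 : ph' c d e * ph a b (dl c (dl d e)) = ph a b (dl (dl c d) e) * ph' c d e :=
    ph_conj _ (ph'_comm _ _ _ _) (ph'_comm _ _ _ _) (ph'_nat _ _ _)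
  have h5 : ph a b c * ph' (dl (dl a b) c) (dl d e) r = ph' (dl a (dl b c)) (dl d e) r * ph a b c :=
    ph'_conj _ (ph_nat _ _ _) (ph_comm _ _ _ _) (ph_comm _ _ _ _)
  -- Carries Φ⁻¹ on a, (bc)(de), r to the left edge; on the way its middle argument is rebracketed
  -- to b((cd)e), which the contraction sees as ε.
  have h6 : ph' c d e * ph b c (dl d e) * ph' a (dl (dl b c) (dl d e)) r =
      ph' a (dl b (dl (dl c d) e)) r * (ph' c d e * ph b c (dl d e)) := by
    rw [mul_assoc, ph'_conj (ph b c (dl d e)) (a' := a) (b' := dl b (dl c (dl d e))) (c' := r)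
      (ph_comm _ _ _ _) (ph_nat _ _ _) (ph_comm _ _ _ _), ← mul_assoc,
      ph'_conj (ph' c d e) (a' := a) (b' := dl b (dl (dl c d) e)) (c' := r)
      (ph'_comm _ _ _ _) (dl_conj _ (ph'_comm _ _ _ _) (ph'_nat _ _ _)) (ph'_comm _ _ _ _),
      mul_assoc]
  calc _ = K (ph a b (dl (dl c d) e) * (ph (dl a b) (dl c d) e * ph (dl a b) c d *
        ph' (dl (dl a b) c) d e) * ph' (dl (dl a b) c) (dl d e) r) := by
        have := h3 (ph (dl a b) c d * ph' (dl (dl a b) c) d e * ph' (dl (dl a b) c) (dl d e) r)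
        simp only [mul_assoc] at this ⊢
        exact this.symm
    _ = K (ph' c d e * (ph a b (dl c (dl d e)) * ph (dl a b) c (dl d e)) *
        ph' (dl (dl a b) c) (dl d e) r) := by
        rw [← ph_pentagon₁, ← mul_assoc, ← h4, mul_assoc (ph' c d e)]
    _ = K (ph' c d e * ph b c (dl d e) * (ph a (dl b c) (dl d e) *
        ph' (dl a (dl b c)) (dl d e) r) * ph a b c) := by
        rw [ph_pentagon]
        simp only [mul_assoc, h5]
    _ = K ((ph' c d e * ph b c (dl d e) * ph' a (dl (dl b c) (dl d e)) r *
        ph' (dl b c) (dl d e) r) * ph a (dl b c) (dl (dl d e) r) * ph a b c) := by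
        rw [ph_pentagon₂]
        simp only [mul_assoc]
    _ = K (1 * ph' a (dl b (dl (dl c d) e)) r *
          (ph' c d e * ph b c (dl d e) * ph' (dl b c) (dl d e) r * ph a b c)) := by
        rw [hr.ph_right _ _ _ (ph_comm _ _ _ _), h6]
        simp only [mul_assoc, one_mul]
    _ = _ := by
        rw [h2.ph'_mid _ _ _ (fun _ => by rw [one_mul, mul_one]), one_mul]

end assocL

section assocM

variable (s a b c d e r : H →ₐ[k] B) [CommLeg s a] [CommLeg s b] [CommLeg s c] [CommLeg s d]
  [CommLeg s e] [CommLeg s r] [CommLeg a b] [CommLeg a c] [CommLeg a d] [CommLeg a e]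
  [CommLeg a r] [CommLeg b c] [CommLeg b d] [CommLeg b e] [CommLeg b r] [CommLeg c d] [CommLeg c e]
  [CommLeg c r] [CommLeg d e] [CommLeg d r] [CommLeg e r]

/-- Five copies shrink to three. The zigzags d, e, r and s, a, b are contracted on both sides, d
with e and a with b from the left, e with r and s with a from the right. Each keeps exactly the copy
of Φ⁻¹ or Φ that the antipode axioms evaluate to 1. -/
lemma assocM_coherence (hab : Leq K (dl a b) (ηl k H B)) (hde : Leq K (dl d e) (ηl k H B))
    (her : Req K (dl e r) (ηl k H B)) (hsa : Req K (dl s a) (ηl k H B)) :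
    K (ph' a b c * ph (dl b c) d e * ph a (dl (dl b c) d) e *
      ph' (dl a (dl (dl b c) d)) e r * ph s a (dl (dl b c) d)) =
      K (ph' d e r * ph s a b * ph b c d) := by
  have one : ∀ {z : H →ₐ[k] B} (h), (1 : B) * z h = z h * 1 := fun _ => by rw [one_mul, mul_one]
  have e1 : ph (dl b c) d e * ph a (dl (dl b c) d) e =
      ph a (dl b c) (dl d e) * ph (dl a (dl b c)) d e * ph' a (dl b c) d := ph_pentagon₃ _ _ _ _
  have e2 : ph' a b c * ph (dl a (dl b c)) d e = ph (dl (dl a b) c) d e * ph' a b c :=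
    ph_conj _ (ph'_nat _ _ _) (ph'_comm _ _ _ _) (ph'_comm _ _ _ _)
  have e3 : ph' a b c * ph' a (dl b c) d = ph' (dl a b) c d * ph' a b (dl c d) * ph b c d :=
    ph_pentagon₄ _ _ _ _
  have e4 : ph b c d * ph' (dl a (dl (dl b c) d)) e r = ph' (dl a (dl b (dl c d))) e r * ph b c d :=
    ph'_conj _ (dl_conj _ (ph_comm _ _ _ _) (ph_nat _ _ _)) (ph_comm _ _ _ _) (ph_comm _ _ _ _)
  have e5 : ph b c d * ph s a (dl (dl b c) d) = ph s a (dl b (dl c d)) * ph b c d :=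
    ph_conj _ (ph_comm _ _ _ _) (ph_comm _ _ _ _) (ph_nat _ _ _)
  have e6 : ph' a b (dl c d) * ph' (dl a (dl b (dl c d))) e r =
      ph' (dl (dl a b) (dl c d)) e r * ph' a b (dl c d) :=
    ph'_conj _ (ph'_nat _ _ _) (ph'_comm _ _ _ _) (ph'_comm _ _ _ _)
  have h1 : Leq K (dl (dl a b) (dl c d)) (dl c d) := by simpa using hab.dl_left (dl c d)
  have h2 : Leq K (dl (dl a b) c) c := by simpa using hab.dl_left c
  -- The right end of the product. It contains neither e nor r, so a compound leg er standing before
  -- it can be moved to the right edge and contracted there.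
  set R := ph' a b (dl c d) * ph s a (dl b (dl c d)) * ph b c d with hR
  have hRe : ∀ h, R * dl e r h = dl e r h * R := by
    intro h
    rw [hR, mul_assoc, mul_assoc, ph_comm, ← mul_assoc (ph s a _), ph_comm, mul_assoc,
      ← mul_assoc, ph'_comm, mul_assoc, mul_assoc]
  calc _ = K (ph' a b c * (ph (dl b c) d e * ph a (dl (dl b c) d) e) *
        (ph' (dl a (dl (dl b c) d)) e r * ph s a (dl (dl b c) d))) := by simp only [mul_assoc]
    _ = K (ph' a b c * ph a (dl b c) (dl d e) * (ph (dl a (dl b c)) d e * ph' a (dl b c) d *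
        (ph' (dl a (dl (dl b c) d)) e r * ph s a (dl (dl b c) d)))) := by
        rw [e1]; simp only [mul_assoc]
    _ = K (ph' a b c * (ph (dl a (dl b c)) d e * ph' a (dl b c) d *
        (ph' (dl a (dl (dl b c) d)) e r * ph s a (dl (dl b c) d)))) := by
        have := ((hde.absorb_ηl (ph' a b c) (ph'_comm _ _ _ _)).pair_right (dl b c)).pair_right a
          (Phi k H) (ph (dl a (dl b c)) d e * ph' a (dl b c) d *
        (ph' (dl a (dl (dl b c) d)) e r * ph s a (dl (dl b c) d)))
        change K (ph' a b c * (ph a (dl b c) (dl d e) * _)) =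
          K (ph' a b c * (ph a (dl b c) (ηl k H B) * _)) at this
        rw [mul_assoc, this, ph_ηl_right, one_mul]
    _ = K (ph (dl (dl a b) c) d e * (ph' a b c * ph' a (dl b c) d *
        (ph' (dl a (dl (dl b c) d)) e r * ph s a (dl (dl b c) d)))) := by
        simp only [← mul_assoc, e2]
    _ = K (ph c d e * (ph' (dl a b) c d * (ph' a b (dl c d) *
        (ph b c d * ph' (dl a (dl (dl b c) d)) e r * ph s a (dl (dl b c) d))))) := by
        refine (h2.pair_left (pair d e) (Phi k H) _).trans ?_
        rw [e3]
        simp only [mul_assoc]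
        rfl
    _ = K (ph c d e * ph' (dl a b) c d * (ph' (dl (dl a b) (dl c d)) e r * R)) := by
        rw [e4, mul_assoc (ph' (dl a _) e r), e5, ← mul_assoc (ph' a b _) (ph' _ _ _),
          e6, hR]
        simp only [mul_assoc]
    _ = K (ph c d e * (ph' (dl (dl a b) (dl c d)) e r * R)) := by
        exact hab.ph'_left _ _ _ (ph_comm _ _ _ _)
    _ = K (ph c d e * ph' (dl c d) e r * R) := by
        have := hab.absorb_ηl (ph c d e) (ph_comm _ _ _ _)
        have h3 : Leq (K ∘ₗ LinearMap.mulLeft k (ph c d e)) (dl (dl a b) (dl c d)) (dl c d) := by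
          simpa using this.dl_left (dl c d)
        rw [mul_assoc]
        exact h3.pair_left (pair e r) (PhiInv k H) R
    _ = K (1 * ph' c (dl d e) r * (ph' d e r * ph c d (dl e r) * R)) := by
        rw [ph_pentagon₂]; simp only [mul_assoc, one_mul]
    _ = K (ph' d e r * R) := by
        rw [hde.ph'_mid _ _ _ one, one_mul, her.ph_right _ _ _ hRe]
    -- The pentagon on s, a, b, cd splits R so that ab sits in a copy to be contracted from the left
    -- and sa in one to be contracted from the right.
    _ = K (ph' d e r * ph s (dl a b) (dl c d) * (ph s a b * ph' (dl s a) b (dl c d) * ph b c d)) := by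
        rw [hR, ph_pentagon₁]
        simp only [mul_assoc]
    _ = K ((ph' d e r * ph s a b) * ph' (dl s a) b (dl c d) * ph b c d) := by
        rw [hab.ph_mid _ _ _ (ph'_comm _ _ _ _)]
        simp only [mul_assoc]
    _ = _ := hsa.ph'_left _ _ _ (ph_comm _ _ _ _)

end assocM

section assocR

variable (a b c d e f : H →ₐ[k] B) [CommLeg a b] [CommLeg a c] [CommLeg a d] [CommLeg a e]
  [CommLeg a f] [CommLeg b c] [CommLeg b d] [CommLeg b e] [CommLeg b f] [CommLeg c d] [CommLeg c e]
  [CommLeg c f] [CommLeg d e] [CommLeg d f] [CommLeg e f]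

/-- The right side consists of two nested coevaluations, on b, c and on a, d, together with the
associator between them. The left side has the single coevaluation Φ on ab, cd, x of a tensor
product, and the product Φ⁻¹ on a, b, cd times Φ on b, c, d, whose contraction is δ. By the pentagon
they differ only by copies of Φ with the contracted argument bc. -/
lemma coev_coherence (x : H →ₐ[k] B) [CommLeg a x] [CommLeg b x] [CommLeg c x] [CommLeg d x]
    (hbc : Req K (dl b c) (ηl k H B)) (u : B) :
    K (u * (ph a b (dl (dl c d) x) * ph (dl a b) (dl c d) x * ph' a b (dl c d) * ph b c d)) =
      K (u * (ph' c d x * ph b c (dl d x) * ph a d x)) := by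
  have e1 : ph a (dl b (dl c d)) x * ph b c d = ph b c d * ph a (dl (dl b c) d) x :=
    (ph_conj _ (ph_comm _ _ _ _) (ph_nat _ _ _) (ph_comm _ _ _ _)).symm
  have e2 : ph b (dl c d) x * ph b c d = ph' c d x * ph b c (dl d x) * ph (dl b c) d x := by
    rw [mul_assoc, ph_pentagon, mul_assoc (ph c d x), ph'_mul_ph_mul]
  have h1 : Req K (dl (dl b c) d) d := by simpa using hbc.dl_left d
  calc _ = K (u * (ph' c d x * ph b c (dl d x)) * ph (dl b c) d x * ph a (dl (dl b c) d) x) := by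
        rw [ph_pentagon]
        simp only [mul_assoc, ph_mul_ph'_mul, e1]
        rw [← mul_assoc (ph b (dl c d) x), e2]
        simp only [mul_assoc]
    _ = K (u * (ph' c d x * ph b c (dl d x)) * ph (dl b c) d x * ph a d x) :=
        (h1.pair_left x).pair_right a (Phi k H) _
    _ = _ := by
        have := (hbc.absorb_ηl (ph a d x) (ph_comm _ _ _ _)).pair_left (pair d x) (Phi k H)
          (u * (ph' c d x * ph b c (dl d x)))
        change K (_ * ph (dl b c) d x * ph a d x) = K (_ * ph (ηl k H B) d x * ph a d x) at this
        rw [this, ph_ηl_left, mul_one, mul_assoc, mul_assoc]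

/-- After `coev_coherence`, the evaluation on cd, e, f meets the coevaluation of the tensor product,
and the pentagon lets one cancel against the other. What survives has the contraction δ at its right
end, for recognising G. -/
lemma assocR_coherence (he : Leq K (dl (dl c d) e) (ηl k H B)) (hbc : Req K (dl b c) (ηl k H B))
    (had : Req K (dl a d) (ηl k H B)) :
    K (ph' (dl c d) e f * ph' c d (dl e f) * ph b c (dl d (dl e f)) * ph a d (dl e f)) =
      K (ph a b f * ph (dl a b) (dl c d) e * (ph' a b (dl c d) * ph b c d)) := by
  have e1 : ph' (dl c d) e f * ph a b (dl (dl c d) (dl e f)) =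
      ph a b (dl (dl (dl c d) e) f) * ph' (dl c d) e f :=
    ph_conj _ (ph'_comm _ _ _ _) (ph'_comm _ _ _ _) (ph'_nat _ _ _)
  have e2 : ph' (dl (dl a b) (dl c d)) e f * (ph' a b (dl c d) * ph b c d) =
      ph' a b (dl c d) * ph b c d * ph' (dl a (dl (dl b c) d)) e f := by
    rw [← mul_assoc, ← ph'_conj (ph' a b (dl c d)) (a := dl a (dl b (dl c d))) (b := e) (c := f)
      (ph'_nat _ _ _) (ph'_comm _ _ _ _) (ph'_comm _ _ _ _), mul_assoc,
      ← ph'_conj (ph b c d) (a := dl a (dl (dl b c) d)) (b := e) (c := f)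
      (dl_conj _ (ph_comm _ _ _ _) (ph_nat _ _ _)) (ph_comm _ _ _ _) (ph_comm _ _ _ _), mul_assoc]
  -- The nested pairs are absorbed from the inside: first bc, after which only ad remains.
  have h1 : Req K (dl a (dl (dl b c) d)) (ηl k H B) := fun x u => by
    have h2 : Req K (dl (dl b c) d) d := by simpa using hbc.dl_left d
    rw [h2.dl_right a, had]
  have h3 : Leq K (dl (dl (dl c d) e) f) f := by simpa using he.dl_left f
  calc _ = K (ph' (dl c d) e f * (ph' c d (dl e f) * ph b c (dl d (dl e f)) * ph a d (dl e f))) := by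
        simp only [mul_assoc]
    _ = K (ph a b (dl (dl (dl c d) e) f) * (ph' (dl c d) e f * ph (dl a b) (dl c d) (dl e f) *
          (ph' a b (dl c d) * ph b c d))) := by
        rw [← coev_coherence a b c d (dl e f) hbc]
        simp only [← mul_assoc, e1]
    _ = K (ph a b f * ph (dl a b) (dl (dl c d) e) f * (ph (dl a b) (dl c d) e *
          (ph' (dl (dl a b) (dl c d)) e f * (ph' a b (dl c d) * ph b c d)))) := by
        refine ((h3.pair_right b).pair_right a (Phi k H) _).trans ?_
        rw [ph_pentagon₁]
        simp only [mul_assoc]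
        rfl
    _ = K (ph a b f * (ph (dl a b) (dl c d) e * (ph' a b (dl c d) * ph b c d)) *
          ph' (dl a (dl (dl b c) d)) e f * 1) := by
        rw [he.ph_mid _ _ _ (ph_comm _ _ _ _), e2]
        simp only [mul_assoc, mul_one]
    _ = _ := by
        rw [h1.ph'_left _ _ _ (fun _ => by rw [one_mul, mul_one])]
        simp only [mul_assoc, mul_one]

end assocR

end Coherence
end QHopf


namespace QHopf

open QuasiBialgebra QuasiHopfAlgebra

set_option maxSynthPendingDepth 6

/-! ### The inverse of Drinfeld's twist -/

section DrinfeldInverse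

variable (k H : Type u) [Field k] [Ring H] [Algebra k H]

open Algebra.TensorProduct in
/-- The first leg of `H ⊗ (H ⊗ (H ⊗ H))`. -/
noncomputable abbrev l₁ : H →ₐ[k] H ⊗[k] (H ⊗[k] (H ⊗[k] H)) := includeLeft

open Algebra.TensorProduct in
/-- The second leg of `H ⊗ (H ⊗ (H ⊗ H))`. -/
noncomputable abbrev l₂ : H →ₐ[k] H ⊗[k] (H ⊗[k] (H ⊗[k] H)) := includeRight.comp includeLeft

open Algebra.TensorProduct in
/-- The third leg of `H ⊗ (H ⊗ (H ⊗ H))`. -/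
noncomputable abbrev l₃ : H →ₐ[k] H ⊗[k] (H ⊗[k] (H ⊗[k] H)) :=
  includeRight.comp (includeRight.comp includeLeft)

open Algebra.TensorProduct in
/-- The fourth leg of `H ⊗ (H ⊗ (H ⊗ H))`. -/
noncomputable abbrev l₄ : H →ₐ[k] H ⊗[k] (H ⊗[k] (H ⊗[k] H)) :=
  includeRight.comp (includeRight.comp includeRight)

variable {k H} in
lemma ind₄ {p : H ⊗[k] (H ⊗[k] (H ⊗[k] H)) → Prop} (x : H ⊗[k] (H ⊗[k] (H ⊗[k] H))) (h0 : p 0)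
    (hadd : ∀ x y, p x → p y → p (x + y)) (ht : ∀ a b c d, p (a ⊗ₜ (b ⊗ₜ (c ⊗ₜ d)))) : p x := by
  induction x with
  | zero => exact h0
  | add x y hx hy => exact hadd x y hx hy
  | tmul a t =>
    induction t using ind₃ with
    | h0 => simpa using h0
    | hadd x y hx hy => simpa [TensorProduct.tmul_add] using hadd _ _ hx hy
    | ht b c d => exact ht a b c d

variable {k H} in
-- Every element of the fourfold tensor power is its own expression in the canonical legs, so
-- concrete elements such as those defining γ and δ can be treated by the leg calculus.
lemma pair_canonical (t : H ⊗[k] (H ⊗[k] (H ⊗[k] H))) :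
    pair (l₁ k H) (leg₃ (l₂ k H) (l₃ k H) (l₄ k H)) t = t := by
  induction t using ind₄ with
  | h0 => simp
  | hadd x y hx hy => rw [map_add, hx, hy]
  | ht a b c d => simp

variable [QuasiHopfAlgebra k H]

/-- `a ⊗ b ↦ S(b) ⊗ S(a)` -/
noncomputable def SS : H ⊗[k] H →ₗ[k] H ⊗[k] H :=
  TensorProduct.map (S k H).toLinearMap (S k H).toLinearMap ∘ₗ (TensorProduct.comm k H H).toLinearMap

/-- `a ⊗ b ↦ S⁻¹(b) ⊗ S⁻¹(a)` -/
noncomputable def SS' : H ⊗[k] H →ₗ[k] H ⊗[k] H :=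
  TensorProduct.map (S k H).symm.toLinearMap (S k H).symm.toLinearMap ∘ₗ
    (TensorProduct.comm k H H).toLinearMap

variable {k H}

@[simp] lemma SS_tmul (a b : H) : SS k H (a ⊗ₜ b) = S k H b ⊗ₜ S k H a := rfl

@[simp] lemma SS'_tmul (a b : H) : SS' k H (a ⊗ₜ b) = (S k H).symm b ⊗ₜ (S k H).symm a := rfl

lemma SΔop_apply (h : H) : SΔop k H h = SS k H (comul h) := rfl

lemma SS_mul (x y : H ⊗[k] H) : SS k H (x * y) = SS k H y * SS k H x := by
  induction x with
  | zero => simp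
  | add x x' hx hx' => simp only [add_mul, mul_add, map_add, hx, hx']
  | tmul a b =>
    induction y with
    | zero => simp
    | add y y' hy hy' => simp only [add_mul, mul_add, map_add, hy, hy']
    | tmul c d => simp [S_mul]

lemma SS'_mul (x y : H ⊗[k] H) : SS' k H (x * y) = SS' k H y * SS' k H x := by
  induction x with
  | zero => simp
  | add x x' hx hx' => simp only [add_mul, mul_add, map_add, hx, hx']
  | tmul a b =>
    induction y with
    | zero => simp
    | add y y' hy hy' => simp only [add_mul, mul_add, map_add, hy, hy']
    | tmul c d => simp [S_symm_mul]

lemma SS'_SS (x : H ⊗[k] H) : SS' k H (SS k H x) = x := by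
  induction x with
  | zero => simp
  | add x y hx hy => rw [map_add, map_add, hx, hy]
  | tmul a b => simp

lemma SΔop_mul (a b : H) : SΔop k H (a * b) = SΔop k H b * SΔop k H a := by
  rw [SΔop_apply, map_mul, SS_mul, ← SΔop_apply, ← SΔop_apply]

lemma SΔop_one : SΔop k H 1 = 1 := by
  simp [SΔop_apply, Algebra.TensorProduct.one_def, S_one]

variable (k H) in
/-- `a ⊗ b ⊗ c ⊗ d ↦ a β S(d) ⊗ b β S(c)` -/
noncomputable def δmap : H ⊗[k] (H ⊗[k] (H ⊗[k] H)) →ₗ[k] H ⊗[k] H :=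
  mulWith (Algebra.TensorProduct.includeLeft : H →ₐ[k] H ⊗[k] H).toLinearMap 1
    ((TensorProduct.comm k H H).toLinearMap ∘ₗ
      TensorProduct.map (mβ k H) (LinearMap.mulLeft k (β k) ∘ₗ (S k H).toLinearMap) ∘ₗ
      (TensorProduct.assoc k H H H).symm.toLinearMap)

@[simp] lemma δmap_tmul (a b c d : H) : δmap k H (a ⊗ₜ (b ⊗ₜ (c ⊗ₜ d))) =
    (a * (β k * S k H d)) ⊗ₜ (b * β k * S k H c) := by
  simp [δmap]

lemma δ_eq : δ k H = δmap k H (ph' (l₁ k H) (l₂ k H) (dl (l₃ k H) (l₄ k H)) *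
    ph (l₂ k H) (l₃ k H) (l₄ k H)) := by
  rw [ph', ← leg₄_dLst, ph, ← leg₄_padL (l₁ k H), pair_canonical, pair_canonical]
  rfl

/-- Both copies of β stand in the middle, so left multipliers on the first two legs come out on the
left and those on the last two come out, reversed by S, on the right. -/
lemma δmap_mul (x y t) : δmap k H (pair (pair (l₁ k H) (l₂ k H)) (pair (l₃ k H) (l₄ k H))
    (x ⊗ₜ y) * t) = x * δmap k H t * SS k H y := by
  induction x with
  | zero => simp
  | add x x' hx hx' => simp only [TensorProduct.add_tmul, map_add, add_mul, hx, hx']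
  | tmul a b =>
    induction y with
    | zero => simp
    | add y y' hy hy' => simp only [TensorProduct.tmul_add, map_add, mul_add, add_mul, hy, hy']
    | tmul c d =>
      induction t with
      | zero => simp
      | add t t' ht ht' => simp only [map_add, mul_add, add_mul, ht, ht']
      | tmul p t =>
        induction t using ind₃ with
        | h0 => simp
        | hadd t t' ht ht' =>
          simp only [TensorProduct.tmul_add, map_add, mul_add, add_mul, ht, ht']
        | ht q r s => simp [S_mul, mul_assoc]

/-- Right multipliers land next to β, where h¹ β S(h²) = ε(h) β applies. The same happens
independently for the legs 1 and 4. -/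
lemma δmap_req₂₃ : Req (δmap k H) (dl (l₂ k H) (l₃ k H)) (ηl k H _) := by
  intro h u
  have : ∀ (w : H ⊗[k] H) a b c d, δmap k H ((a ⊗ₜ (b ⊗ₜ (c ⊗ₜ d))) * pair (l₂ k H) (l₃ k H) w) =
      (a * (β k * S k H d)) ⊗ₜ (b * mβ k H w * S k H c) := by
    intro w a b c d
    induction w with
    | zero => simp
    | add x y hx hy => simp only [map_add, mul_add, add_mul, TensorProduct.tmul_add, hx, hy]
    | tmul x y => simp [S_mul, mul_assoc]
  induction u with
  | zero => simp
  | add t t' ht ht' => simp only [map_add, add_mul, ht, ht']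
  | tmul p t =>
    induction t using ind₃ with
    | h0 => simp
    | hadd t t' ht ht' => simp only [TensorProduct.tmul_add, map_add, add_mul, ht, ht']
    | ht q r s =>
      rw [dl_apply, this, mβ_comul, ηl_apply, ← Algebra.commutes, ← Algebra.smul_def]
      simp [mul_assoc]

lemma δmap_req₁₄ : Req (δmap k H) (dl (l₁ k H) (l₄ k H)) (ηl k H _) := by
  intro h u
  have : ∀ (w : H ⊗[k] H) a b c d, δmap k H ((a ⊗ₜ (b ⊗ₜ (c ⊗ₜ d))) * pair (l₁ k H) (l₄ k H) w) =
      (a * mβ k H w * S k H d) ⊗ₜ (b * β k * S k H c) := by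
    intro w a b c d
    induction w with
    | zero => simp
    | add x y hx hy => simp only [map_add, mul_add, add_mul, TensorProduct.add_tmul, hx, hy]
    | tmul x y => simp [S_mul, mul_assoc]
  induction u with
  | zero => simp
  | add t t' ht ht' => simp only [map_add, add_mul, ht, ht']
  | tmul p t =>
    induction t using ind₃ with
    | h0 => simp
    | hadd t t' ht ht' => simp only [TensorProduct.tmul_add, map_add, add_mul, ht, ht']
    | ht q r s =>
      rw [dl_apply, this, mβ_comul, ηl_apply, ← Algebra.commutes, ← Algebra.smul_def]
      simp [mul_assoc, TensorProduct.smul_tmul']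

/-- `Δ(h¹) · δ · (S ⊗ S)(Δᵒᵖ(h²)) = ε(h) δ` -/
lemma δ_inv (h : H) : mulWith (comul : H →ₐ[k] H ⊗[k] H).toLinearMap (δ k H) (SΔop k H) (comul h) =
    (counit h : k) • δ k H := by
  have e1 : ∀ w t, mulWith (comul : H →ₐ[k] H ⊗[k] H).toLinearMap (δmap k H t) (SΔop k H) w =
      δmap k H (pair (dl (l₁ k H) (l₂ k H)) (dl (l₃ k H) (l₄ k H)) w * t) := by
    intro w t
    induction w with
    | zero => simp
    | add x y hx hy => simp only [map_add, add_mul, hx, hy]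
    | tmul x y =>
      rw [mulWith_tmul, SΔop_apply, AlgHom.toLinearMap_apply, ← δmap_mul, pair_tmul, pair_tmul,
        dl_apply, dl_apply]
  -- The two copies of Φ inside δ change the bracketing 1((23)4) into (12)(34). So the outer factors
  -- become a nested pair on the right of δ, where the two β's absorb first 23 and then 14.
  have e2 : ∀ x, ph' (l₁ k H) (l₂ k H) (dl (l₃ k H) (l₄ k H)) *
      ph (l₂ k H) (l₃ k H) (l₄ k H) * dl (l₁ k H) (dl (dl (l₂ k H) (l₃ k H)) (l₄ k H)) x =
      dl (dl (l₁ k H) (l₂ k H)) (dl (l₃ k H) (l₄ k H)) x *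
      (ph' (l₁ k H) (l₂ k H) (dl (l₃ k H) (l₄ k H)) * ph (l₂ k H) (l₃ k H) (l₄ k H)) := by
    intro x
    rw [mul_assoc, dl_conj (ph (l₂ k H) (l₃ k H) (l₄ k H)) (a' := l₁ k H)
      (b' := dl (l₂ k H) (dl (l₃ k H) (l₄ k H))) (ph_comm _ _ _ _) (ph_nat _ _ _), ← mul_assoc,
      ph'_nat, mul_assoc]
  have e3 : Req (δmap k H) (dl (dl (l₂ k H) (l₃ k H)) (l₄ k H)) (l₄ k H) := by
    simpa using δmap_req₂₃.dl_left (l₄ k H)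
  rw [δ_eq, e1]
  change δmap k H (dl (dl (l₁ k H) (l₂ k H)) (dl (l₃ k H) (l₄ k H)) h * _) = _
  rw [← e2, e3.dl_right, δmap_req₁₄, ηl_apply, ← Algebra.commutes, ← Algebra.smul_def, map_smul]

variable (k H) in
/-- `a ⊗ b ⊗ c ↦ Δ(S(a) α b) · δ · (S ⊗ S)(Δᵒᵖ(c))` -/
noncomputable def twistInvMap : H ⊗[k] (H ⊗[k] H) →ₗ[k] H ⊗[k] H :=
  mulWith (comul : H →ₐ[k] H ⊗[k] H).toLinearMap (δ k H) (SΔop k H) ∘ₗ (mα k H).rTensor H ∘ₗ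
    (TensorProduct.assoc k H H H).symm.toLinearMap

lemma mulWith_mul_δ (x y : H) (w : H ⊗[k] H) :
    mulWith (comul : H →ₐ[k] H ⊗[k] H).toLinearMap (δ k H) (SΔop k H) ((x ⊗ₜ y) * w) =
      comul x * mulWith (comul : H →ₐ[k] H ⊗[k] H).toLinearMap (δ k H) (SΔop k H) w * SΔop k H y := by
  induction w with
  | zero => simp
  | add w w' hw hw' => simp only [map_add, mul_add, add_mul, hw, hw']
  | tmul p q => simp [SΔop_mul, mul_assoc]

/-- The coproduct in the last two slots surrounds δ and disappears by `δ_inv`; only the first slot,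
read through S, survives. -/
lemma twistInvMap_idΔ (w : H ⊗[k] H) (u : H ⊗[k] (H ⊗[k] H)) :
    twistInvMap k H (u * idΔ k H w) = comul (S k H (epsR k H H w)) * twistInvMap k H u := by
  induction w with
  | zero => simp
  | add x y hx hy => simp only [map_add, mul_add, add_mul, hx, hy]
  | tmul x y =>
    induction u using ind₃ with
    | h0 => simp
    | hadd x y hx hy => simp only [map_add, mul_add, add_mul, hx, hy]
    | ht a b c =>
      have : ∀ w : H ⊗[k] H, twistInvMap k H ((a ⊗ₜ (b ⊗ₜ c)) * (x ⊗ₜ w)) =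
          mulWith (comul : H →ₐ[k] H ⊗[k] H).toLinearMap (δ k H) (SΔop k H)
            (((S k H x * (S k H a * α k * b)) ⊗ₜ c) * w) := by
        intro w
        induction w with
        | zero => simp
        | add x y hx hy => simp only [TensorProduct.tmul_add, map_add, mul_add, hx, hy]
        | tmul p q => simp [twistInvMap, S_mul, mul_assoc]
      rw [idΔ_tmul, this, mulWith_mul_δ, δ_inv]
      simp [twistInvMap, mul_assoc]

/-- Here the coproduct in the first two slots surrounds α and disappears by the axiom for α. -/
lemma twistInvMap_Δid (w : H ⊗[k] H) (u : H ⊗[k] (H ⊗[k] H)) :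
    twistInvMap k H (Δid k H w * u) = twistInvMap k H u * SΔop k H (epsL k H H w) := by
  induction w with
  | zero => simp
  | add x y hx hy => simp only [map_add, mul_add, add_mul, hx, hy]
  | tmul x y =>
    induction u using ind₃ with
    | h0 => simp
    | hadd x y hx hy => simp only [map_add, mul_add, add_mul, hx, hy]
    | ht a b c =>
      have : ∀ w : H ⊗[k] H, twistInvMap k H
          (Algebra.TensorProduct.assoc k k k H H H (w ⊗ₜ y) * (a ⊗ₜ (b ⊗ₜ c))) =
          comul (S k H a * mα k H w * b) * δ k H * SΔop k H (y * c) := by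
        intro w
        induction w with
        | zero => simp
        | add x y hx hy =>
          simp only [TensorProduct.add_tmul, map_add, mul_add, add_mul, hx, hy]
        | tmul p q => simp [twistInvMap, S_mul, mul_assoc]
      rw [Δid_tmul, this, mα_comul]
      simp [twistInvMap, SΔop_mul, mul_assoc]

/-- `Δ(S(h)) F⁻¹ = F⁻¹ (S ⊗ S)(Δᵒᵖ(h))` -/
lemma comul_S_mul_drinfeldTwistInv (h : H) :
    comul (S k H h) * drinfeldTwistInv k H = drinfeldTwistInv k H * SΔop k H h := by
  -- Coassociativity of Φ⁻¹, evaluated by `twistInvMap` in its two forms, gives the two sides of the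
  -- claim.
  have e1 := twistInvMap_idΔ (comul h) (PhiInv k H)
  rw [coassoc'', twistInvMap_Δid, epsL_comul, epsR_comul] at e1
  exact e1.symm

/-- `Δ(β) F⁻¹ = δ` -/
lemma comul_β_mul_drinfeldTwistInv : comul (β k) * drinfeldTwistInv k H = δ k H := by
  -- K sends a ⊗ b ⊗ c ⊗ d to Δ(a β S(b) α c) δ (S ⊗ S)(Δᵒᵖ(d)). It takes 1 ⊗ Φ⁻¹ to Δ(β) F⁻¹ and Φ
  -- ⊗ 1 to δ, so it is enough that the pentagon relates these two up to copies of Φ that K ignores.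
  let K : H ⊗[k] (H ⊗[k] (H ⊗[k] H)) →ₗ[k] H ⊗[k] H :=
    mulWith (comul : H →ₐ[k] H ⊗[k] H).toLinearMap (δ k H) (SΔop k H) ∘ₗ onFirst₃ (f₃ k H)
  have hK : ∀ t d, K (rebr k H (t ⊗ₜ d)) = comul (f₃ k H t) * δ k H * SΔop k H d := by
    intro t d
    simp [K, onFirst₃_rebr]
  have hK' : ∀ a b c d, K (a ⊗ₜ (b ⊗ₜ (c ⊗ₜ d))) =
      comul (a * β k * (S k H b * α k * c)) * δ k H * SΔop k H d := fun a b c d =>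
    hK (a ⊗ₜ (b ⊗ₜ c)) d
  have hbc : Leq K (dl (l₂ k H) (l₃ k H)) (ηl k H _) := by
    intro h u
    have : ∀ (w : H ⊗[k] H) a b c d, K (pair (l₂ k H) (l₃ k H) w * (a ⊗ₜ (b ⊗ₜ (c ⊗ₜ d)))) =
        comul (a * β k * (S k H b * mα k H w * c)) * δ k H * SΔop k H d := by
      intro w a b c d
      induction w with
      | zero => simp
      | add x y hx hy => simp only [map_add, mul_add, add_mul, hx, hy]
      | tmul x y =>
        simp only [pair_tmul, AlgHom.comp_apply, Algebra.TensorProduct.includeLeft_apply,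
          Algebra.TensorProduct.includeRight_apply, Algebra.TensorProduct.tmul_mul_tmul, one_mul,
          mul_one, hK', S_mul, mα_tmul, mul_assoc]
    induction u using ind₄ with
    | h0 => simp
    | hadd x y hx hy => simp only [map_add, mul_add, hx, hy]
    | ht a b c d =>
      rw [dl_apply, this, mα_comul, ηl_apply, ← Algebra.smul_def, map_smul, hK']
      simp only [mul_smul_comm, smul_mul_assoc, map_smul]
  have hab : Req K (dl (l₁ k H) (l₂ k H)) (ηl k H _) := by
    intro h u
    have : ∀ (w : H ⊗[k] H) a b c d, K ((a ⊗ₜ (b ⊗ₜ (c ⊗ₜ d))) * pair (l₁ k H) (l₂ k H) w) =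
        comul (a * mβ k H w * (S k H b * α k * c)) * δ k H * SΔop k H d := by
      intro w a b c d
      induction w with
      | zero => simp
      | add x y hx hy => simp only [map_add, mul_add, add_mul, hx, hy]
      | tmul x y =>
        simp only [pair_tmul, AlgHom.comp_apply, Algebra.TensorProduct.includeLeft_apply,
          Algebra.TensorProduct.includeRight_apply, Algebra.TensorProduct.tmul_mul_tmul, one_mul,
          mul_one, hK', S_mul, mβ_tmul, mul_assoc]
    induction u using ind₄ with
    | h0 => simp
    | hadd x y hx hy => simp only [map_add, add_mul, hx, hy]
    | ht a b c d =>
      rw [dl_apply, this, mβ_comul, ηl_apply, ← Algebra.commutes, ← Algebra.smul_def, map_smul, hK']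
      simp only [mul_smul_comm, smul_mul_assoc, map_smul]
  have hcd : Req K (dl (l₃ k H) (l₄ k H)) (ηl k H _) := by
    intro h u
    have : ∀ (w : H ⊗[k] H) a b c d, K ((a ⊗ₜ (b ⊗ₜ (c ⊗ₜ d))) * pair (l₃ k H) (l₄ k H) w) =
        comul (a * β k * (S k H b * α k * c)) *
          mulWith (comul : H →ₐ[k] H ⊗[k] H).toLinearMap (δ k H) (SΔop k H) w * SΔop k H d := by
      intro w a b c d
      induction w with
      | zero => simp
      | add x y hx hy => simp only [map_add, mul_add, add_mul, hx, hy]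
      | tmul x y =>
        simp only [pair_tmul, AlgHom.comp_apply, Algebra.TensorProduct.includeLeft_apply,
          Algebra.TensorProduct.includeRight_apply, Algebra.TensorProduct.tmul_mul_tmul, one_mul,
          mul_one, hK', SΔop_mul, mulWith_tmul, mul_assoc, map_mul, AlgHom.toLinearMap_apply]
    induction u using ind₄ with
    | h0 => simp
    | hadd x y hx hy => simp only [map_add, add_mul, hx, hy]
    | ht a b c d =>
      rw [dl_apply, this, δ_inv, ηl_apply, ← Algebra.commutes, ← Algebra.smul_def, map_smul, hK']
      simp only [mul_smul_comm, smul_mul_assoc]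
  have e1 : K (padL k H (PhiInv k H)) = comul (β k) * drinfeldTwistInv k H := by
    have : ∀ T, K (padL k H T) = comul (β k) * twistInvMap k H T := by
      intro T
      induction T using ind₃ with
      | h0 => simp
      | hadd x y hx hy => simp only [map_add, mul_add, hx, hy]
      | ht a b c => simp [padL, hK', twistInvMap, mul_assoc]
    exact this _
  have e2 : K (padR k H (Phi k H)) = δ k H := by
    refine (hK (Phi k H) 1).trans ?_
    rw [f₃_Phi, map_one, one_mul, SΔop_one, mul_one]
  have c1 : ∀ (z : H →ₐ[k] H ⊗[k] (H ⊗[k] (H ⊗[k] H))) h, (1 * z h = z h * 1) :=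
    fun z h => by rw [one_mul, mul_one]
  rw [← e1, ← e2, ← pair_canonical (padL k H (PhiInv k H)), leg₄_padL,
    ← pair_canonical (padR k H (Phi k H)), leg₄_padR]
  change K (ph' _ _ _) = K (ph _ _ _)
  -- The other three copies in the pentagon each contain a contracted pair: 34 on the right by
  -- `δ_inv`, 12 on the right by β, and 23 on the left by α.
  have := hcd.ph_right (l₁ k H) (l₂ k H) (g := 1) (ph' (l₂ k H) (l₃ k H) (l₄ k H)) (c1 _)
  rw [mul_one, mul_one, ph_pentagon₁] at this
  rw [← this]
  have := hab.ph'_left (l₃ k H) (l₄ k H) (g := 1)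
    (ph (l₁ k H) (dl (l₂ k H) (l₃ k H)) (l₄ k H) * ph (l₁ k H) (l₂ k H) (l₃ k H)) (c1 _)
  rw [mul_one, mul_one] at this
  rw [this]
  have := hbc.ph_mid (l₁ k H) (l₄ k H) (g := 1) (ph (l₁ k H) (l₂ k H) (l₃ k H)) (c1 _)
  rwa [one_mul, one_mul] at this

/-- `G (S⁻¹ ⊗ S⁻¹)(Δᵒᵖ(h)) = Δ(S⁻¹(h)) G` -/
lemma drinfeldTwistG_mul (h : H) :
    drinfeldTwistG k H * SS' k H (comul h) = comul ((S k H).symm h) * drinfeldTwistG k H := by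
  have := congrArg (SS' k H) (comul_S_mul_drinfeldTwistInv ((S k H).symm h))
  rw [SS'_mul, SS'_mul, SΔop_apply, SS'_SS, LinearEquiv.apply_symm_apply] at this
  exact this

/-- `Δ(S⁻¹(β)) G = (S⁻¹ ⊗ S⁻¹)(δᵒᵖ)` -/
lemma comul_S_symm_β_mul_drinfeldTwistG :
    comul ((S k H).symm (β k)) * drinfeldTwistG k H = SS' k H (δ k H) := by
  rw [← drinfeldTwistG_mul, ← comul_β_mul_drinfeldTwistInv, SS'_mul]
  rfl

/-- `Δ(S⁻¹(Z) S⁻¹(α) Y) · (S⁻¹ ⊗ S⁻¹)(δᵒᵖ) · (S⁻¹ ⊗ S⁻¹)(Δᵒᵖ(X)) = G` -/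
lemma mulWith_δ_Phi : mulWith ((comul : H →ₐ[k] H ⊗[k] H).toLinearMap ∘ₗ (S k H).symm.toLinearMap ∘ₗ
      mα k H) (SS' k H (δ k H)) (SS' k H ∘ₗ (comul : H →ₐ[k] H ⊗[k] H).toLinearMap)
      (TensorProduct.comm k H (H ⊗[k] H) (Phi k H)) = drinfeldTwistG k H := by
  have : ∀ T, mulWith ((comul : H →ₐ[k] H ⊗[k] H).toLinearMap ∘ₗ (S k H).symm.toLinearMap ∘ₗ
      mα k H) (SS' k H (δ k H)) (SS' k H ∘ₗ (comul : H →ₐ[k] H ⊗[k] H).toLinearMap)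
      (TensorProduct.comm k H (H ⊗[k] H) T) =
        comul ((S k H).symm (f₃ k H T)) * drinfeldTwistG k H := by
    intro T
    induction T using ind₃ with
    | h0 => simp
    | hadd x y hx hy => simp only [map_add, add_mul, hx, hy]
    | ht a b c =>
      -- With Δ(S⁻¹(β)) G in place of the flipped δ, G is carried to the right past the term in X.
      -- What precedes it is then Δ(S⁻¹(X β S(Y) α Z)), which is 1 for Φ.
      rw [← comul_S_symm_β_mul_drinfeldTwistG]
      simp only [TensorProduct.comm_tmul, mulWith_tmul, LinearMap.comp_apply,
        AlgHom.toLinearMap_apply, LinearEquiv.coe_coe, mul_assoc, drinfeldTwistG_mul]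
      simp only [← mul_assoc, ← map_mul, f₃_tmul, S_symm_mul]
  rw [this, f₃_Phi, S_symm_one, map_one, one_mul]

end DrinfeldInverse

end QHopf


namespace QHopf

open QuasiBialgebra QuasiHopfAlgebra Algebra.TensorProduct

set_option maxSynthPendingDepth 6

/-! ### Legs composed with an algebra map -/

section CompLegs

variable {k : Type u} [Field k] {A A' B C H : Type u} [Ring A] [Algebra k A] [Ring A']
  [Algebra k A'] [Ring B] [Algebra k B] [Ring C] [Algebra k C] [Ring H] [Algebra k H]

lemma pair_comp (j : B →ₐ[k] C) (f : A →ₐ[k] B) (g : A' →ₐ[k] B) [CommLeg f g] (t : A ⊗[k] A') :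
    pair (j.comp f) (j.comp g) t = j (pair f g t) := by
  induction t with
  | zero => simp
  | add s t hs ht => simp only [map_add, hs, ht]
  | tmul x y => simp

variable [QuasiBialgebra k H]

lemma dl_comp (j : B →ₐ[k] C) (f g : H →ₐ[k] B) [CommLeg f g] :
    dl (j.comp f) (j.comp g) = j.comp (dl f g) := by
  ext h
  exact pair_comp j f g _

lemma ηl_comp (j : B →ₐ[k] C) : j.comp (ηl k H B) = ηl k H C := by
  ext h
  simp

end CompLegs

variable (k H : Type u) [Field k] [Ring H] [Algebra k H]

/-- The action of `(H ⊗ H) ⊗ (H ⊗ H)` on itself, rebracketed to the right. -/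
noncomputable abbrev l₁₂₃₄ :
    (H ⊗[k] H) ⊗[k] (H ⊗[k] H) →ₐ[k] H ⊗[k] (H ⊗[k] (H ⊗[k] H)) :=
  pair (pair (l₁ k H) (l₂ k H)) (pair (l₃ k H) (l₄ k H))

variable [QuasiHopfAlgebra k H]

/-! ### The associativity of the left internal hom -/

section ElementL

/-- `a ⊗ b ⊗ c ⊗ d ↦ S(b) α c ⊗ S(a) α d` -/
noncomputable def γmap : H ⊗[k] (H ⊗[k] (H ⊗[k] H)) →ₗ[k] H ⊗[k] H :=
  mulWith ((includeRight : H →ₐ[k] H ⊗[k] H).toLinearMap ∘ₗ (S k H).toLinearMap) 1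
    (TensorProduct.map (mα k H) (LinearMap.mulLeft k (α k)) ∘ₗ
      (TensorProduct.assoc k H H H).symm.toLinearMap)

variable {k H}

@[simp] lemma γmap_tmul (a b c d : H) : γmap k H (a ⊗ₜ (b ⊗ₜ (c ⊗ₜ d))) =
    (S k H b * α k * c) ⊗ₜ (S k H a * α k * d) := by
  simp [γmap, mul_assoc]

lemma γmap_mul (x y t) : γmap k H (t * l₁₂₃₄ k H (x ⊗ₜ y)) = SS k H x * γmap k H t * y := by
  induction x with
  | zero => simp
  | add x x' hx hx' => simp only [TensorProduct.add_tmul, map_add, mul_add, add_mul, hx, hx']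
  | tmul a b =>
    induction y with
    | zero => simp
    | add y y' hy hy' => simp only [TensorProduct.tmul_add, map_add, mul_add, hy, hy']
    | tmul c d =>
      induction t using ind₄ with
      | h0 => simp
      | hadd t t' ht ht' => simp only [map_add, mul_add, add_mul, ht, ht']
      | ht p q r s => simp [S_mul, mul_assoc]

/-- Mirror image of the situation for δ: the contraction uses α, so the pairs 23 and 14 are absorbed
from the left. -/
lemma γmap_leq₂₃ : Leq (γmap k H) (dl (l₂ k H) (l₃ k H)) (ηl k H _) := by
  intro h u
  have : ∀ (w : H ⊗[k] H) a b c d, γmap k H (pair (l₂ k H) (l₃ k H) w * (a ⊗ₜ (b ⊗ₜ (c ⊗ₜ d)))) =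
      (S k H b * mα k H w * c) ⊗ₜ (S k H a * α k * d) := by
    intro w a b c d
    induction w with
    | zero => simp
    | add x y hx hy => simp only [map_add, mul_add, add_mul, TensorProduct.add_tmul, hx, hy]
    | tmul x y => simp [S_mul, mul_assoc]
  induction u using ind₄ with
  | h0 => simp
  | hadd t t' ht ht' => simp only [map_add, mul_add, ht, ht']
  | ht p q r s =>
    rw [dl_apply, this, mα_comul, ηl_apply, ← Algebra.smul_def]
    simp [mul_assoc, TensorProduct.smul_tmul']

lemma γmap_leq₁₄ : Leq (γmap k H) (dl (l₁ k H) (l₄ k H)) (ηl k H _) := by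
  intro h u
  have : ∀ (w : H ⊗[k] H) a b c d, γmap k H (pair (l₁ k H) (l₄ k H) w * (a ⊗ₜ (b ⊗ₜ (c ⊗ₜ d)))) =
      (S k H b * α k * c) ⊗ₜ (S k H a * mα k H w * d) := by
    intro w a b c d
    induction w with
    | zero => simp
    | add x y hx hy => simp only [map_add, mul_add, add_mul, TensorProduct.tmul_add, hx, hy]
    | tmul x y => simp [S_mul, mul_assoc]
  induction u using ind₄ with
  | h0 => simp
  | hadd t t' ht ht' => simp only [map_add, mul_add, ht, ht']
  | ht p q r s =>
    rw [dl_apply, this, mα_comul, ηl_apply, ← Algebra.smul_def]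
    simp [mul_assoc]

variable (k H)

/-- The algebra `H ⊗ (H⁴ ⊗ H)` that carries the legs of the associativity map of `Homˡ`. -/
abbrev BL := H ⊗[k] ((H ⊗[k] (H ⊗[k] (H ⊗[k] H))) ⊗[k] H)

/-- The inclusion of `H⁴` in `BL`. -/
noncomputable abbrev jL : H ⊗[k] (H ⊗[k] (H ⊗[k] H)) →ₐ[k] BL k H := includeRight.comp includeLeft

/-- The first leg of `BL`. -/
noncomputable abbrev aL : H →ₐ[k] BL k H := includeLeft
/-- The second leg of `BL`. -/
noncomputable abbrev bL : H →ₐ[k] BL k H := (jL k H).comp (l₁ k H)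
/-- The third leg of `BL`. -/
noncomputable abbrev cL : H →ₐ[k] BL k H := (jL k H).comp (l₂ k H)
/-- The fourth leg of `BL`. -/
noncomputable abbrev dL : H →ₐ[k] BL k H := (jL k H).comp (l₃ k H)
/-- The fifth leg of `BL`. -/
noncomputable abbrev eL : H →ₐ[k] BL k H := (jL k H).comp (l₄ k H)
/-- The sixth leg of `BL`. -/
noncomputable abbrev rL : H →ₐ[k] BL k H := includeRight.comp includeRight

/-- `a ⊗ (t ⊗ r) ↦ a ⊗ γ(t) Δ(β S(r))` -/
noncomputable def KL : BL k H →ₗ[k] H ⊗[k] (H ⊗[k] H) :=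
  (mulWith (γmap k H) 1 ((comul : H →ₐ[k] H ⊗[k] H).toLinearMap ∘ₗ LinearMap.mulLeft k (β k) ∘ₗ
    (S k H).toLinearMap)).lTensor H

variable {k H}

@[simp] lemma KL_tmul (a r : H) (t) :
    KL k H (a ⊗ₜ (t ⊗ₜ r)) = a ⊗ₜ (γmap k H t * comul (β k * S k H r)) := by
  simp [KL]

lemma KL_leq {z z' : H →ₐ[k] H ⊗[k] (H ⊗[k] (H ⊗[k] H))} (hz : Leq (γmap k H) z z') :
    Leq (KL k H) ((jL k H).comp z) ((jL k H).comp z') := by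
  intro h u
  induction u using ind₃ with
  | h0 => simp
  | hadd x y hx hy => simp only [mul_add, map_add, hx, hy]
  | ht a t r => simp [hz h t]

lemma dl_dL_eL (h : H) : dl (dL k H) (eL k H) h = jL k H (l₁₂₃₄ k H (1 ⊗ₜ comul h)) := by
  rw [dl_comp, AlgHom.comp_apply, dl_apply, pair_tmul, map_one, one_mul]

lemma dl_bL_cL (h : H) : dl (bL k H) (cL k H) h = jL k H (l₁₂₃₄ k H (comul h ⊗ₜ 1)) := by
  rw [dl_comp, AlgHom.comp_apply, dl_apply, pair_tmul, map_one, mul_one]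

/-- A right multiplier on the compound leg de comes out of γ as a coproduct and meets Δ(β S(r)), so
the axiom for β applies underneath Δ. -/
lemma KL_req : Req (KL k H) (dl (dl (dL k H) (eL k H)) (rL k H)) (ηl k H _) := by
  intro h u
  have : ∀ (w : H ⊗[k] H) a t r, KL k H ((a ⊗ₜ (t ⊗ₜ r)) *
      pair (dl (dL k H) (eL k H)) (rL k H) w) =
      a ⊗ₜ (γmap k H t * comul (mβ k H w * S k H r)) := by
    intro w a t r
    induction w with
    | zero => simp
    | add x y hx hy => simp only [map_add, mul_add, add_mul, TensorProduct.tmul_add, hx, hy]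
    | tmul x y =>
      rw [pair_tmul, dl_dL_eL]
      simp only [AlgHom.comp_apply, includeLeft_apply, includeRight_apply, tmul_mul_tmul, mul_one,
        one_mul, KL_tmul, γmap_mul, S_mul]
      have : SS k H 1 = 1 := by simp [Algebra.TensorProduct.one_def, S_one]
      rw [this]
      simp [mul_assoc]
  induction u using ind₃ with
  | h0 => simp
  | hadd x y hx hy => simp only [add_mul, map_add, hx, hy]
  | ht a t r =>
    rw [dl_apply, this, mβ_comul, ηl_apply, ← Algebra.commutes, ← Algebra.smul_def]
    simp

variable (k H) in
/-- The element of `BL` that describes the associativity map of `Homˡ`. -/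
noncomputable def tL : BL k H :=
  ph (aL k H) (bL k H) (eL k H) * ph (dl (aL k H) (bL k H)) (cL k H) (dL k H) *
    ph' (dl (dl (aL k H) (bL k H)) (cL k H)) (dL k H) (eL k H) *
    ph' (dl (dl (aL k H) (bL k H)) (cL k H)) (dl (dL k H) (eL k H)) (rL k H)

/-- The four factors of `tL` are, in order, the evaluation at W (legs a, b, e), the evaluation at V
(ab, c, d), the inverse associator, and the coevaluation of V ⊗ W (with the extra leg r). After the
coherence lemma the contraction can be read off. -/
lemma KL_tL : KL k H (tL k H) = elL k H := by
  have h1 : Leq (KL k H) (dl (cL k H) (dL k H)) (ηl k H _) := by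
    rw [dl_comp, ← ηl_comp (jL k H)]
    exact KL_leq γmap_leq₂₃
  have h2 : Leq (KL k H) (dl (bL k H) (eL k H)) (ηl k H _) := by
    rw [dl_comp, ← ηl_comp (jL k H)]
    exact KL_leq γmap_leq₁₄
  rw [tL, assocL_coherence _ _ _ _ _ _ h1 h2 KL_req]
  have e1 : ph' (cL k H) (dL k H) (eL k H) * ph (bL k H) (cL k H) (dl (dL k H) (eL k H)) =
      jL k H (padL k H (PhiInv k H) * dLst k H (Phi k H)) := by
    rw [ph', ← leg₄_padL (bL k H), ph, ← leg₄_dLst, ← map_mul]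
    conv_rhs => rw [← pair_canonical (padL k H (PhiInv k H) * dLst k H (Phi k H))]
    generalize padL k H (PhiInv k H) * dLst k H (Phi k H) = t
    induction t using ind₄ with
    | h0 => simp
    | hadd x y hx hy => simp only [map_add, hx, hy]
    | ht a b c d => simp
  -- The compound legs bc and de come out of γ as (S ⊗ S)(Δᵒᵖ(P)) and Δ(Q β S(R)), so with V = Φ⁻¹
  -- this is the defining formula of F. The remaining Φ on a, b, c contributes X ⊗ S(Z) ⊗ S(Y).
  have e2 : ∀ t V T, KL k H (jL k H t * leg₃ (dl (bL k H) (cL k H)) (dl (dL k H) (eL k H)) (rL k H) V *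
      leg₃ (aL k H) (bL k H) (cL k H) T) = (SS k H).lTensor H T *
        (1 ⊗ₜ mulWith (SΔop k H) (γmap k H t) (comul : H →ₐ[k] H ⊗[k] H).toLinearMap
          (κL' k H V)) := by
    intro t V T
    induction V using ind₃ with
    | h0 => simp
    | hadd x y hx hy => simp only [map_add, mul_add, add_mul, TensorProduct.tmul_add, hx, hy]
    | ht p q r =>
      induction T using ind₃ with
      | h0 => simp
      | hadd x y hx hy => simp only [map_add, mul_add, add_mul, hx, hy]
      | ht x y z =>
        have e3 : bL k H y * cL k H z = jL k H (l₁₂₃₄ k H ((y ⊗ₜ z) ⊗ₜ 1)) := by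
          simp
        rw [pair_tmul, pair_tmul, pair_tmul, pair_tmul, dl_bL_cL, dl_dL_eL, e3]
        have e4 : jL k H t * (jL k H (l₁₂₃₄ k H (comul p ⊗ₜ 1)) *
            (jL k H (l₁₂₃₄ k H (1 ⊗ₜ comul q)) * rL k H r)) *
            (aL k H x * jL k H (l₁₂₃₄ k H ((y ⊗ₜ z) ⊗ₜ 1))) =
            x ⊗ₜ ((t * l₁₂₃₄ k H ((comul p * (y ⊗ₜ z)) ⊗ₜ comul q)) ⊗ₜ r) := by
          have : ((comul p : H ⊗[k] H) * (y ⊗ₜ[k] z)) ⊗ₜ[k] (comul q : H ⊗[k] H) =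
              (((comul p : H ⊗[k] H) ⊗ₜ[k] (1 : H ⊗[k] H)) * (1 ⊗ₜ comul q)) *
              ((y ⊗ₜ z) ⊗ₜ (1 : H ⊗[k] H)) := by simp
          rw [this, map_mul, map_mul]
          simp only [AlgHom.comp_apply, includeLeft_apply, includeRight_apply, tmul_mul_tmul,
            mul_one, one_mul, mul_assoc]
        rw [e4, KL_tmul, γmap_mul, SS_mul]
        simp only [LinearMap.lTensor_tmul, κL'_tmul, mulWith_tmul, SΔop_apply, tmul_mul_tmul,
          mul_one, mul_assoc, map_mul, AlgHom.toLinearMap_apply]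
  rw [e1, ph', ph, e2]
  rfl

end ElementL

end QHopf


namespace QHopf

open QuasiBialgebra QuasiHopfAlgebra Algebra.TensorProduct

set_option maxSynthPendingDepth 6
set_option linter.unusedSectionVars false

variable (k H : Type u) [Field k] [Ring H] [Algebra k H] [QuasiHopfAlgebra k H]

/-! ### The mixed associativity of the internal homs -/

section ElementM

/-- The first leg of `H ⊗ (H ⊗ H)`. -/
noncomputable abbrev m₁ (k H : Type u) [Field k] [Ring H] [Algebra k H] :
    H →ₐ[k] H ⊗[k] (H ⊗[k] H) := includeLeft
/-- The second leg of `H ⊗ (H ⊗ H)`. -/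
noncomputable abbrev m₂ (k H : Type u) [Field k] [Ring H] [Algebra k H] :
    H →ₐ[k] H ⊗[k] (H ⊗[k] H) := includeRight.comp includeLeft
/-- The third leg of `H ⊗ (H ⊗ H)`. -/
noncomputable abbrev m₃ (k H : Type u) [Field k] [Ring H] [Algebra k H] :
    H →ₐ[k] H ⊗[k] (H ⊗[k] H) := includeRight.comp includeRight

variable {k H}

lemma leg₃_canonical (t : H ⊗[k] (H ⊗[k] H)) : leg₃ (m₁ k H) (m₂ k H) (m₃ k H) t = t := by
  induction t using ind₃ with
  | h0 => simp
  | hadd x y hx hy => rw [map_add, hx, hy]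
  | ht a b c => simp

lemma dl_m₂_m₃ (h : H) : dl (m₂ k H) (m₃ k H) h = idΔ k H (1 ⊗ₜ h) := by
  rw [← leg₃_canonical (idΔ k H (1 ⊗ₜ h)), leg₃_idΔ, pair_tmul, map_one, one_mul]

lemma dl_m₁_m₂ (h : H) : dl (m₁ k H) (m₂ k H) h = Δid k H (h ⊗ₜ 1) := by
  rw [← leg₃_canonical (Δid k H (h ⊗ₜ 1)), leg₃_Δid, pair_tmul, map_one, mul_one]

lemma f₃_leq : Leq (f₃ k H) (dl (m₂ k H) (m₃ k H)) (ηl k H _) := by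
  intro h u
  rw [dl_m₂_m₃, f₃_left, epsR_tmul, ηl_apply, ← Algebra.smul_def, map_smul, smul_mul_assoc, one_mul]

lemma f₃_req : Req (f₃ k H) (dl (m₁ k H) (m₂ k H)) (ηl k H _) := by
  intro h u
  rw [dl_m₁_m₂, f₃_right, epsL_tmul, ηl_apply, ← Algebra.commutes, ← Algebra.smul_def, map_smul,
    mul_smul_comm, mul_one]

lemma g₃_leq : Leq (g₃ k H) (dl (m₁ k H) (m₂ k H)) (ηl k H _) := by
  intro h u
  rw [dl_m₁_m₂, g₃_left, epsL_tmul, ηl_apply, ← Algebra.smul_def, map_smul, map_smul, S_one,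
    mul_smul_comm, mul_one]

lemma g₃_req : Req (g₃ k H) (dl (m₂ k H) (m₃ k H)) (ηl k H _) := by
  intro h u
  rw [dl_m₂_m₃, g₃_right, epsR_tmul, ηl_apply, ← Algebra.commutes, ← Algebra.smul_def, map_smul,
    map_smul, S_one, smul_mul_assoc, one_mul]

variable (k H)

/-- The algebra `H ⊗ (H³ ⊗ H³)` that carries the legs of the mixed associativity map. -/
abbrev BM := H ⊗[k] ((H ⊗[k] (H ⊗[k] H)) ⊗[k] (H ⊗[k] (H ⊗[k] H)))

/-- The inclusion of the first `H³` in `BM`. -/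
noncomputable abbrev jM : H ⊗[k] (H ⊗[k] H) →ₐ[k] BM k H := includeRight.comp includeLeft
/-- The inclusion of the second `H³` in `BM`. -/
noncomputable abbrev jM' : H ⊗[k] (H ⊗[k] H) →ₐ[k] BM k H := includeRight.comp includeRight

/-- `c ⊗ (t ⊗ u) ↦ c ⊗ g₃(t) ⊗ S⁻¹(f₃(u))` -/
noncomputable def KM : BM k H →ₗ[k] H ⊗[k] (H ⊗[k] H) :=
  (TensorProduct.map (g₃ k H) ((S k H).symm.toLinearMap ∘ₗ f₃ k H)).lTensor H

/-- A leg of `BM`. -/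
noncomputable abbrev cM : H →ₐ[k] BM k H := includeLeft
/-- A leg of `BM`. -/
noncomputable abbrev dM : H →ₐ[k] BM k H := (jM k H).comp (m₁ k H)
/-- A leg of `BM`. -/
noncomputable abbrev eM : H →ₐ[k] BM k H := (jM k H).comp (m₂ k H)
/-- A leg of `BM`. -/
noncomputable abbrev rM : H →ₐ[k] BM k H := (jM k H).comp (m₃ k H)
/-- A leg of `BM`. -/
noncomputable abbrev sM : H →ₐ[k] BM k H := (jM' k H).comp (m₁ k H)
/-- A leg of `BM`. -/
noncomputable abbrev aM : H →ₐ[k] BM k H := (jM' k H).comp (m₂ k H)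
/-- A leg of `BM`. -/
noncomputable abbrev bM : H →ₐ[k] BM k H := (jM' k H).comp (m₃ k H)

variable {k H}

@[simp] lemma KM_tmul (c : H) (t u) :
    KM k H (c ⊗ₜ (t ⊗ₜ u)) = c ⊗ₜ (g₃ k H t ⊗ₜ (S k H).symm (f₃ k H u)) := by
  simp [KM]

lemma KM_leq {z z' : H →ₐ[k] H ⊗[k] (H ⊗[k] H)} (hz : Leq (g₃ k H) z z') :
    Leq (KM k H) ((jM k H).comp z) ((jM k H).comp z') := by
  intro h u
  induction u using ind₃ with
  | h0 => simp
  | hadd x y hx hy => simp only [mul_add, map_add, hx, hy]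
  | ht a t r => simp [hz h t]

lemma KM_leq' {z z' : H →ₐ[k] H ⊗[k] (H ⊗[k] H)} (hz : Leq (f₃ k H) z z') :
    Leq (KM k H) ((jM' k H).comp z) ((jM' k H).comp z') := by
  intro h u
  induction u using ind₃ with
  | h0 => simp
  | hadd x y hx hy => simp only [mul_add, map_add, hx, hy]
  | ht a t r => simp [hz h r]

lemma KM_req {z z' : H →ₐ[k] H ⊗[k] (H ⊗[k] H)} (hz : Req (g₃ k H) z z') :
    Req (KM k H) ((jM k H).comp z) ((jM k H).comp z') := by
  intro h u
  induction u using ind₃ with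
  | h0 => simp
  | hadd x y hx hy => simp only [add_mul, map_add, hx, hy]
  | ht a t r => simp [hz h t]

lemma KM_req' {z z' : H →ₐ[k] H ⊗[k] (H ⊗[k] H)} (hz : Req (f₃ k H) z z') :
    Req (KM k H) ((jM' k H).comp z) ((jM' k H).comp z') := by
  intro h u
  induction u using ind₃ with
  | h0 => simp
  | hadd x y hx hy => simp only [add_mul, map_add, hx, hy]
  | ht a t r => simp [hz h r]

variable (k H) in
/-- The element of `BM` that describes the mixed associativity map. -/
noncomputable def tM : BM k H :=
  ph' (aM k H) (bM k H) (cM k H) * ph (dl (bM k H) (cM k H)) (dM k H) (eM k H) *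
    ph (aM k H) (dl (dl (bM k H) (cM k H)) (dM k H)) (eM k H) *
    ph' (dl (aM k H) (dl (dl (bM k H) (cM k H)) (dM k H))) (eM k H) (rM k H) *
    ph (sM k H) (aM k H) (dl (dl (bM k H) (cM k H)) (dM k H))

/-- The five factors of `tM` are the right evaluation at W, the left evaluation at V, the
associator, the coevaluation of V (leg r) and the coevaluation of W (leg s). V is acted on through
the zigzag d, e, r and W through s, a, b. -/
lemma KM_tM : KM k H (tM k H) = elM k H := by
  have h1 : Leq (KM k H) (dl (aM k H) (bM k H)) (ηl k H _) := by
    rw [dl_comp, ← ηl_comp (jM' k H)]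
    exact KM_leq' f₃_leq
  have h2 : Leq (KM k H) (dl (dM k H) (eM k H)) (ηl k H _) := by
    rw [dl_comp, ← ηl_comp (jM k H)]
    exact KM_leq g₃_leq
  have h3 : Req (KM k H) (dl (eM k H) (rM k H)) (ηl k H _) := by
    rw [dl_comp, ← ηl_comp (jM k H)]
    exact KM_req g₃_req
  have h4 : Req (KM k H) (dl (sM k H) (aM k H)) (ηl k H _) := by
    rw [dl_comp, ← ηl_comp (jM' k H)]
    exact KM_req' f₃_req
  rw [tM, assocM_coherence _ _ _ _ _ _ _ h1 h2 h3 h4]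
  have e1 : ph' (dM k H) (eM k H) (rM k H) = jM k H (PhiInv k H) := by
    conv_rhs => rw [← leg₃_canonical (PhiInv k H)]
    rw [ph']
    generalize PhiInv k H = t
    induction t using ind₃ with
    | h0 => simp
    | hadd x y hx hy => simp only [map_add, hx, hy]
    | ht a b c => simp
  have e2 : ph (sM k H) (aM k H) (bM k H) = jM' k H (Phi k H) := by
    conv_rhs => rw [← leg₃_canonical (Phi k H)]
    rw [ph]
    generalize Phi k H = t
    induction t using ind₃ with
    | h0 => simp
    | hadd x y hx hy => simp only [map_add, hx, hy]
    | ht a b c => simp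
  -- The legs d and b are the outer ends of their zigzags, so the last Φ factors out of both
  -- contractions, which are then the two antipode identities equal to 1.
  have e3 : ∀ T, KM k H (jM k H (PhiInv k H) * jM' k H (Phi k H) *
      leg₃ (bM k H) (cM k H) (dM k H) T) =
      ((S k H).symm.toLinearMap.lTensor H).lTensor H (cyc k H T) := by
    intro T
    induction T using ind₃ with
    | h0 => simp
    | hadd x y hx hy => simp only [map_add, mul_add, hx, hy]
    | ht x y z =>
      have e4 : jM k H (PhiInv k H) * jM' k H (Phi k H) *
          leg₃ (bM k H) (cM k H) (dM k H) (x ⊗ₜ (y ⊗ₜ z)) =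
          y ⊗ₜ ((PhiInv k H * idΔ k H (z ⊗ₜ 1)) ⊗ₜ (Phi k H * Δid k H (1 ⊗ₜ x))) := by
        have o : (1 : H) ⊗ₜ[k] ((1 : H) ⊗ₜ[k] (1 : H)) = 1 := rfl
        simp [idΔ, Δid, Algebra.TensorProduct.one_def, -mul_one, -one_mul]
        simp only [o, one_mul, mul_one]
      rw [e4, KM_tmul, g₃_right, f₃_right, g₃_PhiInv, f₃_Phi]
      simp [cyc]
  rw [e1, e2, ph, e3]
  rfl

end ElementM

/-! ### The associativity of the right internal hom -/

section ElementR

/-- The algebra `H ⊗ (H ⊗ H⁴)` that carries the legs of the associativity map of `Homʳ`. -/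
abbrev BR := H ⊗[k] (H ⊗[k] (H ⊗[k] (H ⊗[k] (H ⊗[k] H))))

/-- The inclusion of `H⁴` in `BR`. -/
noncomputable abbrev jR : H ⊗[k] (H ⊗[k] (H ⊗[k] H)) →ₐ[k] BR k H := includeRight.comp includeRight

/-- The first leg of `BR`. -/
noncomputable abbrev aR : H →ₐ[k] BR k H := (jR k H).comp (l₁ k H)
/-- The second leg of `BR`. -/
noncomputable abbrev bR : H →ₐ[k] BR k H := (jR k H).comp (l₂ k H)
/-- The third leg of `BR`. -/
noncomputable abbrev cR : H →ₐ[k] BR k H := (jR k H).comp (l₃ k H)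
/-- The fourth leg of `BR`. -/
noncomputable abbrev dR : H →ₐ[k] BR k H := (jR k H).comp (l₄ k H)
/-- The fifth leg of `BR`. -/
noncomputable abbrev eR : H →ₐ[k] BR k H := includeRight.comp includeLeft
/-- The sixth leg of `BR`. -/
noncomputable abbrev fR : H →ₐ[k] BR k H := includeLeft

/-- `f ⊗ (e ⊗ t) ↦ f ⊗ Δ(S⁻¹(α e)) (S⁻¹ ⊗ S⁻¹)(δ(t)ᵒᵖ)` -/
noncomputable def KR : BR k H →ₗ[k] H ⊗[k] (H ⊗[k] H) :=
  (mulWith ((comul : H →ₐ[k] H ⊗[k] H).toLinearMap ∘ₗ (S k H).symm.toLinearMap ∘ₗ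
    LinearMap.mulLeft k (α k)) 1 (SS' k H ∘ₗ δmap k H)).lTensor H

variable {k H}

@[simp] lemma KR_tmul (f e : H) (t) : KR k H (f ⊗ₜ (e ⊗ₜ t)) =
    f ⊗ₜ (comul ((S k H).symm (α k * e)) * SS' k H (δmap k H t)) := by
  simp [KR]

lemma KR_req {z z' : H →ₐ[k] H ⊗[k] (H ⊗[k] (H ⊗[k] H))} (hz : Req (δmap k H) z z') :
    Req (KR k H) ((jR k H).comp z) ((jR k H).comp z') := by
  intro h u
  induction u using ind₃ with
  | h0 => simp
  | hadd x y hx hy => simp only [add_mul, map_add, hx, hy]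
  | ht a t r => simp [hz h r]

lemma dl_cR_dR (h : H) : dl (cR k H) (dR k H) h = jR k H (l₁₂₃₄ k H (1 ⊗ₜ comul h)) := by
  rw [dl_comp, AlgHom.comp_apply, dl_apply, pair_tmul, map_one, one_mul]

lemma dl_aR_bR (h : H) : dl (aR k H) (bR k H) h = jR k H (l₁₂₃₄ k H (comul h ⊗ₜ 1)) := by
  rw [dl_comp, AlgHom.comp_apply, dl_apply, pair_tmul, map_one, mul_one]

/-- A left multiplier on cd leaves δ through S ⊗ S, which the flipped S⁻¹ ⊗ S⁻¹ undoes. It therefore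
meets Δ(S⁻¹(α e)) as a plain coproduct, and the axiom for α applies underneath Δ ∘ S⁻¹. -/
lemma KR_leq : Leq (KR k H) (dl (dl (cR k H) (dR k H)) (eR k H)) (ηl k H _) := by
  intro h u
  have : ∀ (w : H ⊗[k] H) f e t, KR k H (pair (dl (cR k H) (dR k H)) (eR k H) w *
      (f ⊗ₜ (e ⊗ₜ t))) =
      f ⊗ₜ (comul ((S k H).symm (mα k H w * e)) * SS' k H (δmap k H t)) := by
    intro w f e t
    induction w with
    | zero => simp
    | add x y hx hy => simp only [map_add, add_mul, TensorProduct.tmul_add, hx, hy]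
    | tmul x y =>
      rw [pair_tmul, dl_cR_dR]
      simp only [AlgHom.comp_apply, includeLeft_apply, includeRight_apply, tmul_mul_tmul, mul_one,
        one_mul, KR_tmul, δmap_mul, SS'_mul, SS'_SS]
      rw [← mul_assoc, ← map_mul]
      simp [S_symm_mul, mul_assoc]
  induction u using ind₃ with
  | h0 => simp
  | hadd x y hx hy => simp only [mul_add, map_add, hx, hy]
  | ht a t r =>
    rw [dl_apply, this, mα_comul, ηl_apply, ← Algebra.smul_def]
    simp

variable (k H) in
/-- The element of `BR` that describes the associativity map of `Homʳ`. -/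
noncomputable def tR : BR k H :=
  ph' (dl (cR k H) (dR k H)) (eR k H) (fR k H) *
    ph' (cR k H) (dR k H) (dl (eR k H) (fR k H)) *
    ph (bR k H) (cR k H) (dl (dR k H) (dl (eR k H) (fR k H))) *
    ph (aR k H) (dR k H) (dl (eR k H) (fR k H))

/-- The factors of `tR` are the evaluation at V ⊗ W (legs cd, e, f), the inverse associator, and the
coevaluations of V (legs b, c) and of W (legs a, d). -/
lemma KR_tR : KR k H (tR k H) = elR k H := by
  have h1 : Req (KR k H) (dl (bR k H) (cR k H)) (ηl k H _) := by
    rw [dl_comp, ← ηl_comp (jR k H)]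
    exact KR_req δmap_req₂₃
  have h2 : Req (KR k H) (dl (aR k H) (dR k H)) (ηl k H _) := by
    rw [dl_comp, ← ηl_comp (jR k H)]
    exact KR_req δmap_req₁₄
  rw [tR, assocR_coherence _ _ _ _ _ _ KR_leq h1 h2]
  have e1 : ph' (aR k H) (bR k H) (dl (cR k H) (dR k H)) * ph (bR k H) (cR k H) (dR k H) =
      jR k H (dLst k H (PhiInv k H) * padL k H (Phi k H)) := by
    rw [ph', ← leg₄_dLst, ph, ← leg₄_padL (aR k H), ← map_mul]
    conv_rhs => rw [← pair_canonical (dLst k H (PhiInv k H) * padL k H (Phi k H))]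
    generalize dLst k H (PhiInv k H) * padL k H (Phi k H) = t
    induction t using ind₄ with
    | h0 => simp
    | hadd x y hx hy => simp only [map_add, hx, hy]
    | ht a b c d => simp
  have e2 : ∀ T V t, KR k H (leg₃ (aR k H) (bR k H) (fR k H) T *
      leg₃ (dl (aR k H) (bR k H)) (dl (cR k H) (dR k H)) (eR k H) V * jR k H t) =
      (1 ⊗ₜ (mulWith ((comul : H →ₐ[k] H ⊗[k] H).toLinearMap ∘ₗ (S k H).symm.toLinearMap ∘ₗ
      mα k H) (SS' k H (δmap k H t)) (SS' k H ∘ₗ (comul : H →ₐ[k] H ⊗[k] H).toLinearMap)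
      (TensorProduct.comm k H (H ⊗[k] H) V))) * (SS' k H).lTensor H
        (TensorProduct.comm k (H ⊗[k] H) H ((TensorProduct.assoc k H H H).symm T)) := by
    intro T V t
    induction V using ind₃ with
    | h0 => simp
    | hadd x y hx hy => simp only [map_add, mul_add, add_mul, TensorProduct.tmul_add, hx, hy]
    | ht p q r =>
      induction T using ind₃ with
      | h0 => simp
      | hadd x y hx hy => simp only [map_add, mul_add, add_mul, hx, hy]
      | ht x y z =>
        have e3 : leg₃ (aR k H) (bR k H) (fR k H) (x ⊗ₜ (y ⊗ₜ z)) =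
            jR k H (l₁₂₃₄ k H ((x ⊗ₜ y) ⊗ₜ 1)) * fR k H z := by
          simp
        rw [e3, pair_tmul (dl (aR k H) (bR k H)), pair_tmul (dl (cR k H) (dR k H)), dl_aR_bR, dl_cR_dR]
        have e4 : jR k H (l₁₂₃₄ k H ((x ⊗ₜ y) ⊗ₜ 1)) * fR k H z *
            (jR k H (l₁₂₃₄ k H (comul p ⊗ₜ 1)) *
            (jR k H (l₁₂₃₄ k H (1 ⊗ₜ comul q)) * eR k H r)) * jR k H t =
            z ⊗ₜ (r ⊗ₜ (l₁₂₃₄ k H (((x ⊗ₜ y) * comul p) ⊗ₜ comul q) * t)) := by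
          have : ((x ⊗ₜ[k] y) * (comul p : H ⊗[k] H)) ⊗ₜ[k] (comul q : H ⊗[k] H) =
              ((x ⊗ₜ y) ⊗ₜ (1 : H ⊗[k] H)) * (((comul p : H ⊗[k] H) ⊗ₜ[k] (1 : H ⊗[k] H)) *
                (1 ⊗ₜ comul q)) := by simp
          rw [this, map_mul, map_mul]
          simp only [AlgHom.comp_apply, includeLeft_apply, includeRight_apply, tmul_mul_tmul,
            mul_one, one_mul, mul_assoc]
        rw [e4, KR_tmul, δmap_mul, SS'_mul, SS'_mul, SS'_mul, SS'_SS, ← mul_assoc, ← map_mul]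
        simp [S_symm_mul, mul_assoc]
  rw [e1, ph, ph, e2]
  -- At this point the element is G multiplied out with δ; it becomes G only through the
  -- intertwining property of F⁻¹.
  have e5 := mulWith_δ_Phi (k := k) (H := H)
  change mulWith _ (SS' k H (δmap k H _)) _ _ = _ at e5
  rw [e5]
  rfl

end ElementR

end QHopf


/-! ### The adjunctions in explicit form -/

namespace QHMod

open QHopf QuasiBialgebra QuasiHopfAlgebra

set_option maxSynthPendingDepth 6

variable {k H : Type u} [Field k] [Ring H] [Algebra k H] [QuasiHopfAlgebra k H]

lemma curryL_eq (T V M : QHMod k H) (f : T ⊗ V ⟶ M) :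
    Biclosed.curryL T V M f = ζL (T := T) (V := V) f := by
  change (adjL V).homEquiv T M f = _
  rw [adjL, Adjunction.mkOfHomEquiv_homEquiv]
  rfl

lemma curryR_eq (T V M : QHMod k H) (f : V ⊗ T ⟶ M) :
    Biclosed.curryR T V M f = ζR (T := T) (V := V) f := by
  change (adjR V).homEquiv T M f = _
  rw [adjR, Adjunction.mkOfHomEquiv_homEquiv]
  rfl

lemma evR_apply (V M : QHMod k H) (φ : V →ₗ[k] M) (v : V) :
    Hom.lin (Biclosed.evR V M) (v ⊗ₜ[k] φ) = sandwich V M (pR k H) φ v := by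
  rfl

end QHMod


namespace QHMod

open QHopf QuasiBialgebra QuasiHopfAlgebra Algebra.TensorProduct

set_option maxSynthPendingDepth 6
set_option linter.unusedSectionVars false

/-! ### Action of the triple tensor power on bilinear maps -/

section Twist

variable {k H : Type u} [Field k] [Ring H] [Algebra k H]

/-- `a ⊗ b ⊗ c` sends a bilinear map `f : V × W → M` to `(v, w) ↦ a f(b v, c w)`. -/
noncomputable def bitwist (V W M : QHMod k H) :
    H ⊗[k] (H ⊗[k] H) →ₗ[k] Module.End k (V →ₗ[k] W →ₗ[k] M) :=
  mulWith (C := Module.End k (V →ₗ[k] W →ₗ[k] M))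
    ((LinearMap.llcomp k V (W →ₗ[k] M) (W →ₗ[k] M) :
        ((W →ₗ[k] M) →ₗ[k] (W →ₗ[k] M)) →ₗ[k] Module.End k (V →ₗ[k] W →ₗ[k] M)) ∘ₗ
      LinearMap.llcomp k W M M ∘ₗ M.ρ.toLinearMap) 1
    (TensorProduct.lift (LinearMap.mk₂ k
      (fun b c => LinearMap.llcomp k V (W →ₗ[k] M) (W →ₗ[k] M)
          (LinearMap.lcomp k M (W.ρ c)) ∘ₗ
        LinearMap.lcomp k (W →ₗ[k] M) (V.ρ b))
      (fun a a' b => by ext; simp) (fun c a b => by ext; simp)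
      (fun a b b' => by ext; simp) (fun c a b => by ext; simp)))

variable {V W M : QHMod k H}

@[simp] lemma bitwist_tmul (a b c : H) (f : V →ₗ[k] W →ₗ[k] M) (v : V) (w : W) :
    bitwist V W M (a ⊗ₜ (b ⊗ₜ c)) f v w = M.ρ a (f (V.ρ b v) (W.ρ c w)) := rfl

lemma bitwist_regular (x : H ⊗[k] (H ⊗[k] H)) :
    bitwist (regular k H) (regular k H) M x = twist₂ M x := by
  induction x using ind₃ with
  | h0 => simp
  | hadd x y hx hy => simp only [map_add, hx, hy]
  | ht a b c => rfl

lemma homL_ρ [QuasiHopfAlgebra k H] (h : H) : (homL V M).ρ h = homActL V M (comul h) := rfl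

lemma homR_ρ [QuasiHopfAlgebra k H] (h : H) : (homR V M).ρ h = homActR V M (comul h) := rfl

lemma lift_bitwist (x : H ⊗[k] (H ⊗[k] H)) (y : H ⊗[k] H) (f : V →ₗ[k] W →ₗ[k] M) (v : V) (w : W) :
    TensorProduct.lift (bitwist V W M x f) (tensorAct V.ρ W.ρ y (v ⊗ₜ w)) =
      bitwist V W M (x * (1 ⊗ₜ y)) f v w := by
  induction y with
  | zero => simp
  | add y z hy hz =>
    simp only [map_add, LinearMap.add_apply, TensorProduct.tmul_add, mul_add, hy, hz]
  | tmul p q =>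
    induction x using ind₃ with
    | h0 => simp
    | hadd x y hx hy =>
      simp only [map_add, add_mul, LinearMap.add_apply] at hx hy ⊢
      simp only [tensorAct_tmul, TensorProduct.lift.tmul] at hx hy
      simp [hx, hy]
    | ht a b c => simp

end Twist

/-! ### The associativity map of Homˡ is the action of `elL` -/

section AssocL

variable {k H : Type u} [Field k] [Ring H] [Algebra k H] [QuasiHopfAlgebra k H]

variable (k H) in
/-- The algebra that carries the legs of the evaluations in the associativity map of `Homˡ`. -/
abbrev CL := H ⊗[k] (H ⊗[k] (H ⊗[k] (H ⊗[k] H)))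

variable (k H) in
/-- The inclusion of `H⁴` in `CL`. -/
noncomputable abbrev iL : H ⊗[k] (H ⊗[k] (H ⊗[k] H)) →ₐ[k] CL k H := includeRight

variable (k H) in
/-- The inclusion of `CL` in `BL`. -/
noncomputable abbrev ιL : CL k H →ₐ[k] BL k H :=
  Algebra.TensorProduct.map (AlgHom.id k H) includeLeft

variable {V W M : QHMod k H}

variable (V W M) in
/-- The action of `CL` on bilinear maps through `id ⊗ γ`. -/
noncomputable def actL : CL k H →ₗ[k] Module.End k (V →ₗ[k] W →ₗ[k] M) :=
  bitwist V W M ∘ₗ (γmap k H).lTensor H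

lemma actL_tmul (a b c d e : H) (t : V →ₗ[k] W →ₗ[k] M) (v : V) (w : W) :
    actL V W M (a ⊗ₜ (b ⊗ₜ (c ⊗ₜ (d ⊗ₜ e)))) t v w =
      M.ρ a (t (V.ρ (S k H c * α k * d) v) (W.ρ (S k H b * α k * e) w)) := by
  simp [actL, mul_assoc]

lemma ind₅ {p : CL k H → Prop} (x : CL k H) (h0 : p 0) (hadd : ∀ x y, p x → p y → p (x + y))
    (ht : ∀ a b c d e, p (a ⊗ₜ (b ⊗ₜ (c ⊗ₜ (d ⊗ₜ e))))) : p x := by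
  induction x using TensorProduct.induction_on with
  | zero => exact h0
  | add x y hx hy => exact hadd _ _ hx hy
  | tmul a t =>
    induction t using ind₄ with
    | h0 => simpa using h0
    | hadd x y hx hy => simpa [TensorProduct.tmul_add] using hadd _ _ hx hy
    | ht b c d e => exact ht _ _ _ _ _

/-- `actL` is not multiplicative, as α sits between the legs, but right multipliers act first. On
the compound leg (ab)c they give the action of H on Homˡ(V, Homˡ(W, M)); on d and e they act on v
and w (next lemma). -/
lemma actL_homActL (x : CL k H) (y : H ⊗[k] H) (t : V →ₗ[k] W →ₗ[k] M) :
    actL V W M (x * pair (dl includeLeft ((iL k H).comp (l₁ k H))) ((iL k H).comp (l₂ k H)) y) t =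
      actL V W M x (homActL V (homL W M) y t) := by
  ext v w
  induction y with
  | zero => simp
  | add y z hy hz => simp only [map_add, mul_add, LinearMap.add_apply, hy, hz]
  | tmul p q =>
    rw [pair_tmul, dl_apply]
    induction x using ind₅ with
    | h0 => simp
    | hadd x y hx hy => simp only [map_add, add_mul, LinearMap.add_apply, hx, hy]
    | ht a b c d e =>
      rw [actL_tmul, homActL_tmul, homL_ρ]
      generalize (comul p : H ⊗[k] H) = y
      induction y with
      | zero => simp
      | add y z hy hz => simp only [map_add, mul_add, add_mul, LinearMap.add_apply, hy, hz]
      | tmul r s => simp [actL_tmul, S_mul, mul_assoc]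

lemma actL_apply_apply (x : CL k H) (q r : H) (t : V →ₗ[k] W →ₗ[k] M) (v : V) (w : W) :
    actL V W M (x * ((iL k H).comp (l₃ k H) q * (iL k H).comp (l₄ k H) r)) t v w =
      actL V W M x t (V.ρ q v) (W.ρ r w) := by
  induction x using ind₅ with
  | h0 => simp
  | hadd x y hx hy => simp only [map_add, add_mul, LinearMap.add_apply, hx, hy]
  | ht a b c d e => simp [actL_tmul, mul_assoc]

lemma actL_evL (x y : H ⊗[k] (H ⊗[k] H)) (t : V →ₗ[k] W →ₗ[k] M) (v : V) (w : W) :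
    sandwich W M (κL k H x) (sandwich V (homL W M) (κL k H y) t v) w =
      actL V W M (leg₃ includeLeft ((iL k H).comp (l₁ k H)) ((iL k H).comp (l₄ k H)) x *
        leg₃ (dl includeLeft ((iL k H).comp (l₁ k H))) ((iL k H).comp (l₂ k H))
          ((iL k H).comp (l₃ k H)) y) t v w := by
  induction y using ind₃ with
  | h0 => simp
  | hadd x y hx hy => simp only [map_add, mul_add, LinearMap.add_apply, hx, hy]
  | ht p q r =>
    induction x using ind₃ with
    | h0 => simp
    | hadd x y hx hy => simp only [map_add, add_mul, LinearMap.add_apply, hx, hy]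
    | ht a b c =>
      rw [κL_tmul, κL_tmul, sandwich_tmul, sandwich_tmul, homL_ρ, pair_tmul, pair_tmul,
        pair_tmul, pair_tmul, dl_apply]
      generalize (comul p : H ⊗[k] H) = y
      induction y with
      | zero => simp
      | add y z hy hz => simp only [map_add, mul_add, add_mul, LinearMap.add_apply, hy, hz]
      | tmul r s => simp [actL_tmul, S_mul, mul_assoc]

/-- Separates the coevaluation from the rest: its legs come last in the product, so they leave the
contraction as Δ(Q β S(R)) acting on v ⊗ w before everything else. -/
lemma KL_ιL (x : CL k H) (q r : H) :
    KL k H (ιL k H x * (dl (dL k H) (eL k H) q * rL k H r)) =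
      (γmap k H).lTensor H x * (1 ⊗ₜ comul (q * β k * S k H r)) := by
  induction x using TensorProduct.induction_on with
  | zero => simp
  | add x y hx hy => simp only [map_add, add_mul, hx, hy]
  | tmul a t =>
    have h : SS k H 1 = 1 := by simp [Algebra.TensorProduct.one_def, S_one]
    have h' := γmap_mul (1 : H ⊗[k] H) (comul q) t
    rw [dl_dL_eL]
    simp only [AlgHom.comp_apply, Algebra.TensorProduct.map_tmul, includeLeft_apply,
      includeRight_apply, tmul_mul_tmul, one_mul, mul_one, KL_tmul, h', h, AlgHom.coe_id, id_eq,
      LinearMap.lTensor_tmul, map_mul, mul_assoc]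

variable (k H) in
/-- The element of `CL` that describes the two evaluations and the first associator. -/
noncomputable def sL : CL k H :=
  let a := (includeLeft : H →ₐ[k] CL k H)
  let b := (iL k H).comp (l₁ k H)
  let c := (iL k H).comp (l₂ k H)
  let d := (iL k H).comp (l₃ k H)
  let e := (iL k H).comp (l₄ k H)
  ph a b e * ph (dl a b) c d * ph' (dl (dl a b) c) d e

/-- The form of `pair_comp` for legs that factor through j only pointwise, as the compound legs do.
-/
lemma pair_map {A A' B C : Type u} [Ring A] [Algebra k A] [Ring A'] [Algebra k A'] [Ring B]
    [Algebra k B] [Ring C] [Algebra k C] (j : B →ₐ[k] C) {f : A →ₐ[k] B} {g : A' →ₐ[k] B}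
    {f' : A →ₐ[k] C} {g' : A' →ₐ[k] C} [CommLeg f g] [CommLeg f' g'] (hf : ∀ x, f' x = j (f x))
    (hg : ∀ x, g' x = j (g x)) (t : A ⊗[k] A') : pair f' g' t = j (pair f g t) := by
  induction t using TensorProduct.induction_on with
  | zero => simp
  | add x y hx hy => simp only [map_add, hx, hy]
  | tmul x y => simp [hf, hg]

/-- Only the coevaluation needs the leg r, so the other three copies of Φ already live in the
smaller algebra `CL`, which acts on bilinear maps. -/
lemma tL_eq : tL k H = ιL k H (sL k H) *
    ph' (dl (dl (aL k H) (bL k H)) (cL k H)) (dl (dL k H) (eL k H)) (rL k H) := by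
  have ha : ∀ x, aL k H x = ιL k H ((includeLeft : H →ₐ[k] CL k H) x) := fun x => rfl
  have hb : ∀ x, bL k H x = ιL k H ((iL k H).comp (l₁ k H) x) := fun x => rfl
  have hc : ∀ x, cL k H x = ιL k H ((iL k H).comp (l₂ k H) x) := fun x => rfl
  have hd : ∀ x, dL k H x = ιL k H ((iL k H).comp (l₃ k H) x) := fun x => rfl
  have he : ∀ x, eL k H x = ιL k H ((iL k H).comp (l₄ k H) x) := fun x => rfl
  have hab : ∀ x, dl (aL k H) (bL k H) x =
      ιL k H (dl (includeLeft : H →ₐ[k] CL k H) ((iL k H).comp (l₁ k H)) x) :=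
    fun x => pair_map (ιL k H) ha hb (comul x)
  have habc : ∀ x, dl (dl (aL k H) (bL k H)) (cL k H) x =
      ιL k H (dl (dl (includeLeft : H →ₐ[k] CL k H) ((iL k H).comp (l₁ k H)))
        ((iL k H).comp (l₂ k H)) x) :=
    fun x => pair_map (ιL k H) hab hc (comul x)
  rw [tL, sL, map_mul, map_mul]
  congr 1
  refine congr_arg₂ _ (congr_arg₂ _ ?_ ?_) ?_
  · exact pair_map _ ha (fun x => pair_map _ hb he x) _
  · exact pair_map _ hab (fun x => pair_map _ hc hd x) _
  · exact pair_map _ habc (fun x => pair_map _ hd he x) _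

variable (V W M) in
/-- The evaluation `(t ⊗ v) ⊗ w ↦ evˡ(evˡ(t ⊗ v) ⊗ w)` -/
noncomputable def evevL : ((V →ₗ[k] W →ₗ[k] M) ⊗[k] V) ⊗[k] W →ₗ[k] M :=
  TensorProduct.lift (sandwich W M (pL k H) ∘ₗ TensorProduct.lift (sandwich V (homL W M) (pL k H)))

lemma evevL_act₃ (t : V →ₗ[k] W →ₗ[k] M) (v : V) (w : W) :
    evevL V W M ((TensorProduct.assoc k _ V W).symm
      (act₃ (homL V (homL W M)) V W (PhiInv k H) (t ⊗ₜ (v ⊗ₜ w)))) =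
      actL V W M (sL k H) t v w := by
  rw [sL, ph']
  generalize PhiInv k H = U
  induction U using ind₃ with
  | h0 => simp
  | hadd x y hx hy => simp only [map_add, mul_add, LinearMap.add_apply, hx, hy]
  | ht p q r =>
    rw [act₃, tensorAct_tmul, tensorAct_tmul, TensorProduct.assoc_symm_tmul, pair_tmul, pair_tmul,
      ← mul_assoc, actL_apply_apply, homL_ρ, dl_apply, actL_homActL]
    exact actL_evL _ _ _ _ _

variable (V W M) in
/-- The associativity map of `Homˡ` as a linear map. -/
noncomputable def assocLLin : (V →ₗ[k] W →ₗ[k] M) →ₗ[k] V ⊗[k] W →ₗ[k] M :=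
  Hom.lin (Biclosed.assocL V W M)

lemma assocLLin_apply (t : V →ₗ[k] W →ₗ[k] M) (x : V ⊗[k] W) :
    assocLLin V W M t x = evevL V W M ((TensorProduct.assoc k _ V W).symm
      (act₃ (homL V (homL W M)) V W (PhiInv k H)
        (tensorAct (homL V (homL W M)).ρ (tensor V W).ρ (qL k H) (t ⊗ₜ x)))) := by
  have : Biclosed.assocL V W M = ζL (T := homL V (homL W M)) (V := tensor V W) (M := M)
      ((α_ (homL V (homL W M)) V W).inv ≫ Biclosed.evL V (homL W M) ▷ W ≫ Biclosed.evL W M) :=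
    curryL_eq _ _ _ _
  have h : Hom.lin (Biclosed.evL V (homL W M) ▷ W ≫ Biclosed.evL W M) = evevL V W M :=
    TensorProduct.ext_threefold fun t v w => rfl
  rw [assocLLin, this]
  exact LinearMap.congr_fun h _

/-- Currying applies P to t and Q β S(R) to v ⊗ w before the two evaluations; collecting the legs of
all actions produces `tL`, which `KL_tL` contracts. -/
lemma assocLLin_tmul (t : V →ₗ[k] W →ₗ[k] M) (v : V) (w : W) :
    assocLLin V W M t (v ⊗ₜ w) = bitwist V W M (elL k H) t v w := by
  have h : ∀ (x : V ⊗[k] W) (t : V →ₗ[k] W →ₗ[k] M), evevL V W M ((TensorProduct.assoc k _ V W).symm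
      (act₃ (homL V (homL W M)) V W (PhiInv k H) (t ⊗ₜ x))) =
      TensorProduct.lift (actL V W M (sL k H) t) x := by
    intro x t
    induction x with
    | zero => simp
    | add x y hx hy => simp only [map_add, TensorProduct.tmul_add, hx, hy]
    | tmul v w => exact evevL_act₃ t v w
  have habc : ∀ x, dl (dl (aL k H) (bL k H)) (cL k H) x =
      ιL k H (dl (dl (includeLeft : H →ₐ[k] CL k H) ((iL k H).comp (l₁ k H)))
        ((iL k H).comp (l₂ k H)) x) :=
    fun x => pair_map (ιL k H) (fun x => pair_map (ιL k H) (fun _ => rfl) (fun _ => rfl) (comul x))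
      (fun _ => rfl) (comul x)
  have h' : ∀ U, evevL V W M ((TensorProduct.assoc k _ V W).symm
      (act₃ (homL V (homL W M)) V W (PhiInv k H)
        (tensorAct (homL V (homL W M)).ρ (tensor V W).ρ (κL' k H U) (t ⊗ₜ (v ⊗ₜ w))))) =
      bitwist V W M (KL k H (ιL k H (sL k H) *
        leg₃ (dl (dl (aL k H) (bL k H)) (cL k H)) (dl (dL k H) (eL k H)) (rL k H) U)) t v w := by
    intro U
    induction U using ind₃ with
    | h0 => simp
    | hadd x y hx hy => simp only [map_add, mul_add, LinearMap.add_apply, hx, hy]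
    | ht p q r =>
      rw [κL'_tmul, tensorAct_tmul, h, pair_tmul, pair_tmul, habc, ← mul_assoc, ← map_mul,
        KL_ιL, ← lift_bitwist, homL_ρ, ← actL_homActL]
      rfl
  rw [assocLLin_apply, ← KL_tL, tL_eq, qL, ph', h']

end AssocL

end QHMod


namespace QHMod

open QHopf QuasiBialgebra QuasiHopfAlgebra Algebra.TensorProduct

set_option maxSynthPendingDepth 6
set_option linter.unusedSectionVars false

/-! ### The mixed associativity map is the action of `elM` -/

section AssocM

variable {k H : Type u} [Field k] [Ring H] [Algebra k H] [QuasiHopfAlgebra k H]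

variable (k H)

/-- The algebra that carries the legs of the evaluations in the mixed associativity map. -/
abbrev CM := H ⊗[k] ((H ⊗[k] H) ⊗[k] (H ⊗[k] H))

/-- The inclusion of the first `H ⊗ H` in `CM`. -/
noncomputable abbrev iM : H ⊗[k] H →ₐ[k] CM k H := includeRight.comp includeLeft
/-- The inclusion of the second `H ⊗ H` in `CM`. -/
noncomputable abbrev iM' : H ⊗[k] H →ₐ[k] CM k H := includeRight.comp includeRight

/-- A leg of `CM`. -/
noncomputable abbrev cM₀ : H →ₐ[k] CM k H := includeLeft
/-- A leg of `CM`. -/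
noncomputable abbrev dM₀ : H →ₐ[k] CM k H := (iM k H).comp includeLeft
/-- A leg of `CM`. -/
noncomputable abbrev eM₀ : H →ₐ[k] CM k H := (iM k H).comp includeRight
/-- A leg of `CM`. -/
noncomputable abbrev aM₀ : H →ₐ[k] CM k H := (iM' k H).comp includeLeft
/-- A leg of `CM`. -/
noncomputable abbrev bM₀ : H →ₐ[k] CM k H := (iM' k H).comp includeRight

/-- The inclusion of `CM` in `BM`. -/
noncomputable abbrev ιM : CM k H →ₐ[k] BM k H :=
  Algebra.TensorProduct.map (AlgHom.id k H)
    (Algebra.TensorProduct.map (Algebra.TensorProduct.map (AlgHom.id k H) includeLeft) includeRight)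

/-- `c ⊗ ((d ⊗ e) ⊗ (a ⊗ b)) ↦ c ⊗ (S(d) α e ⊗ S⁻¹(S(a) α b))` -/
noncomputable def KM₀ : CM k H →ₗ[k] H ⊗[k] (H ⊗[k] H) :=
  (TensorProduct.map (mα k H) ((S k H).symm.toLinearMap ∘ₗ mα k H)).lTensor H

variable {k H} {V W M : QHMod k H}

variable (V W M) in
/-- The action of `CM` on bilinear maps through `KM₀`. -/
noncomputable def actM : CM k H →ₗ[k] Module.End k (V →ₗ[k] W →ₗ[k] M) :=
  bitwist V W M ∘ₗ KM₀ k H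

lemma bitwist_mul (x : H ⊗[k] (H ⊗[k] H)) (b c : H) (t : V →ₗ[k] W →ₗ[k] M) (v : V) (w : W) :
    bitwist V W M (x * (1 ⊗ₜ (b ⊗ₜ c))) t v w = bitwist V W M x t (V.ρ b v) (W.ρ c w) := by
  rw [← lift_bitwist]
  rfl

lemma actM_tmul (a b c d e : H) (t : V →ₗ[k] W →ₗ[k] M) (v : V) (w : W) :
    actM V W M (c ⊗ₜ ((d ⊗ₜ e) ⊗ₜ (a ⊗ₜ b))) t v w =
      M.ρ c (t (V.ρ (S k H d * α k * e) v) (W.ρ ((S k H).symm (S k H a * α k * b)) w)) := rfl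

lemma indM {p : CM k H → Prop} (x : CM k H) (h0 : p 0) (hadd : ∀ x y, p x → p y → p (x + y))
    (ht : ∀ a b c d e, p (c ⊗ₜ ((d ⊗ₜ e) ⊗ₜ (a ⊗ₜ b)))) : p x := by
  induction x using ind₃ with
  | h0 => exact h0
  | hadd x y hx hy => exact hadd _ _ hx hy
  | ht c t u =>
    induction t with
    | zero => simpa using h0
    | add x y hx hy => simpa [TensorProduct.tmul_add, TensorProduct.add_tmul] using hadd _ _ hx hy
    | tmul d e =>
      induction u with
      | zero => simpa using h0
      | add x y hx hy => simpa [TensorProduct.tmul_add] using hadd _ _ hx hy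
      | tmul a b => exact ht _ _ _ _ _

lemma actM_homActL (x : CM k H) (y : H ⊗[k] H) (t : V →ₗ[k] W →ₗ[k] M) :
    actM V W M (x * pair (dl (bM₀ k H) (cM₀ k H)) (dM₀ k H) y) t =
      actM V W M x (homActL V (homR W M) y t) := by
  ext v w
  induction y with
  | zero => simp
  | add y z hy hz => simp only [map_add, mul_add, LinearMap.add_apply, hy, hz]
  | tmul p q =>
    rw [pair_tmul, dl_apply]
    induction x using indM with
    | h0 => simp
    | hadd x y hx hy => simp only [map_add, add_mul, LinearMap.add_apply, hx, hy]
    | ht a b c d e =>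
      rw [actM_tmul, homActL_tmul, homR_ρ]
      generalize (comul p : H ⊗[k] H) = y
      induction y with
      | zero => simp
      | add y z hy hz => simp only [map_add, mul_add, add_mul, LinearMap.add_apply, hy, hz]
      | tmul r s => simp [actM_tmul, S_mul, S_symm_mul, mul_assoc]

lemma actM_apply_apply (x : CM k H) (p q : H) (t : V →ₗ[k] W →ₗ[k] M) (v : V) (w : W) :
    actM V W M (x * (eM₀ k H q * aM₀ k H p)) t v w = actM V W M x t (V.ρ q v) (W.ρ p w) := by
  induction x using indM with
  | h0 => simp
  | hadd x y hx hy => simp only [map_add, add_mul, LinearMap.add_apply, hx, hy]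
  | ht a b c d e => simp [actM_tmul, S_mul, S_symm_mul, mul_assoc]

lemma actM_ev (x y : H ⊗[k] (H ⊗[k] H)) (t : V →ₗ[k] W →ₗ[k] M) (v : V) (w : W) :
    sandwich W M (κR k H x) (sandwich V (homR W M) (κL k H y) t v) w =
      actM V W M (leg₃ (aM₀ k H) (bM₀ k H) (cM₀ k H) x *
        leg₃ (dl (bM₀ k H) (cM₀ k H)) (dM₀ k H) (eM₀ k H) y) t v w := by
  induction y using ind₃ with
  | h0 => simp
  | hadd x y hx hy => simp only [map_add, mul_add, LinearMap.add_apply, hx, hy]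
  | ht p q r =>
    induction x using ind₃ with
    | h0 => simp
    | hadd x y hx hy => simp only [map_add, add_mul, LinearMap.add_apply, hx, hy]
    | ht a b c =>
      rw [κL_tmul, κR_tmul, sandwich_tmul, sandwich_tmul, homR_ρ, pair_tmul, pair_tmul,
        pair_tmul, pair_tmul, dl_apply]
      generalize (comul p : H ⊗[k] H) = y
      induction y with
      | zero => simp
      | add y z hy hz => simp only [map_add, mul_add, add_mul, LinearMap.add_apply, hy, hz]
      | tmul r s => simp [actM_tmul, S_symm_mul, mul_assoc]

lemma KM_ιM (x : CM k H) (p q r s : H) :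
    KM k H (ιM k H x * ((eM k H q * rM k H r) * (sM k H s * aM k H p))) =
      KM₀ k H x * (1 ⊗ₜ ((q * β k * S k H r) ⊗ₜ (S k H).symm (s * β k * S k H p))) := by
  induction x using indM with
  | h0 => simp
  | hadd x y hx hy => simp only [map_add, add_mul, hx, hy]
  | ht a b c d e => simp [KM₀, S_mul, S_symm_mul, mul_assoc]

variable (k H) in
/-- The element of `CM` that describes the two evaluations and the associator. -/
noncomputable def sMid : CM k H :=
  ph' (aM₀ k H) (bM₀ k H) (cM₀ k H) * ph (dl (bM₀ k H) (cM₀ k H)) (dM₀ k H) (eM₀ k H) *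
    ph (aM₀ k H) (dl (dl (bM₀ k H) (cM₀ k H)) (dM₀ k H)) (eM₀ k H)

lemma ιM_bcd (x : H) : dl (dl (bM k H) (cM k H)) (dM k H) x =
    ιM k H (dl (dl (bM₀ k H) (cM₀ k H)) (dM₀ k H) x) :=
  pair_map (ιM k H) (fun x => pair_map (ιM k H) (fun x => by simp [Algebra.TensorProduct.one_def]) (fun x => by simp [Algebra.TensorProduct.one_def]) (comul x))
    (fun x => by simp [Algebra.TensorProduct.one_def]) (comul x)

lemma ιM_abcd (x : H) : dl (aM k H) (dl (dl (bM k H) (cM k H)) (dM k H)) x =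
    ιM k H (dl (aM₀ k H) (dl (dl (bM₀ k H) (cM₀ k H)) (dM₀ k H)) x) :=
  pair_map (ιM k H) (fun x => by simp [Algebra.TensorProduct.one_def]) ιM_bcd (comul x)

lemma tM_eq : tM k H = ιM k H (sMid k H) *
    ph' (dl (aM k H) (dl (dl (bM k H) (cM k H)) (dM k H))) (eM k H) (rM k H) *
    ph (sM k H) (aM k H) (dl (dl (bM k H) (cM k H)) (dM k H)) := by
  have ha : ∀ x, aM k H x = ιM k H (aM₀ k H x) := fun x => by simp [Algebra.TensorProduct.one_def]
  have hb : ∀ x, bM k H x = ιM k H (bM₀ k H x) := fun x => by simp [Algebra.TensorProduct.one_def]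
  have hc : ∀ x, cM k H x = ιM k H (cM₀ k H x) := fun x => by simp [Algebra.TensorProduct.one_def]
  have hd : ∀ x, dM k H x = ιM k H (dM₀ k H x) := fun x => by simp [Algebra.TensorProduct.one_def]
  have he : ∀ x, eM k H x = ιM k H (eM₀ k H x) := fun x => by simp [Algebra.TensorProduct.one_def]
  have hbc : ∀ x, dl (bM k H) (cM k H) x = ιM k H (dl (bM₀ k H) (cM₀ k H) x) :=
    fun x => pair_map (ιM k H) hb hc (comul x)
  rw [tM, sMid, map_mul, map_mul]
  congr 2
  refine congr_arg₂ _ (congr_arg₂ _ ?_ ?_) ?_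
  · exact pair_map _ ha (fun x => pair_map _ hb hc x) _
  · exact pair_map _ hbc (fun x => pair_map _ hd he x) _
  · exact pair_map _ ha (fun x => pair_map _ ιM_bcd he x) _

variable (V W M) in
/-- The evaluation `w ⊗ (t ⊗ v) ↦ evʳ(w ⊗ evˡ(t ⊗ v))` -/
noncomputable def evevM : W ⊗[k] ((V →ₗ[k] W →ₗ[k] M) ⊗[k] V) →ₗ[k] M :=
  TensorProduct.lift ((sandwich W M (pR k H) ∘ₗ
    TensorProduct.lift (sandwich V (homR W M) (pL k H))).flip)

variable (V W M) in
/-- The evaluation `evevM` after the associativity isomorphism. -/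
noncomputable def evM : (W ⊗[k] (V →ₗ[k] W →ₗ[k] M)) ⊗[k] V →ₗ[k] M :=
  evevM V W M ∘ₗ act₃ W (homL V (homR W M)) V (Phi k H) ∘ₗ (TensorProduct.assoc k W _ V).toLinearMap

lemma evM_tmul (t : V →ₗ[k] W →ₗ[k] M) (v : V) (w : W) :
    evM V W M ((w ⊗ₜ t) ⊗ₜ v) = actM V W M (sMid k H) t v w := by
  have h : ∀ U, evevM V W M (act₃ W (homL V (homR W M)) V U (w ⊗ₜ (t ⊗ₜ v))) =
      actM V W M (ph' (aM₀ k H) (bM₀ k H) (cM₀ k H) *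
        ph (dl (bM₀ k H) (cM₀ k H)) (dM₀ k H) (eM₀ k H) *
        leg₃ (aM₀ k H) (dl (dl (bM₀ k H) (cM₀ k H)) (dM₀ k H)) (eM₀ k H) U) t v w := by
    intro U
    induction U using ind₃ with
    | h0 => simp
    | hadd x y hx hy => simp only [map_add, mul_add, LinearMap.add_apply, hx, hy]
    | ht p q r =>
      -- The legs acting on v and w go to the far right, where `actM_apply_apply` strips them off;
      -- those acting on t can then be removed by `actM_homActL`.
      have : ∀ x, x * (aM₀ k H p * (dl (dl (bM₀ k H) (cM₀ k H)) (dM₀ k H) q * eM₀ k H r)) =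
          x * dl (dl (bM₀ k H) (cM₀ k H)) (dM₀ k H) q * (eM₀ k H r * aM₀ k H p) := fun x => by
        have c₁ := CommLeg.comm (f := aM₀ k H) (g := dl (dl (bM₀ k H) (cM₀ k H)) (dM₀ k H)) p q
        have c₂ := CommLeg.comm (f := aM₀ k H) (g := eM₀ k H) p r
        rw [← mul_assoc (aM₀ k H p), c₁.eq, mul_assoc (dl _ _ _), c₂.eq, mul_assoc]
      rw [act₃, tensorAct_tmul, tensorAct_tmul, pair_tmul, pair_tmul, this,
        actM_apply_apply, homL_ρ, dl_apply, actM_homActL]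
      exact actM_ev _ _ _ _ _
  exact h _

lemma evM_act (y : H ⊗[k] H) (t : V →ₗ[k] W →ₗ[k] M) (v : V) (w : W) :
    evM V W M (tensorAct W.ρ (homL V (homR W M)).ρ y (w ⊗ₜ t) ⊗ₜ v) =
      actM V W M (sMid k H * pair (aM₀ k H) (dl (dl (bM₀ k H) (cM₀ k H)) (dM₀ k H)) y) t v w := by
  induction y with
  | zero => simp
  | add y z hy hz =>
    simp only [map_add, mul_add, LinearMap.add_apply, TensorProduct.add_tmul, hy, hz]
  | tmul p q =>
    have := actM_apply_apply (V := V) (M := M)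
      (sMid k H * dl (dl (bM₀ k H) (cM₀ k H)) (dM₀ k H) q) p 1 t v w
    rw [map_one, map_one, one_mul, Module.End.one_apply] at this
    rw [tensorAct_tmul, evM_tmul, pair_tmul, CommLeg.comm, ← mul_assoc, this, dl_apply,
      actM_homActL]
    rfl

lemma evM_tmul_act (p c b q : H) (t : V →ₗ[k] W →ₗ[k] M) (v : V) (w : W) :
    evM V W M (tensorAct (tensor W (homL V (homR W M))).ρ V.ρ (p ⊗ₜ c)
      (tensorAct W.ρ (homL V (homR W M)).ρ (b ⊗ₜ q) (w ⊗ₜ t) ⊗ₜ v)) =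
    actM V W M (sMid k H * dl (aM₀ k H) (dl (dl (bM₀ k H) (cM₀ k H)) (dM₀ k H)) p *
      dl (dl (bM₀ k H) (cM₀ k H)) (dM₀ k H) q) t (V.ρ c v) (W.ρ b w) := by
  rw [tensorAct_tmul, tensorAct_tmul, AlgHom.comp_apply, evM_act, homL_ρ, ← actM_homActL]
  rfl

/-- Gathers the legs of both coevaluations that act on v and w at the right end, the form required
by `KM_ιM`. -/
lemma tM_reorder (x : BM k H) (z : H →ₐ[k] BM k H) [CommLeg (eM k H) z] [CommLeg (rM k H) z]
    [CommLeg (sM k H) z] [CommLeg (aM k H) z] (p : BM k H) (q r s p' q' : H) :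
    x * (p * (eM k H q * rM k H r)) * (sM k H s * (aM k H p' * z q')) =
      x * p * z q' * ((eM k H q * rM k H r) * (sM k H s * aM k H p')) := by
  have h := (((CommLeg.comm (f := eM k H) (g := z) q q').mul_left
    (CommLeg.comm (f := rM k H) (g := z) r q')).mul_left
    ((CommLeg.comm (f := sM k H) (g := z) s q').mul_left
    (CommLeg.comm (f := aM k H) (g := z) p' q'))).eq
  rw [mul_assoc (x * p), ← h]
  simp only [mul_assoc]

variable (V W M) in
/-- The mixed associativity map as a linear map. -/
noncomputable def assocMLin : (V →ₗ[k] W →ₗ[k] M) →ₗ[k] W →ₗ[k] V →ₗ[k] M :=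
  Hom.lin (Biclosed.assocM V W M)

lemma assocMLin_apply (t : V →ₗ[k] W →ₗ[k] M) (v : V) (w : W) :
    assocMLin V W M t w v = evM V W M (tensorAct (tensor W (homL V (homR W M))).ρ V.ρ (qL k H)
      (tensorAct W.ρ (homL V (homR W M)).ρ (qR k H) (w ⊗ₜ t) ⊗ₜ v)) := by
  have : Biclosed.assocM V W M = ζR (T := homL V (homR W M)) (V := W) (M := homL V M)
      (ζL (T := tensor W (homL V (homR W M))) (V := V) (M := M)
        ((α_ W (homL V (homR W M)) V).hom ≫ W ◁ Biclosed.evL V (homR W M) ≫ Biclosed.evR W M)) :=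
    (curryR_eq _ _ _ _).trans (congr_arg _ (curryL_eq _ _ _ _))
  have h : Hom.lin (W ◁ Biclosed.evL V (homR W M) ≫ Biclosed.evR W M) = evevM V W M :=
    TensorProduct.ext (LinearMap.ext fun w => TensorProduct.ext' fun t v => rfl)
  rw [assocMLin, this]
  exact LinearMap.congr_fun h _

/-- Two curryings occur here, one from each adjunction, so both `qL` and `qR` enter; with the
evaluations they make up `tM`. -/
lemma assocMLin_eq (t : V →ₗ[k] W →ₗ[k] M) (v : V) (w : W) :
    assocMLin V W M t w v = bitwist V W M (elM k H) t v w := by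
  have h : ∀ U U', evM V W M (tensorAct (tensor W (homL V (homR W M))).ρ V.ρ (κL' k H U)
      (tensorAct W.ρ (homL V (homR W M)).ρ (κR' k H U') (w ⊗ₜ t) ⊗ₜ v)) =
      bitwist V W M (KM k H (ιM k H (sMid k H) *
        leg₃ (dl (aM k H) (dl (dl (bM k H) (cM k H)) (dM k H))) (eM k H) (rM k H) U *
        leg₃ (sM k H) (aM k H) (dl (dl (bM k H) (cM k H)) (dM k H)) U')) t v w := by
    intro U U'
    induction U using ind₃ with
    | h0 => simp
    | hadd x y hx hy => simp only [map_add, mul_add, add_mul, LinearMap.add_apply, hx, hy]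
    | ht p q r =>
      induction U' using ind₃ with
      | h0 => simp
      | hadd x y hx hy =>
        simp only [map_add, mul_add, TensorProduct.add_tmul, LinearMap.add_apply, hx, hy]
      | ht s p' q' =>
        rw [κL'_tmul, κR'_tmul, evM_tmul_act, pair_tmul, pair_tmul, pair_tmul, pair_tmul,
          tM_reorder, ιM_bcd, ιM_abcd, ← map_mul, ← map_mul, KM_ιM, bitwist_mul]
        simp only [S_symm_mul, LinearEquiv.symm_apply_apply, ← mul_assoc]
        rfl
  rw [assocMLin_apply, ← KM_tM, tM_eq, qL, qR, h]
  rfl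

end AssocM

end QHMod


namespace QHMod

open QHopf QuasiBialgebra QuasiHopfAlgebra Algebra.TensorProduct

set_option maxSynthPendingDepth 6
set_option linter.unusedSectionVars false

/-! ### The associativity map of Homʳ is the action of `elR` -/

section AssocR

variable {k H : Type u} [Field k] [Ring H] [Algebra k H] [QuasiHopfAlgebra k H]

variable (k H)

/-- The inclusion `f ⊗ (e ⊗ (c ⊗ d)) ↦ f ⊗ (e ⊗ (1 ⊗ (1 ⊗ (c ⊗ d))))` in `BR`. -/
noncomputable abbrev ιR : H ⊗[k] (H ⊗[k] (H ⊗[k] H)) →ₐ[k] BR k H :=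
  Algebra.TensorProduct.map (AlgHom.id k H)
    (Algebra.TensorProduct.map (AlgHom.id k H) (includeRight.comp includeRight))

/-- `f ⊗ (e ⊗ y) ↦ f ⊗ Δ(S⁻¹(α e)) y` -/
noncomputable def KR₀ : H ⊗[k] (H ⊗[k] (H ⊗[k] H)) →ₗ[k] H ⊗[k] (H ⊗[k] H) :=
  (mulWith ((comul : H →ₐ[k] H ⊗[k] H).toLinearMap ∘ₗ (S k H).symm.toLinearMap ∘ₗ
    LinearMap.mulLeft k (α k)) 1 LinearMap.id).lTensor H

variable {k H} {V W M : QHMod k H}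

lemma bitwist_curry (a : H) (y : H ⊗[k] H) (g : V ⊗[k] W →ₗ[k] M) (v : V) (w : W) :
    bitwist V W M (a ⊗ₜ y) (TensorProduct.curry g) v w =
      M.ρ a (g (tensorAct V.ρ W.ρ y (v ⊗ₜ w))) := by
  induction y with
  | zero => simp
  | add x y hx hy => simp only [TensorProduct.tmul_add, map_add, LinearMap.add_apply, hx, hy]
  | tmul b c => rfl

variable (V W M) in
/-- The action of `f ⊗ (e ⊗ (c ⊗ d))`, `g ↦ (v, w) ↦ f g(S⁻¹(α e) (c v ⊗ d w))`. -/
noncomputable def actR : H ⊗[k] (H ⊗[k] (H ⊗[k] H)) →ₗ[k]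
    (V ⊗[k] W →ₗ[k] M) →ₗ[k] V →ₗ[k] W →ₗ[k] M :=
  LinearMap.lcomp k _ (TensorProduct.lcurry (.id k) V W M) ∘ₗ bitwist V W M ∘ₗ KR₀ k H

lemma actR_eq (x : H ⊗[k] (H ⊗[k] (H ⊗[k] H))) (g : V ⊗[k] W →ₗ[k] M) :
    actR V W M x g = bitwist V W M (KR₀ k H x) (TensorProduct.curry g) := rfl

lemma actR_tmul (c d e f : H) (g : V ⊗[k] W →ₗ[k] M) (v : V) (w : W) :
    actR V W M (f ⊗ₜ (e ⊗ₜ (c ⊗ₜ d))) g v w =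
      M.ρ f (g ((tensor V W).ρ ((S k H).symm (α k * e)) (V.ρ c v ⊗ₜ W.ρ d w))) := by
  rw [actR_eq, KR₀, LinearMap.lTensor_tmul, bitwist_curry, mulWith_tmul, mul_one, map_mul]
  rfl

lemma actR_homActR (x : H ⊗[k] (H ⊗[k] (H ⊗[k] H))) (y : H ⊗[k] H) (g : V ⊗[k] W →ₗ[k] M) :
    actR V W M (x * pair (l₂ k H) (l₁ k H) y) g =
      actR V W M x (homActR (tensor V W) M y g) := by
  ext v w
  induction y with
  | zero => simp
  | add y z hy hz => simp only [map_add, mul_add, LinearMap.add_apply, hy, hz]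
  | tmul p q =>
    induction x using ind₄ with
    | h0 => simp
    | hadd x y hx hy => simp only [map_add, add_mul, LinearMap.add_apply, hx, hy]
    | ht f e c d =>
      have h : f ⊗ₜ (e ⊗ₜ (c ⊗ₜ d)) * (l₂ k H p * l₁ k H q) =
          (f * q) ⊗ₜ[k] ((e * p) ⊗ₜ[k] (c ⊗ₜ[k] d)) := by simp
      rw [pair_tmul, h, actR_tmul, actR_tmul, homActR_tmul, ← mul_assoc, S_symm_mul, map_mul,
        map_mul]
      rfl

lemma actR_apply_apply (x : H ⊗[k] (H ⊗[k] (H ⊗[k] H))) (p q : H) (g : V ⊗[k] W →ₗ[k] M) (v : V)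
    (w : W) :
    actR V W M (x * (l₃ k H p * l₄ k H q)) g v w = actR V W M x g (V.ρ p v) (W.ρ q w) := by
  induction x using ind₄ with
  | h0 => simp
  | hadd x y hx hy => simp only [map_add, add_mul, LinearMap.add_apply, hx, hy]
  | ht f e c d =>
    have h : f ⊗ₜ (e ⊗ₜ (c ⊗ₜ d)) * (l₃ k H p * l₄ k H q) =
        f ⊗ₜ[k] (e ⊗ₜ[k] ((c * p) ⊗ₜ[k] (d * q))) := by simp
    rw [h, actR_tmul, actR_tmul, map_mul V.ρ, map_mul W.ρ]
    rfl

/-- An element acts on V ⊗ W through its coproduct, so one evaluation at the tensor product uses the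
compound leg of the third and fourth factors. -/
lemma actR_ev (x : H ⊗[k] (H ⊗[k] H)) (g : V ⊗[k] W →ₗ[k] M) (v : V) (w : W) :
    sandwich (tensor V W) M (κR k H x) g (v ⊗ₜ w) =
      actR V W M (leg₃ (dl (l₃ k H) (l₄ k H)) (l₂ k H) (l₁ k H) x) g v w := by
  induction x using ind₃ with
  | h0 => simp
  | hadd x y hx hy => simp only [map_add, LinearMap.add_apply, hx, hy]
  | ht x y z =>
    have h : ((S k H).symm y * (S k H).symm (α k) * x) = (S k H).symm (α k * y) * x := by
      rw [S_symm_mul]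
    rw [κR_tmul, sandwich_tmul, h, map_mul, pair_tmul, pair_tmul, dl_apply, Module.End.mul_apply,
      AlgHom.comp_apply (tensorAct V.ρ W.ρ) comul x]
    generalize (comul x : H ⊗[k] H) = t
    induction t with
    | zero => simp
    | add s t hs ht => simp only [map_add, add_mul, LinearMap.add_apply, hs, ht]
    | tmul p q =>
      have h : pair (l₃ k H) (l₄ k H) (p ⊗ₜ q) * (l₂ k H y * l₁ k H z) =
          z ⊗ₜ[k] (y ⊗ₜ[k] (p ⊗ₜ[k] q)) := by simp
      rw [h, actR_tmul]
      rfl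

lemma KR_ιR (x : H ⊗[k] (H ⊗[k] (H ⊗[k] H))) (p q r s : H) :
    KR k H (ιR k H x * ((bR k H p * cR k H q) * (aR k H r * dR k H s))) =
      KR₀ k H x * (1 ⊗ₜ ((S k H).symm (p * β k * S k H q) ⊗ₜ (S k H).symm (r * β k * S k H s))) := by
  induction x using ind₄ with
  | h0 => simp
  | hadd x y hx hy => simp only [map_add, add_mul, hx, hy]
  | ht f e c d =>
    have h : ιR k H (f ⊗ₜ (e ⊗ₜ (c ⊗ₜ d))) * ((bR k H p * cR k H q) * (aR k H r * dR k H s)) =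
        f ⊗ₜ (e ⊗ₜ (r ⊗ₜ (p ⊗ₜ ((c * q) ⊗ₜ (d * s))))) := by simp
    rw [h, KR_tmul, KR₀, LinearMap.lTensor_tmul, mulWith_tmul, δmap_tmul]
    simp [S_mul, S_symm_mul, mul_assoc]

variable (k H) in
/-- The element of `H⁴` that describes the evaluation and the associator. -/
noncomputable def sR : H ⊗[k] (H ⊗[k] (H ⊗[k] H)) :=
  ph' (dl (l₃ k H) (l₄ k H)) (l₂ k H) (l₁ k H) *
    ph' (l₃ k H) (l₄ k H) (dl (l₂ k H) (l₁ k H))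

lemma ιR_ef (x : H) : dl (eR k H) (fR k H) x = ιR k H (dl (l₂ k H) (l₁ k H) x) :=
  pair_map (ιR k H) (fun x => by simp [Algebra.TensorProduct.one_def])
    (fun x => by simp [Algebra.TensorProduct.one_def]) (comul x)

lemma ιR_def (x : H) : dl (dR k H) (dl (eR k H) (fR k H)) x =
    ιR k H (dl (l₄ k H) (dl (l₂ k H) (l₁ k H)) x) :=
  pair_map (ιR k H) (fun x => by simp) ιR_ef (comul x)

lemma tR_eq : tR k H = ιR k H (sR k H) *
    ph (bR k H) (cR k H) (dl (dR k H) (dl (eR k H) (fR k H))) *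
    ph (aR k H) (dR k H) (dl (eR k H) (fR k H)) := by
  have hc : ∀ x, cR k H x = ιR k H (l₃ k H x) := fun x => by simp
  have hd : ∀ x, dR k H x = ιR k H (l₄ k H x) := fun x => by simp
  have he : ∀ x, eR k H x = ιR k H (l₂ k H x) := fun x => by
    simp [Algebra.TensorProduct.one_def]
  have hf : ∀ x, fR k H x = ιR k H (l₁ k H x) := fun x => by
    simp [Algebra.TensorProduct.one_def]
  have hcd : ∀ x, dl (cR k H) (dR k H) x = ιR k H (dl (l₃ k H) (l₄ k H) x) :=
    fun x => pair_map (ιR k H) hc hd (comul x)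
  rw [tR, sR, map_mul]
  congr 2
  refine congr_arg₂ _ ?_ ?_
  · exact pair_map _ hcd (fun x => pair_map _ he hf x) _
  · exact pair_map _ hc (fun x => pair_map _ hd ιR_ef x) _

variable (V W M) in
/-- The evaluation `(v ⊗ w) ⊗ g ↦ evʳ((v ⊗ w) ⊗ g)` after the inverse associativity isomorphism. -/
noncomputable def evR₂ : V ⊗[k] (W ⊗[k] (V ⊗[k] W →ₗ[k] M)) →ₗ[k] M :=
  TensorProduct.lift (sandwich (tensor V W) M (pR k H)).flip ∘ₗ
    (TensorProduct.assoc k V W _).symm.toLinearMap ∘ₗ act₃ V W (homR (tensor V W) M) (PhiInv k H)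

lemma evR₂_tmul (g : V ⊗[k] W →ₗ[k] M) (v : V) (w : W) :
    evR₂ V W M (v ⊗ₜ (w ⊗ₜ g)) = actR V W M (sR k H) g v w := by
  have h : ∀ U, TensorProduct.lift (sandwich (tensor V W) M (pR k H)).flip
      ((TensorProduct.assoc k V W _).symm
        (act₃ V W (homR (tensor V W) M) U (v ⊗ₜ (w ⊗ₜ g)))) =
      actR V W M (ph' (dl (l₃ k H) (l₄ k H)) (l₂ k H) (l₁ k H) *
        leg₃ (l₃ k H) (l₄ k H) (dl (l₂ k H) (l₁ k H)) U) g v w := by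
    intro U
    induction U using ind₃ with
    | h0 => simp
    | hadd x y hx hy => simp only [map_add, mul_add, LinearMap.add_apply, hx, hy]
    | ht p q r =>
      have : ∀ x, x * (l₃ k H p * (l₄ k H q * dl (l₂ k H) (l₁ k H) r)) =
          x * dl (l₂ k H) (l₁ k H) r * (l₃ k H p * l₄ k H q) := fun x => by
        have c₁ := CommLeg.comm (f := l₃ k H) (g := dl (l₂ k H) (l₁ k H)) p r
        have c₂ := CommLeg.comm (f := l₄ k H) (g := dl (l₂ k H) (l₁ k H)) q r
        rw [← mul_assoc (l₃ k H p), (c₁.mul_left c₂).eq, ← mul_assoc]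
      rw [act₃, tensorAct_tmul, tensorAct_tmul, pair_tmul, pair_tmul, this,
        actR_apply_apply, homR_ρ, dl_apply, actR_homActR, TensorProduct.assoc_symm_tmul]
      exact actR_ev _ _ _ _
  exact h _

lemma evR₂_act (y : H ⊗[k] H) (g : V ⊗[k] W →ₗ[k] M) (v : V) (w : W) :
    evR₂ V W M (v ⊗ₜ tensorAct W.ρ (homR (tensor V W) M).ρ y (w ⊗ₜ g)) =
      actR V W M (sR k H * pair (l₄ k H) (dl (l₂ k H) (l₁ k H)) y) g v w := by
  induction y with
  | zero => simp
  | add y z hy hz =>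
    simp only [map_add, mul_add, LinearMap.add_apply, TensorProduct.tmul_add, hy, hz]
  | tmul p q =>
    have := actR_apply_apply (V := V) (M := M) (sR k H * dl (l₂ k H) (l₁ k H) q) 1 p g v w
    rw [map_one, map_one, one_mul, Module.End.one_apply] at this
    rw [tensorAct_tmul, evR₂_tmul, pair_tmul, CommLeg.comm, ← mul_assoc, this, dl_apply,
      actR_homActR]
    rfl

lemma evR₂_tmul_act (p c b q : H) (g : V ⊗[k] W →ₗ[k] M) (v : V) (w : W) :
    evR₂ V W M (tensorAct V.ρ (tensor W (homR (tensor V W) M)).ρ (c ⊗ₜ p)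
      (v ⊗ₜ tensorAct W.ρ (homR (tensor V W) M).ρ (b ⊗ₜ q) (w ⊗ₜ g))) =
    actR V W M (sR k H * dl (l₄ k H) (dl (l₂ k H) (l₁ k H)) p * dl (l₂ k H) (l₁ k H) q) g
      (V.ρ c v) (W.ρ b w) := by
  rw [tensorAct_tmul, tensorAct_tmul, AlgHom.comp_apply, evR₂_act, homR_ρ, ← actR_homActR]
  rfl

lemma tR_reorder (x : BR k H) (z z' : H →ₐ[k] BR k H) [CommLeg (bR k H) z] [CommLeg (cR k H) z]
    [CommLeg (aR k H) z'] [CommLeg (bR k H) z'] [CommLeg (cR k H) z'] [CommLeg (dR k H) z']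
    (p q r s p' q' : H) :
    x * (bR k H p * (cR k H q * z r)) * (aR k H s * (dR k H p' * z' q')) =
      x * z r * z' q' * ((bR k H p * cR k H q) * (aR k H s * dR k H p')) := by
  have h := ((CommLeg.comm (f := bR k H) (g := z) p r).mul_left
    (CommLeg.comm (f := cR k H) (g := z) q r)).eq
  have h' := (((CommLeg.comm (f := bR k H) (g := z') p q').mul_left
    (CommLeg.comm (f := cR k H) (g := z') q q')).mul_left
    ((CommLeg.comm (f := aR k H) (g := z') s q').mul_left
    (CommLeg.comm (f := dR k H) (g := z') p' q'))).eq
  rw [mul_assoc (x * z r), ← h', ← mul_assoc (bR k H p), h]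
  simp only [mul_assoc]

variable (V W M) in
/-- The associativity map of `Homʳ` as a linear map. -/
noncomputable def assocRLin : (V ⊗[k] W →ₗ[k] M) →ₗ[k] W →ₗ[k] V →ₗ[k] M :=
  Hom.lin (Biclosed.assocR V W M)

lemma assocRLin_apply (g : V ⊗[k] W →ₗ[k] M) (v : V) (w : W) :
    assocRLin V W M g w v = evR₂ V W M (tensorAct V.ρ (tensor W (homR (tensor V W) M)).ρ (qR k H)
      (v ⊗ₜ tensorAct W.ρ (homR (tensor V W) M).ρ (qR k H) (w ⊗ₜ g))) := by
  have : Biclosed.assocR V W M = ζR (T := homR (tensor V W) M) (V := W) (M := homR V M)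
      (ζR (T := tensor W (homR (tensor V W) M)) (V := V) (M := M)
        ((α_ V W (homR (tensor V W) M)).inv ≫ Biclosed.evR (tensor V W) M)) :=
    (curryR_eq _ _ _ _).trans (congr_arg _ (curryR_eq _ _ _ _))
  have h : Hom.lin (Biclosed.evR (tensor V W) M) =
      TensorProduct.lift (sandwich (tensor V W) M (pR k H)).flip :=
    TensorProduct.ext' fun v g => rfl
  rw [assocRLin, this]
  exact LinearMap.congr_fun h _

/-- Both curryings use `qR`, the inner one for V and the outer one for W; after reordering, all legs
make up `tR`. -/
lemma assocRLin_eq (g : V ⊗[k] W →ₗ[k] M) (v : V) (w : W) :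
    assocRLin V W M g w v = bitwist V W M (elR k H) (TensorProduct.curry g) v w := by
  have h : ∀ U U', evR₂ V W M (tensorAct V.ρ (tensor W (homR (tensor V W) M)).ρ (κR' k H U)
      (v ⊗ₜ tensorAct W.ρ (homR (tensor V W) M).ρ (κR' k H U') (w ⊗ₜ g))) =
      bitwist V W M (KR k H (ιR k H (sR k H) *
        leg₃ (bR k H) (cR k H) (dl (dR k H) (dl (eR k H) (fR k H))) U *
        leg₃ (aR k H) (dR k H) (dl (eR k H) (fR k H)) U')) (TensorProduct.curry g) v w := by
    intro U U'
    induction U using ind₃ with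
    | h0 => simp
    | hadd x y hx hy => simp only [map_add, mul_add, add_mul, LinearMap.add_apply, hx, hy]
    | ht p q r =>
      induction U' using ind₃ with
      | h0 => simp
      | hadd x y hx hy =>
        simp only [map_add, mul_add, TensorProduct.tmul_add, LinearMap.add_apply, hx, hy]
      | ht s p' q' =>
        rw [κR'_tmul, κR'_tmul, evR₂_tmul_act, pair_tmul, pair_tmul, pair_tmul, pair_tmul,
          tR_reorder, ιR_ef, ιR_def, ← map_mul, ← map_mul, KR_ιR, bitwist_mul]
        simp only [S_symm_mul, LinearEquiv.symm_apply_apply, ← mul_assoc]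
        rfl
  rw [assocRLin_apply, ← KR_tR, tR_eq, qR, h]
  rfl

end AssocR

end QHMod


namespace QHopf

open QuasiBialgebra QuasiHopfAlgebra

/-! ### The counit on α, β and the antipode -/

section Counit

set_option maxSynthPendingDepth 6

variable {k H : Type u} [Field k] [Ring H] [Algebra k H] [QuasiHopfAlgebra k H]

lemma counit_mα (w : H ⊗[k] H) : (counit (mα k H w) : k) =
    counit (α k : H) * counit (S k H (epsR k H H w)) := by
  induction w with
  | zero => simp
  | add x y hx hy => simp only [map_add, mul_add, hx, hy]
  | tmul a b => simp; ring

/-- This is ε applied to S(h¹) α h² = ε(h) α. The factor ε(α) can be cancelled only after ε(β) ε(α)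
= 1 is known, and the proof of that identity already needs the present form. -/
lemma counit_S_mul (h : H) : (counit (α k : H) : k) * counit (S k H h) =
    counit (α k : H) * counit h := by
  have := counit_mα (comul h : H ⊗[k] H)
  rw [epsR_comul, mα_comul] at this
  rw [← this, map_smul, smul_eq_mul, mul_comm]

lemma counit_f₃ (U : H ⊗[k] (H ⊗[k] H)) : (counit (f₃ k H U) : k) =
    counit (β k : H) * (counit (α k : H) *
      counit (epsR k H H (Algebra.TensorProduct.map (AlgHom.id k H) (epsR k H H) U))) := by
  induction U using ind₃ with
  | h0 => simp
  | hadd x y hx hy => simp only [map_add, mul_add, hx, hy]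
  | ht a b c =>
    have := counit_S_mul (k := k) b
    simp only [f₃_tmul, mα_tmul, map_mul, Algebra.TensorProduct.map_tmul, AlgHom.coe_id, id_eq,
      epsR_tmul, map_smul, smul_eq_mul]
    linear_combination (counit a * counit (β k : H) * counit c : k) * this

/-- The counit of X β S(Y) α Z = 1, because Φ becomes trivial when ε is applied to its slots. -/
lemma counit_β_mul_counit_α : (counit (β k : H) * counit (α k : H) : k) = 1 := by
  have := counit_f₃ (Phi k H)
  rw [f₃_Phi, epsR_Phi, map_one, map_one, map_one, mul_one] at this
  exact this.symm

lemma counit_S (h : H) : (counit (S k H h) : k) = counit h := by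
  have h₀ : (counit (α k : H) : k) ≠ 0 :=
    right_ne_zero_of_mul_eq_one (counit_β_mul_counit_α (k := k) (H := H))
  exact mul_left_cancel₀ h₀ (counit_S_mul h)

end Counit

end QHopf

namespace QHMod

open QHopf QuasiBialgebra QuasiHopfAlgebra

set_option maxSynthPendingDepth 6
set_option linter.unusedSectionVars false

/-! ### Functoriality of the internal homs in the source, and orbit maps -/

section Precomposition

variable {k H : Type u} [Field k] [Ring H] [Algebra k H] [QuasiHopfAlgebra k H]

/-- Precomposition with `f`, as a map of left internal homs. -/
noncomputable def precompL {V V' : QHMod k H} (f : V ⟶ V') (M : QHMod k H) :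
    homL V' M ⟶ homL V M :=
  ⟨LinearMap.lcomp k M f.lin, fun _ φ => (sandwich_comp f (𝟙 M) _ φ).symm⟩

/-- Precomposition with `f`, as a map of right internal homs. -/
noncomputable def precompR {V V' : QHMod k H} (f : V ⟶ V') (M : QHMod k H) :
    homR V' M ⟶ homR V M :=
  ⟨LinearMap.lcomp k M f.lin, fun _ φ => (sandwich_comp f (𝟙 M) _ φ).symm⟩

/-- The abstract map is determined by its transpose under the adjunction, and an H-linear f commutes
with the elements of H that occur in the evaluation. -/
lemma preL_eq {V V' : QHMod k H} (f : V ⟶ V') (M : QHMod k H) :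
    Biclosed.preL f M = precompL f M := by
  refine (curryL_eq _ _ _ _).trans ((homEquivL (homL V' M) V M).symm_apply_eq.mp ?_).symm
  refine hom_ext (TensorProduct.ext' fun φ v => ?_)
  exact LinearMap.congr_fun (sandwich_comp f (𝟙 M) (pL k H) φ) v

lemma preR_eq {V V' : QHMod k H} (f : V ⟶ V') (M : QHMod k H) :
    Biclosed.preR f M = precompR f M := by
  refine (curryR_eq _ _ _ _).trans ((homEquivR (homR V' M) V M).symm_apply_eq.mp ?_).symm
  refine hom_ext (TensorProduct.ext' fun v φ => ?_)
  exact LinearMap.congr_fun (sandwich_comp f (𝟙 M) (pR k H) φ) v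

/-- The `H`-linear map `H → V`, `h ↦ h v`. -/
noncomputable def orbit (V : QHMod k H) (v : V) : regular k H ⟶ V :=
  ⟨LinearMap.applyₗ v ∘ₗ V.ρ.toLinearMap, fun h x => by simp⟩

@[simp] lemma orbit_apply (V : QHMod k H) (v : V) (h : H) : (orbit V v).lin h = V.ρ h v := rfl

lemma orbit_one (V : QHMod k H) (v : V) : (orbit V v).lin (1 : H) = v := by
  rw [orbit_apply, map_one, Module.End.one_apply]

lemma orbit_regular_one : (orbit (regular k H) (1 : H)).lin = LinearMap.id :=
  LinearMap.ext fun h => mul_one h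

lemma orbit_comp {V V' : QHMod k H} (f : V ⟶ V') (v : V) :
    f.lin ∘ₗ (orbit V v).lin = (orbit V' (f.lin v)).lin :=
  LinearMap.ext fun h => f.comm h v

variable {V W M : QHMod k H}

/-- On k the element S(Y) α Z acts by its counit, and Φ is trivial under ε. The factor ε(α) that
remains is the reason for ε(β) in the third contramodule axiom. -/
lemma unitL_apply (φ : k →ₗ[k] M) :
    Hom.lin (Biclosed.unitL M) φ = (counit (α k : H) : k) • φ 1 := by
  have h : ∀ U, sandwich (unit k H) M (κL k H U) φ 1 = (counit (α k : H) : k) •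
      M.ρ (epsR k H H (Algebra.TensorProduct.map (AlgHom.id k H) (epsR k H H) U)) (φ 1) := by
    intro U
    induction U using ind₃ with
    | h0 => simp
    | hadd x y hx hy => simp only [map_add, LinearMap.add_apply, smul_add, hx, hy]
    | ht a b c =>
      have : φ ((unit k H).ρ (S k H b * α k * c) 1) =
          ((counit (α k : H) : k) * (counit b * counit c)) • φ 1 := by
        rw [← map_smul]
        congr 1
        simp [counit_S]
        ring
      rw [κL_tmul, sandwich_tmul, this]
      simp [mul_smul]
      congr 1
      exact smul_comm _ _ _
  have := h (Phi k H)
  rw [epsR_Phi, map_one (epsR k H H), map_one M.ρ, Module.End.one_apply] at this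
  exact this

end Precomposition

/-! ### The family τ defined by ν, and the hexagon -/

section Tau

variable {k H : Type u} [Field k] [Ring H] [Algebra k H] [QuasiHopfAlgebra k H]
  {V W V' W' M M' : QHMod k H}

/-- The map `v ⊗ f ↦ ν(x ↦ f(x v))`. -/
noncomputable def coev (ν : (H →ₗ[k] M) →ₗ[k] M) (V : QHMod k H) :
    V ⊗[k] (V →ₗ[k] M) →ₗ[k] M :=
  TensorProduct.lift (LinearMap.mk₂ k (fun v f => ν (f ∘ₗ LinearMap.applyₗ v ∘ₗ V.ρ.toLinearMap))
    (fun v v' f => by simp [LinearMap.comp_add, LinearMap.add_comp])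
    (fun c v f => by simp [LinearMap.comp_smul, LinearMap.smul_comp])
    (fun v f f' => by simp [LinearMap.add_comp])
    (fun c v f => by simp [LinearMap.smul_comp]))

lemma coev_tmul (ν : (H →ₗ[k] M) →ₗ[k] M) (v : V) (f : V →ₗ[k] M) :
    coev ν V (v ⊗ₜ f) = ν (f ∘ₗ (orbit V v).lin) := rfl

lemma tau_apply (ν : (H →ₗ[k] M) →ₗ[k] M) (v : V) (f : V →ₗ[k] M) :
    tau ν V f v = ν (twist M (kappaElt k H) (f ∘ₗ (orbit V v).lin)) := rfl

/-- For y = Δ(h) this computes `coev` on h(v ⊗ f) and so turns H-linearity into the first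
contramodule axiom; for y = `qR` it produces Z¹ and κ. -/
lemma coev_act (ν : (H →ₗ[k] M) →ₗ[k] M) (y : H ⊗[k] H) (v : V) (f : V →ₗ[k] M) :
    coev ν V (tensorAct V.ρ (homL V M).ρ y (v ⊗ₜ f)) =
      ν (twist M (cyc k H (idΔ k H y)) (f ∘ₗ (orbit V v).lin)) := by
  induction y with
  | zero => simp
  | add x y hx hy => simp only [map_add, LinearMap.add_apply, hx, hy]
  | tmul a b =>
    rw [tensorAct_tmul, coev_tmul, idΔ_tmul, homL_ρ]
    congr 1
    generalize (comul b : H ⊗[k] H) = t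
    induction t with
    | zero => ext; simp
    | add s t hs ht =>
      simp only [map_add, TensorProduct.tmul_add, LinearMap.add_apply, LinearMap.add_comp, hs, ht]
    | tmul p q =>
      refine LinearMap.ext fun x => ?_
      change M.ρ p (f (V.ρ (S k H q) (V.ρ x (V.ρ a v)))) = M.ρ p (f (V.ρ (S k H q * x * a) v))
      simp

lemma tau_eq_coev (ν : (H →ₗ[k] M) →ₗ[k] M) (v : V) (f : V →ₗ[k] M) :
    tau ν V f v = coev ν V (tensorAct V.ρ (homL V M).ρ (qR k H) (v ⊗ₜ f)) :=
  (coev_act ν (qR k H) v f).symm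

/-- Naturality costs nothing: f enters only through orbits, and an H-linear map carries the orbit of
v to that of g(v). No axiom on ν is involved. -/
lemma tau_comp (ν : (H →ₗ[k] M) →ₗ[k] M) (g : V ⟶ V') (v : V) (f : V' →ₗ[k] M) :
    tau ν V (f ∘ₗ g.lin) v = tau ν V' f (g.lin v) := by
  rw [tau_apply, tau_apply, LinearMap.comp_assoc, orbit_comp]

lemma twist_comp (t : M ⟶ M') (x : H ⊗[k] (H ⊗[k] H)) (φ : H →ₗ[k] M) :
    t.lin ∘ₗ twist M x φ = twist M' x (t.lin ∘ₗ φ) := by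
  induction x using ind₃ with
  | h0 => simp
  | hadd x y hx hy => simp only [map_add, LinearMap.add_apply, LinearMap.comp_add, hx, hy]
  | ht a b c => exact LinearMap.ext fun x => t.comm _ _

lemma bitwist_comp (x : H ⊗[k] (H ⊗[k] H)) (f : V ⟶ V') (g : W ⟶ W')
    (s : V' →ₗ[k] W' →ₗ[k] M) (v : V) (w : W) :
    bitwist V W M x (LinearMap.lcomp k M g.lin ∘ₗ s ∘ₗ f.lin) v w =
      bitwist V' W' M x s (f.lin v) (g.lin w) := by
  induction x using ind₃ with
  | h0 => simp
  | hadd x y hx hy => simp only [map_add, LinearMap.add_apply, hx, hy]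
  | ht a b c =>
    rw [bitwist_tmul, bitwist_tmul, ← f.comm, ← g.comm]
    rfl

/-- The two sides of the hexagon axiom, for a family of maps given by `ν`. -/
def HexagonAt (ν : (H →ₗ[k] M) →ₗ[k] M) (V W : QHMod k H) (t : V →ₗ[k] W →ₗ[k] M) (v : V) (w : W) :
    Prop :=
  tau ν V ((bitwist V W M (elM k H) (tau ν W ∘ₗ t)).flip w) v =
    bitwist V W M (elR k H) (TensorProduct.curry
      (tau ν (tensor V W) (TensorProduct.lift (bitwist V W M (elL k H) t)))) v w

/-- All ingredients, the actions of `elL`, `elM`, `elR` and the maps `tau`, are compatible with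
precomposition by H-linear maps. Hence an instance of the hexagon can be pushed forward along f and
g. -/
lemma HexagonAt.comp {ν : (H →ₗ[k] M) →ₗ[k] M} {f : V ⟶ V'} {g : W ⟶ W'}
    {t : V' →ₗ[k] W' →ₗ[k] M} {v : V} {w : W}
    (h : HexagonAt ν V W (LinearMap.lcomp k M g.lin ∘ₗ t ∘ₗ f.lin) v w) :
    HexagonAt ν V' W' t (f.lin v) (g.lin w) := by
  have h₁ : tau ν W ∘ₗ LinearMap.lcomp k M g.lin ∘ₗ t ∘ₗ f.lin =
      LinearMap.lcomp k M g.lin ∘ₗ (tau ν W' ∘ₗ t) ∘ₗ f.lin :=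
    LinearMap.ext fun a => LinearMap.ext fun b => tau_comp ν g b _
  have h₂ : (bitwist V W M (elM k H)
      (LinearMap.lcomp k M g.lin ∘ₗ (tau ν W' ∘ₗ t) ∘ₗ f.lin)).flip w =
      (bitwist V' W' M (elM k H) (tau ν W' ∘ₗ t)).flip (g.lin w) ∘ₗ f.lin :=
    LinearMap.ext fun a => bitwist_comp _ f g _ a w
  have h₃ : TensorProduct.lift (bitwist V W M (elL k H)
      (LinearMap.lcomp k M g.lin ∘ₗ t ∘ₗ f.lin)) =
      TensorProduct.lift (bitwist V' W' M (elL k H) t) ∘ₗ (tensorMap f g).lin :=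
    TensorProduct.ext' fun a b => bitwist_comp _ f g _ a b
  have h₄ : TensorProduct.curry (tau ν (tensor V W)
      (TensorProduct.lift (bitwist V' W' M (elL k H) t) ∘ₗ (tensorMap f g).lin)) =
      LinearMap.lcomp k M g.lin ∘ₗ TensorProduct.curry (tau ν (tensor V' W')
        (TensorProduct.lift (bitwist V' W' M (elL k H) t))) ∘ₗ f.lin :=
    LinearMap.ext fun a => LinearMap.ext fun b => tau_comp ν (tensorMap f g) (a ⊗ₜ[k] b) _
  rw [HexagonAt, h₁, h₂, h₃, h₄, bitwist_comp, tau_comp] at h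
  exact h

/-- Any v and w are the images of 1 under orbit maps, so the case of the regular module is
universal. -/
lemma hexagonAt_of_regular {ν : (H →ₗ[k] M) →ₗ[k] M}
    (h : ∀ t, HexagonAt ν (regular k H) (regular k H) t (1 : H) (1 : H))
    (t : V →ₗ[k] W →ₗ[k] M) (v : V) (w : W) : HexagonAt ν V W t v w := by
  have := (h (LinearMap.lcomp k M (orbit W w).lin ∘ₗ t ∘ₗ (orbit V v).lin)).comp
  rwa [orbit_one, orbit_one] at this

lemma hexagonAt_regular_iff (ν : (H →ₗ[k] M) →ₗ[k] M) (f : H →ₗ[k] H →ₗ[k] M) :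
    HexagonAt ν (regular k H) (regular k H) f (1 : H) (1 : H) ↔
    tau ν (regular k H) ((twist₂ M (elM k H) (tau ν (regular k H) ∘ₗ f)).flip 1) 1 =
      twist₂ M (elR k H) (TensorProduct.curry
        (tau ν (tensor (regular k H) (regular k H))
          (TensorProduct.lift (twist₂ M (elL k H) f)))) 1 1 := by
  rw [HexagonAt, bitwist_regular, bitwist_regular, bitwist_regular]

lemma hom_eq_iff {X Y : QHMod k H} (l r : X ⟶ Y) {a b : X → Y} (hl : ∀ t, l.lin t = a t)
    (hr : ∀ t, r.lin t = b t) : l = r ↔ ∀ t, a t = b t := by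
  constructor
  · rintro rfl t
    rw [← hl, hr]
  · exact fun h => hom_ext (LinearMap.ext fun t => by rw [hl, hr, h])

/-- The only place where the three explicit associativity maps meet. The flips appear because the
iterated right hom takes its argument from W before the one from V. -/
lemma hexagon_iff (τ : ∀ V : QHMod k H, homL V M ⟶ homR V M) (ν : (H →ₗ[k] M) →ₗ[k] M)
    (hτ : ∀ V, (τ V).lin = tau ν V) (V W : QHMod k H) :
    ((Biclosed.homL V).map (τ W) ≫ Biclosed.assocM V W M ≫ (Biclosed.homR W).map (τ V) =
      Biclosed.assocL V W M ≫ τ (V ⊗ W) ≫ Biclosed.assocR V W M) ↔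
    ∀ t v w, HexagonAt ν V W t v w := by
  have h₁ : ∀ (t : V →ₗ[k] W →ₗ[k] M), (assocMLin V W M) t =
      (bitwist V W M (elM k H) t).flip := fun t =>
    LinearMap.ext fun w => LinearMap.ext fun v => assocMLin_eq t v w
  have h₂ : ∀ (t : V →ₗ[k] W →ₗ[k] M), (assocLLin V W M) t =
      TensorProduct.lift (bitwist V W M (elL k H) t) := fun t =>
    TensorProduct.ext' fun v w => assocLLin_tmul t v w
  have hl : ∀ (t : V →ₗ[k] W →ₗ[k] M), Hom.lin ((Biclosed.homL V).map (τ W) ≫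
      Biclosed.assocM V W M ≫ (Biclosed.homR W).map (τ V)) t =
      tau ν V ∘ₗ (bitwist V W M (elM k H) (tau ν W ∘ₗ t)).flip := fun t => by
    rw [← h₁, ← hτ, ← hτ]
    rfl
  have hr : ∀ (t : V →ₗ[k] W →ₗ[k] M), Hom.lin (Biclosed.assocL V W M ≫ τ (V ⊗ W) ≫
      Biclosed.assocR V W M) t = (bitwist V W M (elR k H) (TensorProduct.curry
        (tau ν (tensor V W) (TensorProduct.lift (bitwist V W M (elL k H) t))))).flip := fun t => by
    rw [← h₂, ← hτ]
    exact LinearMap.ext fun w => LinearMap.ext fun v => assocRLin_eq _ v w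
  refine (hom_eq_iff _ _ hl hr).trans (forall_congr' fun t => ⟨fun e v w => ?_, fun h => ?_⟩)
  · exact LinearMap.congr_fun (LinearMap.congr_fun e w) v
  · exact LinearMap.ext fun w => LinearMap.ext fun v => h v w

end Tau

end QHMod


namespace QHMod

open QHopf QuasiBialgebra QuasiHopfAlgebra

/-! ### The unit axiom -/

section UnitAxiom

set_option maxSynthPendingDepth 6

variable {k H : Type u} [Field k] [Ring H] [Algebra k H] [QuasiHopfAlgebra k H] {M : QHMod k H}

lemma unitR_ηR (g : homL (unit k H) M ⟶ homR (unit k H) M) (φ : k →ₗ[k] M) :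
    Hom.lin (g ≫ Biclosed.unitR M) φ = (ηR g).lin ((1 : k) ⊗ₜ[k] φ) := by
  have h : Hom.lin (Biclosed.evR (unit k H) M) ((1 : k) ⊗ₜ[k] g.lin φ) =
      sandwich (unit k H) M (pR k H) (g.lin φ) (1 : k) := evR_apply _ _ _ _
  exact h

/-- The left composite is φ ↦ ν(x ↦ ε(x) φ(1)) and the right map is φ ↦ ε(α) φ(1); multiplying by
the inverse scalars ε(β) and ε(α) passes between the two conditions. -/
lemma unit_axiom_iff (ν : (H →ₗ[k] M) →ₗ[k] M) (g : homL (unit k H) M ⟶ homR (unit k H) M)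
    (hg : (ηR g).lin = coev ν (unit k H)) :
    g ≫ Biclosed.unitR M = Biclosed.unitL M ↔
      ∀ m : M, ν ((counit (β k : H) : k) • (counit : H →ₐ[k] k).toLinearMap.smulRight m) = m := by
  have h : ∀ φ : k →ₗ[k] M, Hom.lin (g ≫ Biclosed.unitR M) φ =
      ν ((counit : H →ₐ[k] k).toLinearMap.smulRight (φ 1)) := fun φ => by
    rw [unitR_ηR, hg, coev_tmul]
    congr 1
    refine LinearMap.ext fun x => ?_
    change φ ((counit x : k) * 1) = (counit x : k) • φ 1
    rw [← map_smul, smul_eq_mul]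
  have hβα := counit_β_mul_counit_α (k := k) (H := H)
  refine (hom_eq_iff _ _ h unitL_apply).trans ⟨fun e m => ?_, fun e φ => ?_⟩
  -- The axiom is tested on the linear map k → M whose value at 1 is m.
  · have := e (LinearMap.toSpanSingleton k M m)
    rw [LinearMap.toSpanSingleton_apply, one_smul] at this
    rw [map_smul, this, smul_smul, hβα, one_smul]
  · have := e (φ 1)
    rw [map_smul] at this
    conv_rhs => rw [← this, smul_smul, mul_comm, hβα, one_smul]

lemma coev_one_tmul (ν : (H →ₗ[k] M) →ₗ[k] M) (f : H →ₗ[k] M) :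
    coev ν (regular k H) ((1 : H) ⊗ₜ[k] f) = ν f := by
  rw [coev_tmul, orbit_regular_one]
  rfl

end UnitAxiom

end QHMod

/-! ### From contramodules to the weak center -/

namespace AYDContramoduleII

open QHopf QHMod QuasiBialgebra QuasiHopfAlgebra

variable {k H : Type u} [Field k] [Ring H] [Algebra k H] [QuasiHopfAlgebra k H]

/-- The `H`-linear map `v ⊗ f ↦ ν(x ↦ f(x v))`. -/
noncomputable def coevHom (X : AYDContramoduleII k H) (V : QHMod k H) :
    tensor V (homL V X.M) ⟶ X.M where
  lin := coev X.ν V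
  comm := fun h (x : V ⊗[k] (V →ₗ[k] X.M)) => by
    induction x with
    | zero => simp
    | add x y hx hy => simp only [map_add, hx, hy]
    | tmul v f =>
      rw [AlgHom.comp_apply, coev_act, ← X.aYD]
      rfl

/-- The structure maps of the object of the weak center. -/
noncomputable def tauHom (X : AYDContramoduleII k H) (V : QHMod k H) :
    homL V X.M ⟶ homR V X.M :=
  ζR (T := homL V X.M) (coevHom X V)

lemma tauHom_lin (X : AYDContramoduleII k H) (V : QHMod k H) : (X.tauHom V).lin = tau X.ν V :=
  LinearMap.ext fun f => LinearMap.ext fun v => (tau_eq_coev X.ν v f).symm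

lemma ηR_tauHom (X : AYDContramoduleII k H) (V : QHMod k H) : ηR (X.tauHom V) = coevHom X V :=
  (homEquivR (homL V X.M) V X.M).left_inv (coevHom X V)

lemma tauHom_naturality (X : AYDContramoduleII k H) {V V' : QHMod k H} (f : V ⟶ V') :
    Biclosed.preL f X.M ≫ X.tauHom V = X.tauHom V' ≫ Biclosed.preR f X.M := by
  rw [preL_eq, preR_eq]
  refine hom_ext (LinearMap.ext fun φ => LinearMap.ext fun v => ?_)
  change (X.tauHom V).lin (φ ∘ₗ f.lin) v = (X.tauHom V').lin φ (f.lin v)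
  rw [tauHom_lin, tauHom_lin]
  exact tau_comp X.ν f v φ

/-- The object of the weak center associated with a contramodule. -/
noncomputable def toWeakCenterObj (X : AYDContramoduleII k H) : WeakCenter (QHMod k H) where
  M := X.M
  τ := X.tauHom
  naturality := X.tauHom_naturality
  hexagon V W := (hexagon_iff X.tauHom X.ν X.tauHom_lin V W).mpr fun t v w =>
    hexagonAt_of_regular (fun f => (hexagonAt_regular_iff X.ν f).mpr (X.contra f)) t v w
  unit := (unit_axiom_iff X.ν (X.tauHom (QHMod.unit k H))
    (congr_arg Hom.lin (X.ηR_tauHom _))).mpr X.unit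

lemma tau_comp_lin {X Y : AYDContramoduleII k H} (f : X ⟶ Y) (V : QHMod k H) (φ : V →ₗ[k] X.M) :
    tau Y.ν V (f.t.lin ∘ₗ φ) = f.t.lin ∘ₗ tau X.ν V φ := by
  refine LinearMap.ext fun v => ?_
  rw [LinearMap.comp_apply, tau_apply, tau_apply, f.comm, twist_comp, LinearMap.comp_assoc]

variable (k H) in
/-- The functor from contramodules to the weak center. -/
noncomputable def toWeakCenter : AYDContramoduleII k H ⥤ WeakCenter (QHMod k H) where
  obj X := X.toWeakCenterObj
  map {X Y} f := ⟨f.t, fun V => by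
    refine hom_ext (LinearMap.ext fun φ => ?_)
    change (Y.tauHom V).lin (f.t.lin ∘ₗ φ) = f.t.lin ∘ₗ (X.tauHom V).lin φ
    rw [tauHom_lin, tauHom_lin]
    exact tau_comp_lin f V φ⟩

end AYDContramoduleII

/-! ### From the weak center to contramodules -/

namespace WeakCenter

open QHopf QHMod QuasiBialgebra QuasiHopfAlgebra

variable {k H : Type u} [Field k] [Ring H] [Algebra k H] [QuasiHopfAlgebra k H]

lemma nuLin_apply (Y : WeakCenter (QHMod k H)) (f : H →ₗ[k] Y.M) :
    Y.nuLin f = sandwich (regular k H) Y.M (pR k H) (Y.tauLin (regular k H) f) (1 : H) := rfl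

/-- The Yoneda step: naturality of τ along the orbit map of v expresses the transpose of τ_V at v ⊗
f by its value at 1 ⊗ (x ↦ f(x v)) over the regular module, which is ν. -/
lemma ηR_τ (Y : WeakCenter (QHMod k H)) (V : QHMod k H) :
    Hom.lin (ηR (T := homL V Y.M) (Y.τ V)) = coev Y.nuLin V := by
  refine TensorProduct.ext' fun v f => ?_
  have h : Y.tauLin (regular k H) (f ∘ₗ (orbit V v).lin) = Y.tauLin V f ∘ₗ (orbit V v).lin := by
    have := Y.naturality (orbit V v)
    rw [preL_eq, preR_eq] at this
    exact congr_arg (fun g => Hom.lin g f) this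
  have h' := sandwich_comp (orbit V v) (𝟙 Y.M) (pR k H) (Y.tauLin V f)
  rw [coev_tmul, nuLin_apply, h]
  refine Eq.trans ?_ (LinearMap.congr_fun h' (1 : H)).symm
  change _ = sandwich V Y.M (pR k H) (Y.tauLin V f) ((orbit V v).lin (1 : H))
  rw [orbit_one]
  rfl

/-- Transposing `ηR_τ` back through the adjunction recovers τ from ν. This is one half of the
bijection on objects, and it also lets `hexagon_iff` be applied to an arbitrary object of the weak
center. -/
lemma tauLin_eq (Y : WeakCenter (QHMod k H)) (V : QHMod k H) : Y.tauLin V = tau Y.nuLin V := by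
  refine LinearMap.ext fun f => LinearMap.ext fun v => ?_
  have h : ζR (ηR (T := homL V Y.M) (Y.τ V)) = Y.τ V :=
    (homEquivR (homL V Y.M) V Y.M).right_inv (Y.τ V)
  rw [tau_eq_coev, ← ηR_τ]
  exact congr_arg (fun g : homL V Y.M ⟶ homR V Y.M => g.lin f v) h.symm

lemma nuLin_aYD (Y : WeakCenter (QHMod k H)) (h : H) (f : H →ₗ[k] Y.M) :
    Y.M.ρ h (Y.nuLin f) = Y.nuLin (twist Y.M (cyc k H (idΔ k H (comul h))) f) := by
  have h₁ := (ηR (T := homL (regular k H) Y.M) (Y.τ (regular k H))).comm h ((1 : H) ⊗ₜ[k] f)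
  have h₂ := coev_act (V := regular k H) Y.nuLin (comul h) (1 : H) f
  rw [orbit_regular_one] at h₂
  rw [ηR_τ] at h₁
  rw [coev_tmul, orbit_regular_one] at h₁
  exact h₁.symm.trans h₂

lemma nuLin_contra (Y : WeakCenter (QHMod k H)) (f : H →ₗ[k] H →ₗ[k] Y.M) :
    tau Y.nuLin (regular k H) ((twist₂ Y.M (elM k H) (tau Y.nuLin (regular k H) ∘ₗ f)).flip 1) 1 =
      twist₂ Y.M (elR k H) (TensorProduct.curry
        (tau Y.nuLin (tensor (regular k H) (regular k H))
          (TensorProduct.lift (twist₂ Y.M (elL k H) f)))) 1 1 :=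
  (hexagonAt_regular_iff Y.nuLin f).mp
    ((hexagon_iff Y.τ Y.nuLin Y.tauLin_eq (regular k H) (regular k H)).mp (Y.hexagon _ _) f _ _)

/-- The contramodule associated with an object of the weak center. -/
noncomputable def toContramoduleObj (Y : WeakCenter (QHMod k H)) : AYDContramoduleII k H where
  M := Y.M
  ν := Y.nuLin
  aYD := Y.nuLin_aYD
  contra := Y.nuLin_contra
  unit := (unit_axiom_iff Y.nuLin (Y.τ (QHMod.unit k H)) (Y.ηR_τ (QHMod.unit k H))).mp Y.unit

lemma nuLin_comp_lin {X Y : WeakCenter (QHMod k H)} (f : X ⟶ Y) (φ : H →ₗ[k] X.M) :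
    f.t.lin (X.nuLin φ) = Y.nuLin (f.t.lin ∘ₗ φ) := by
  have h : Y.tauLin (regular k H) (f.t.lin ∘ₗ φ) = f.t.lin ∘ₗ X.tauLin (regular k H) φ :=
    congr_arg (fun g => Hom.lin g φ) (f.comm (regular k H))
  have h' := sandwich_comp (𝟙 (regular k H)) f.t (pR k H) (X.tauLin (regular k H) φ)
  rw [nuLin_apply, nuLin_apply, h]
  exact (LinearMap.congr_fun h' (1 : H)).symm

variable (k H) in
/-- The functor from the weak center to contramodules. -/
noncomputable def toContramodule : WeakCenter (QHMod k H) ⥤ AYDContramoduleII k H where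
  obj Y := Y.toContramoduleObj
  map f := ⟨f.t, nuLin_comp_lin f⟩

end WeakCenter

/-! ### The two functors are mutually inverse -/

section Isomorphism

open QHopf QHMod

variable {k H : Type u} [Field k] [Ring H] [Algebra k H] [QuasiHopfAlgebra k H]

/-- Equality of functors on morphisms is stated with transports along equalities of objects; this
lemma and the next bring them down to the underlying modules. -/
lemma AYDContramoduleII.eqToHom_t {X Y : AYDContramoduleII k H} (h : X = Y) :
    (eqToHom h : X ⟶ Y).t = eqToHom (congr_arg AYDContramoduleII.M h) := by
  subst h
  rfl

lemma WeakCenter.eqToHom_t {X Y : WeakCenter (QHMod k H)} (h : X = Y) :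
    (eqToHom h : X ⟶ Y).t = eqToHom (congr_arg WeakCenter.M h) := by
  subst h
  rfl

lemma AYDContramoduleII.nuLin_toWeakCenterObj (X : AYDContramoduleII k H) (f : H →ₗ[k] X.M) :
    X.toWeakCenterObj.nuLin f = X.ν f := by
  have h := congr_arg Hom.lin (X.ηR_tauHom (regular k H))
  exact (LinearMap.congr_fun h ((1 : H) ⊗ₜ[k] f)).trans (coev_one_tmul X.ν f)

lemma AYDContramoduleII.toContramoduleObj_toWeakCenterObj (X : AYDContramoduleII k H) :
    X.toWeakCenterObj.toContramoduleObj = X := by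
  have h : X.toWeakCenterObj.nuLin = X.ν := LinearMap.ext X.nuLin_toWeakCenterObj
  obtain ⟨M, ν, h₁, h₂, h₃⟩ := X
  unfold WeakCenter.toContramoduleObj
  -- Apart from M, which is unchanged, and ν, handled by h, all fields are proofs.
  congr 1

lemma WeakCenter.toWeakCenterObj_toContramoduleObj (Y : WeakCenter (QHMod k H)) :
    Y.toContramoduleObj.toWeakCenterObj = Y := by
  have h : Y.toContramoduleObj.tauHom = Y.τ := by
    funext V
    exact hom_ext ((Y.toContramoduleObj.tauHom_lin V).trans (Y.tauLin_eq V).symm)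
  obtain ⟨M, τ, h₁, h₂, h₃⟩ := Y
  unfold AYDContramoduleII.toWeakCenterObj
  congr 1

end Isomorphism

theorem mainTheorem2 (k H : Type u) [Field k] [Ring H] [Algebra k H] [QuasiHopfAlgebra k H] :
    ∃ (F : AYDContramoduleII k H ⥤ WeakCenter (QHMod k H))
      (G : WeakCenter (QHMod k H) ⥤ AYDContramoduleII k H),
      F ⋙ G = 𝟭 (AYDContramoduleII k H) ∧
      G ⋙ F = 𝟭 (WeakCenter (QHMod k H)) ∧
      F ⋙ WeakCenter.forget (QHMod k H) = AYDContramoduleII.forget k H ∧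
      G ⋙ AYDContramoduleII.forget k H = WeakCenter.forget (QHMod k H) ∧
      (∀ X : AYDContramoduleII k H,
        ∃ (τ : ∀ V : QHMod k H, QHMod.homL V X.M ⟶ QHMod.homR V X.M) (h₁ : _) (h₂ : _) (h₃ : _),
          F.obj X = WeakCenter.mk X.M τ h₁ h₂ h₃ ∧ ∀ V, (τ V).lin = QHopf.tau X.ν V) ∧
      (∀ Y : WeakCenter (QHMod k H), ∃ (h₁ : _) (h₂ : _) (h₃ : _),
        G.obj Y = AYDContramoduleII.mk Y.M Y.nuLin h₁ h₂ h₃) := by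
  refine ⟨AYDContramoduleII.toWeakCenter k H, WeakCenter.toContramodule k H, ?_, ?_, rfl, rfl,
    fun X => ⟨X.tauHom, X.toWeakCenterObj.naturality, X.toWeakCenterObj.hexagon,
      X.toWeakCenterObj.unit, rfl, X.tauHom_lin⟩,
    fun Y => ⟨Y.nuLin_aYD, Y.nuLin_contra, Y.toContramoduleObj.unit, rfl⟩⟩
  · refine CategoryTheory.Functor.ext AYDContramoduleII.toContramoduleObj_toWeakCenterObj
      fun X Y f => AYDContramoduleII.Hom.ext ?_
    -- The round trip leaves the module unchanged definitionally, so the transport on it is along an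
    -- equality of X.M with itself and is the identity.
    have e₁ : (eqToHom X.toContramoduleObj_toWeakCenterObj).t = 𝟙 X.M := AYDContramoduleII.eqToHom_t _
    have e₂ : (eqToHom Y.toContramoduleObj_toWeakCenterObj.symm).t = 𝟙 Y.M := AYDContramoduleII.eqToHom_t _
    exact ((congr_arg₂ (fun (a : X.M ⟶ X.M) (b : Y.M ⟶ Y.M) => a ≫ f.t ≫ b) e₁ e₂).trans
      ((Category.id_comp _).trans (Category.comp_id _))).symm
  · refine CategoryTheory.Functor.ext WeakCenter.toWeakCenterObj_toContramoduleObj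
      fun X Y f => WeakCenter.Hom.ext ?_
    have e₁ : (eqToHom X.toWeakCenterObj_toContramoduleObj).t = 𝟙 X.M := WeakCenter.eqToHom_t _
    have e₂ : (eqToHom Y.toWeakCenterObj_toContramoduleObj.symm).t = 𝟙 Y.M := WeakCenter.eqToHom_t _
    exact ((congr_arg₂ (fun (a : X.M ⟶ X.M) (b : Y.M ⟶ Y.M) => a ≫ f.t ≫ b) e₁ e₂).trans
      ((Category.id_comp _).trans (Category.comp_id _))).symm
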